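/- For integers $r\ge 0$, $s\ge 0$ with $r+s\le n$ let $$\mathbb B^n_{r,s}=\Big\{[z_0,\dots,z_n]\in\mathbb P^n:\ \sum_{i=0}^{r}|z_i|^2>\sum_{j=r+1}^{r+s}|z_j|^2\Big\}\subset\mathbb P^n ,$$ where $\mathbb P^n$ is the complex projective space, and for $0\le r'\le m$ let $\mathbb B^m_{r'}=\mathbb B^m_{r',m-r'}$ be the ordinary generalized ball in $\mathbb P^m$. Let $\partial$ denote the topological boundary, and let $\mathrm{Aut}(\mathbb B^m_{r'})$ be the group of automorphisms of $\mathbb B^m_{r'}$, given by the invertible linear maps of $\mathbb C^{m+1}$ whose action on $\mathbb P^m$ maps $\mathbb B^m_{r'}$ onto itself (so each of them acts on all of $\mathbb P^m$). Theorem. Let $1\le r'\le r<s$, $r+s\le n$ and $r'\le m$, and let $U\subset\mathbb P^n$ be a connected open set such that $U\cap\partial\mathbb B^n_{r,s}\ne\emptyset$. Suppose that $f:U\to\mathbb P^m$ is a holomorphic map with $f(U\cap\mathbb B^n_{r,s})\subset\mathbb B^m_{r'}$ and $f(U\cap\partial\mathbb B^n_{r,s})\subset\partial\mathbb B^m_{r'}$.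 Then $r=r'$, $r+s\le m$, and there is $\Phi\in\mathrm{Aut}(\mathbb B^m_{r'})$ such that for every $[z_0,\dots,z_n]\in U$ the numbers $z_0,\dots,z_{r+s}$ are not all zero and $$\Phi\circ f([z_0,\dots,z_n])=[z_0,\dots,z_{r+s},0,\dots,0]\in\mathbb P^m .$$ In particular, if $r+s<n$, then $f$ is totally degenerate: for every $p\in U$ the differential $df_p:T_p\mathbb P^n\to T_{f(p)}\mathbb P^m$ is not injective. -/

import Mathlib

open scoped LinearAlgebra.Projectivization Manifold ContDiff Pointwise

noncomputable section

/-- Complex projective space `ℙⁿ`, the set of lines through `0` in `ℂⁿ⁺¹`. -/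
abbrev CP (n : ℕ) : Type := ℙ ℂ (Fin (n + 1) → ℂ)

namespace CP

variable {n : ℕ}

/-- The point `[z₀, …, zₙ]` with the given homogeneous coordinates. -/
abbrev mk (z : Fin (n + 1) → ℂ) (hz : z ≠ 0) : CP n := Projectivization.mk ℂ z hz

/-- `ℙⁿ` carries the quotient topology from `ℂⁿ⁺¹ ∖ {0}`. -/
instance : TopologicalSpace (CP n) :=
  TopologicalSpace.coinduced
    (fun z : {z : Fin (n + 1) → ℂ // z ≠ 0} => mk z.1 z.2) inferInstance

theorem isQuotientMap_mk :
    Topology.IsQuotientMap (fun z : {z : Fin (n + 1) → ℂ // z ≠ 0} => mk z.1 z.2) :=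
  ⟨⟨rfl⟩, fun p => ⟨⟨p.rep, p.rep_nonzero⟩, p.mk_rep⟩⟩

/-- Every representative of `[z]` is a nonzero multiple of `z`. -/
theorem exists_rep_eq (z : Fin (n + 1) → ℂ) (hz : z ≠ 0) :
    ∃ a : ℂ, a ≠ 0 ∧ (mk z hz).rep = a • z := by
  obtain ⟨a, ha⟩ := Projectivization.exists_smul_eq_mk_rep ℂ z hz
  exact ⟨a, a.ne_zero, ha.symm⟩

/-- The affine coordinates `(z_j / z_i)_{j ≠ i}` on `{z_i ≠ 0}`. -/
def coord (i : Fin (n + 1)) (p : CP n) : Fin n → ℂ :=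
  fun j => p.rep (i.succAbove j) / p.rep i

/-- The inverse of the `i`-th affine chart, which puts a `1` in position `i`. -/
def ofCoord (i : Fin (n + 1)) (w : Fin n → ℂ) : CP n :=
  mk (i.insertNth (1 : ℂ) w) fun h => one_ne_zero (α := ℂ) (by simpa using congrFun h i)

theorem coord_mk (i : Fin (n + 1)) (z : Fin (n + 1) → ℂ) (hz : z ≠ 0) :
    coord i (mk z hz) = fun j => z (i.succAbove j) / z i := by
  obtain ⟨a, ha, h⟩ := exists_rep_eq z hz
  funext j
  simp only [coord, h, Pi.smul_apply, smul_eq_mul]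
  exact mul_div_mul_left _ _ ha

theorem rep_mk_ne_zero_iff (i : Fin (n + 1)) (z : Fin (n + 1) → ℂ) (hz : z ≠ 0) :
    (mk z hz).rep i ≠ 0 ↔ z i ≠ 0 := by
  obtain ⟨a, ha, h⟩ := exists_rep_eq z hz
  simp [h, ha]

theorem isOpen_affine (i : Fin (n + 1)) : IsOpen {p : CP n | p.rep i ≠ 0} := by
  rw [← isQuotientMap_mk.isOpen_preimage]
  have : (fun z : {z : Fin (n + 1) → ℂ // z ≠ 0} => mk z.1 z.2) ⁻¹' {p : CP n | p.rep i ≠ 0}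
      = {z | z.1 i ≠ 0} := by
    ext z
    exact rep_mk_ne_zero_iff i z.1 z.2
  rw [this]
  exact isOpen_ne_fun ((continuous_apply i).comp continuous_subtype_val) continuous_const

/-- The `i`-th affine chart `{z_i ≠ 0} → ℂⁿ`. -/
def chart (i : Fin (n + 1)) : OpenPartialHomeomorph (CP n) (Fin n → ℂ) where
  toFun := coord i
  invFun := ofCoord i
  source := {p | p.rep i ≠ 0}
  target := Set.univ
  map_source' _ _ := Set.mem_univ _
  map_target' w _ := (rep_mk_ne_zero_iff i _ _).2 (by simp)
  left_inv' p hp := by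
    induction p using Projectivization.ind with
    | h z hz =>
      have hp' : z i ≠ 0 := (rep_mk_ne_zero_iff i z hz).1 hp
      rw [coord_mk i z hz]
      refine (Projectivization.mk_eq_mk_iff' ℂ _ _ _ _).2 ⟨(z i)⁻¹, ?_⟩
      funext k
      rcases Fin.eq_self_or_eq_succAbove i k with rfl | ⟨j, rfl⟩
      · simp [hp']
      · simp [div_eq_inv_mul]
  right_inv' w _ := by
    rw [ofCoord, coord_mk]
    funext j
    simp
  open_source := isOpen_affine i
  open_target := isOpen_univ
  continuousOn_toFun := by
    rw [isQuotientMap_mk.continuousOn_isOpen_iff (isOpen_affine i)]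
    have : (coord i ∘ fun z : {z : Fin (n + 1) → ℂ // z ≠ 0} => mk z.1 z.2)
        = fun z j => z.1 (i.succAbove j) / z.1 i := by
      funext z
      exact coord_mk i z.1 z.2
    rw [this]
    refine continuousOn_pi.2 fun j => ContinuousOn.div ?_ ?_ ?_
    · exact ((continuous_apply _).comp continuous_subtype_val).continuousOn
    · exact ((continuous_apply _).comp continuous_subtype_val).continuousOn
    · exact fun z hz => (rep_mk_ne_zero_iff i z.1 z.2).1 hz
  continuousOn_invFun := by
    refine Continuous.continuousOn ?_
    have hc : Continuous fun w : Fin n → ℂ => i.insertNth (α := fun _ => ℂ) (1 : ℂ) w :=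
      continuous_const.finInsertNth i continuous_id
    exact isQuotientMap_mk.continuous.comp (hc.subtype_mk
      fun w h => one_ne_zero (α := ℂ) (by simpa using congrFun h i))

theorem exists_rep_ne_zero (p : CP n) : ∃ i, p.rep i ≠ 0 :=
  Function.ne_iff.1 p.rep_nonzero

/-- The standard atlas of `ℙⁿ`, consisting of the `n + 1` affine charts. -/
instance : ChartedSpace (Fin n → ℂ) (CP n) where
  atlas := Set.range chart
  chartAt p := chart (exists_rep_ne_zero p).choose
  mem_chart_source p := (exists_rep_ne_zero p).choose_spec
  chart_mem_atlas _ := Set.mem_range_self _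

/-- With the affine charts, `ℙⁿ` is a complex manifold. -/
instance : IsManifold 𝓘(ℂ, Fin n → ℂ) ω (CP n) := by
  refine isManifold_of_contDiffOn _ _ _ ?_
  rintro _ _ ⟨i, rfl⟩ ⟨k, rfl⟩
  have hins : ∀ l : Fin (n + 1),
      ContDiff ℂ ω fun w : Fin n → ℂ => i.insertNth (α := fun _ => ℂ) (1 : ℂ) w l := by
    intro l
    rcases Fin.eq_self_or_eq_succAbove i l with rfl | ⟨j, rfl⟩
    · simpa using contDiff_const
    · simpa using contDiff_apply ℂ ℂ j
  have hfun : (𝓘(ℂ, Fin n → ℂ) ∘ ((chart i).symm ≫ₕ chart k) ∘ 𝓘(ℂ, Fin n → ℂ).symm)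
      = fun (w : Fin n → ℂ) (j : Fin n) =>
        i.insertNth (α := fun _ => ℂ) (1 : ℂ) w (k.succAbove j) /
          i.insertNth (α := fun _ => ℂ) (1 : ℂ) w k := by
    funext w
    exact coord_mk k _ _
  rw [hfun]
  refine contDiffOn_pi.2 fun j =>
    ((hins _).contDiffOn).div ((hins _).contDiffOn) ?_
  rintro w ⟨hw, -⟩
  have h2 : ofCoord i w ∈ {p : CP n | p.rep k ≠ 0} := hw.2
  exact (rep_mk_ne_zero_iff k _ _).1 h2

end CP

/-- The generalized ball
`𝔹ⁿ_{r,s} = {[z₀, …, zₙ] : ∑_{i = 0}^{r} |z_i|² > ∑_{j = r+1}^{r+s} |z_j|²}` in `ℙⁿ`. -/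
def genBall (n r s : ℕ) : Set (CP n) :=
  {p | ∃ (z : Fin (n + 1) → ℂ) (hz : z ≠ 0), p = CP.mk z hz ∧
    ∑ j : Fin (n + 1) with r < j.val ∧ j.val ≤ r + s, ‖z j‖ ^ 2
      < ∑ i : Fin (n + 1) with i.val ≤ r, ‖z i‖ ^ 2}

/-- The ordinary generalized ball
`𝔹ⁿ_r = {[z₀, …, zₙ] : ∑_{i = 0}^{r} |z_i|² > ∑_{j = r+1}^{n} |z_j|²}` in `ℙⁿ`. -/
def ordBall (n r : ℕ) : Set (CP n) :=
  {p | ∃ (z : Fin (n + 1) → ℂ) (hz : z ≠ 0), p = CP.mk z hz ∧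
    ∑ j : Fin (n + 1) with r < j.val, ‖z j‖ ^ 2
      < ∑ i : Fin (n + 1) with i.val ≤ r, ‖z i‖ ^ 2}

/-- Membership in the ball may be tested on any homogeneous coordinates of the point. -/
theorem mk_mem_genBall_iff {n r s : ℕ} (z : Fin (n + 1) → ℂ) (hz : z ≠ 0) :
    CP.mk z hz ∈ genBall n r s ↔
      ∑ j : Fin (n + 1) with r < j.val ∧ j.val ≤ r + s, ‖z j‖ ^ 2
        < ∑ i : Fin (n + 1) with i.val ≤ r, ‖z i‖ ^ 2 := by
  refine ⟨?_, fun h => ⟨z, hz, rfl, h⟩⟩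
  rintro ⟨w, hw, h, hlt⟩
  obtain ⟨a, rfl⟩ := (Projectivization.mk_eq_mk_iff' ℂ z w hz hw).1 h
  have ha : a ≠ 0 := by
    rintro rfl
    simp at hz
  simp only [Pi.smul_apply, smul_eq_mul, norm_mul, mul_pow, ← Finset.mul_sum]
  exact mul_lt_mul_of_pos_left hlt (by positivity)

/-- An ordinary generalized ball is the generalized ball with `r + s = n`. -/
theorem ordBall_eq_genBall {n r s : ℕ} (h : r + s = n) : ordBall n r = genBall n r s := by
  have key : ∀ j : Fin (n + 1), (r < j.val ∧ j.val ≤ r + s) ↔ r < j.val :=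
    fun j => by have := j.2; omega
  simp only [ordBall, genBall, key]

/-- The automorphisms of `𝔹ᵐ_r`, as the linear automorphisms of `ℂᵐ⁺¹` whose action on `ℙᵐ`
maps `𝔹ᵐ_r` onto itself. Such a map is biholomorphic on all of `ℙᵐ`, so it can be composed with
maps whose values lie outside `𝔹ᵐ_r`. -/
def ballAut (m r : ℕ) : Subgroup (LinearMap.GeneralLinearGroup ℂ (Fin (m + 1) → ℂ)) :=
  MulAction.stabilizer (LinearMap.GeneralLinearGroup ℂ (Fin (m + 1) → ℂ)) (ordBall m r)

/-- The vector `(z₀, …, z_k, 0, …, 0)` in `ℂᵐ⁺¹`; used for `k ≤ n` and `k ≤ m`. -/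
def truncate {n : ℕ} (m k : ℕ) (z : Fin (n + 1) → ℂ) : Fin (m + 1) → ℂ :=
  fun j => if h : (j : ℕ) ≤ k ∧ (j : ℕ) < n + 1 then z ⟨j, h.2⟩ else 0

end

/-!
Work with the diagonal Hermitian form `H` of signature `(r + 1, s)`, with a radical of dimension
`n - r - s`, on the source and the nondegenerate form `H'` of signature `(r' + 1, m - r')` on the
target, and with a holomorphic lift `F` of `f` near a boundary point outside the radical.

* Null vectors go to null vectors. By polarization along holomorphic curves whose real points
  are null, orthogonal vectors go to orthogonal vectors, even when they are not null
  (`eventually_orthogonal`).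
* A null line of the source (the span of two orthogonal null vectors) has `r - 1` orthonormal
  positive directions orthogonal to it. Moving one point of the line slightly in these directions
  gives points that `F` sends to `r - 1` mutually orthogonal positive vectors, orthogonal to the image
  of the line, which is null. If that image spanned three dimensions, then the index
  `r' + 1 ≤ r + 1` of `H'` would be exceeded. Thus null lines go into lines
  (`not_linearIndependent_of_null`).
* Null lines form a real-analytic family, and through every pair of vectors that spans a nearby
  line there is, after a change of basis, a holomorphic curve of pairs that spans a null line for
  real values of the parameter (`exists_null_curve`).
  Vanishing of the `3 × 3` minors therefore propagates to all nearby lines (`exists_ball_minor3`).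
  This step needs a pair of positive and a pair of negative directions.
* The image is not contained in a line (`exists_independent_images`), so `F` is a local
  holomorphic collineation, and comparing `F` with its differential at one point shows that it is
  proportional to a linear map (`exists_linear_of_collinear`). The polarized boundary condition makes
  this map conformal, and after rescaling it is an isometry `A` from `H` to `H'`
  (`exists_isometry_near`).
* Comparing signatures gives `r = r'` and `r + s ≤ m`, and the extension theorem for isometries shows
  that `A` is the truncation followed by a unitary map of `H'` (`exists_isometry_truncate`).
* The identity theorem carries `f = [A]` from a neighbourhood to all of `U`
  (`agreesAt_of_eventually`), and `A` cannot vanish over `U`, because `[A]` has different limits along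
  different directions at its centre (`map_ne_zero_of_agreesAt`). If `r + s < n`, then the truncation
  contracts lines, so the differential has a kernel.
-/

open scoped ComplexConjugate
open Filter Topology

/-! ### Diagonal Hermitian forms -/

section Herm

variable {ι κ : Type*} [Fintype ι] [Fintype κ]

/-- The diagonal Hermitian form `∑ εᵢ zᵢ w̄ᵢ` on `ℂ^ι`, linear in `z` and antilinear in `w`. -/
noncomputable def herm (ε : ι → ℝ) (z w : ι → ℂ) : ℂ := ∑ i, (ε i : ℂ) * (z i * conj (w i))

/-- The real quadratic form `∑ εᵢ |zᵢ|²` of `herm ε`. -/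
noncomputable def hermSq (ε : ι → ℝ) (z : ι → ℂ) : ℝ := ∑ i, ε i * ‖z i‖ ^ 2

variable (ε : ι → ℝ)

theorem herm_self (z : ι → ℂ) : herm ε z z = (hermSq ε z : ℂ) := by
  simp [herm, hermSq, Complex.mul_conj, Complex.normSq_eq_norm_sq]

theorem herm_conj (z w : ι → ℂ) : conj (herm ε z w) = herm ε w z := by
  simp only [herm, map_sum, map_mul, Complex.conj_ofReal, Complex.conj_conj]
  exact Finset.sum_congr rfl fun i _ => by ring

theorem herm_add_left (x y w : ι → ℂ) : herm ε (x + y) w = herm ε x w + herm ε y w := by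
  simp only [herm, ← Finset.sum_add_distrib, Pi.add_apply]
  exact Finset.sum_congr rfl fun i _ => by ring

theorem herm_smul_left (c : ℂ) (x w : ι → ℂ) : herm ε (c • x) w = c * herm ε x w := by
  simp only [herm, Finset.mul_sum, Pi.smul_apply, smul_eq_mul]
  exact Finset.sum_congr rfl fun i _ => by ring

theorem herm_add_right (x y w : ι → ℂ) : herm ε w (x + y) = herm ε w x + herm ε w y := by
  rw [← herm_conj, herm_add_left, map_add, herm_conj, herm_conj]

theorem herm_smul_right (c : ℂ) (x w : ι → ℂ) : herm ε w (c • x) = conj c * herm ε w x := by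
  rw [← herm_conj, herm_smul_left, map_mul, herm_conj]

theorem herm_sub_left (x y w : ι → ℂ) : herm ε (x - y) w = herm ε x w - herm ε y w := by
  rw [sub_eq_add_neg, ← neg_one_smul ℂ y, herm_add_left, herm_smul_left]; ring

theorem herm_sub_right (x y w : ι → ℂ) : herm ε w (x - y) = herm ε w x - herm ε w y := by
  rw [← herm_conj, herm_sub_left, map_sub, herm_conj, herm_conj]

@[simp] theorem herm_zero_left (w : ι → ℂ) : herm ε 0 w = 0 := by simp [herm]

@[simp] theorem herm_zero_right (w : ι → ℂ) : herm ε w 0 = 0 := by simp [herm]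

theorem herm_sum_left {α : Type*} (s : Finset α) (x : α → ι → ℂ) (w : ι → ℂ) :
    herm ε (∑ a ∈ s, x a) w = ∑ a ∈ s, herm ε (x a) w := by
  classical
  induction s using Finset.induction_on with
  | empty => simp
  | insert a s ha ih => rw [Finset.sum_insert ha, Finset.sum_insert ha, herm_add_left, ih]

theorem herm_sum_right {α : Type*} (s : Finset α) (x : α → ι → ℂ) (w : ι → ℂ) :
    herm ε w (∑ a ∈ s, x a) = ∑ a ∈ s, herm ε w (x a) := by
  rw [← herm_conj, herm_sum_left, map_sum]
  simp only [herm_conj]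

theorem herm_eq_zero_symm {z w : ι → ℂ} (h : herm ε z w = 0) : herm ε w z = 0 := by
  rw [← herm_conj, h, map_zero]

theorem hermSq_eq_re (z : ι → ℂ) : hermSq ε z = (herm ε z z).re := by simp [herm_self]

theorem hermSq_eq_zero_iff (z : ι → ℂ) : hermSq ε z = 0 ↔ herm ε z z = 0 := by
  rw [herm_self]; norm_cast

theorem hermSq_smul (c : ℂ) (z : ι → ℂ) : hermSq ε (c • z) = ‖c‖ ^ 2 * hermSq ε z := by
  simp only [hermSq, Finset.mul_sum, Pi.smul_apply, smul_eq_mul, norm_mul]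
  exact Finset.sum_congr rfl fun i _ => by ring

theorem continuous_herm : Continuous fun p : (ι → ℂ) × (ι → ℂ) => herm ε p.1 p.2 := by
  unfold herm
  have h : Continuous (starRingEnd ℂ) := Complex.continuous_conj
  fun_prop

theorem Continuous.herm {X : Type*} [TopologicalSpace X] {f g : X → ι → ℂ} (hf : Continuous f)
    (hg : Continuous g) : Continuous fun x => herm ε (f x) (g x) :=
  (continuous_herm ε).comp (hf.prodMk hg)

theorem continuous_hermSq : Continuous (hermSq ε) := by
  unfold hermSq
  fun_prop

/-- `herm ε` is linear in the first argument. -/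
noncomputable def hermLeft (w : ι → ℂ) : (ι → ℂ) →ₗ[ℂ] ℂ where
  toFun z := herm ε z w
  map_add' x y := herm_add_left ε x y w
  map_smul' c x := herm_smul_left ε c x w

end Herm

/-! ### Uniqueness for holomorphic functions -/

section Uniqueness

/-- A holomorphic function on a disc that vanishes on the real diameter vanishes at `i`. -/
theorem eq_zero_at_I_of_real {g : ℂ → ℂ} (hg : DifferentiableOn ℂ g (Metric.ball 0 2))
    (h0 : ∀ t : ℝ, |t| < 2 → g t = 0) : g Complex.I = 0 := by
  have han : AnalyticOnNhd ℂ g (Metric.ball 0 2) := hg.analyticOnNhd Metric.isOpen_ball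
  refine han.eqOn_zero_of_preconnected_of_frequently_eq_zero (z₀ := 0)
    (convex_ball (0 : ℂ) 2).isPreconnected (by simp) ?_ (by simp : Complex.I ∈ Metric.ball (0:ℂ) 2)
  have hseq : Tendsto (fun n : ℕ => ((1 / ((n : ℝ) + 1) : ℝ) : ℂ)) atTop (𝓝[≠] 0) := by
    refine tendsto_nhdsWithin_iff.2 ⟨?_, Eventually.of_forall fun n => ?_⟩
    · have := (Complex.continuous_ofReal.tendsto 0).comp
        (tendsto_one_div_add_atTop_nhds_zero_nat (𝕜 := ℝ))
      rwa [Complex.ofReal_zero] at this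
    · have : (1 / ((n : ℝ) + 1) : ℝ) ≠ 0 := by positivity
      simpa only [Set.mem_compl_iff, Set.mem_singleton_iff, Complex.ofReal_eq_zero] using this
  refine hseq.frequently (Frequently.of_forall fun n => h0 _ ?_)
  rw [abs_of_pos (by positivity)]
  have : (1 / ((n : ℝ) + 1) : ℝ) ≤ 1 := by
    rw [div_le_one (by positivity)]
    have : (0 : ℝ) ≤ n := Nat.cast_nonneg n
    linarith
  linarith

/-- The identity theorem on a convex open set: only differentiability is needed, since the
function is restricted to complex lines. -/
theorem eqOn_zero_of_convex {E : Type*} [NormedAddCommGroup E] [NormedSpace ℂ E] {B : Set E}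
    (hBo : IsOpen B) (hBc : Convex ℝ B) {g : E → ℂ} (hg : DifferentiableOn ℂ g B) {q : E}
    (hq : q ∈ B) (h0 : ∀ᶠ x in 𝓝 q, g x = 0) {x : E} (hx : x ∈ B) : g x = 0 := by
  set φ : ℂ → E := fun t => q + t • (x - q) with hφ
  have hφd : Differentiable ℂ φ := by fun_prop
  set D : Set ℂ := φ ⁻¹' B with hD
  have hDo : IsOpen D := hBo.preimage hφd.continuous
  have hDc : Convex ℝ D := by
    intro a ha b hb α β hα hβ hαβ
    have := hBc ha hb hα hβ hαβ
    have key : φ (α • a + β • b) = α • φ a + β • φ b := by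
      have hsum : (α : ℂ) + β = 1 := by exact_mod_cast hαβ
      simp only [hφ, ← Complex.coe_smul]
      calc q + ((α : ℂ) * a + β * b) • (x - q)
          = ((α : ℂ) + β) • q + ((α : ℂ) * a + β * b) • (x - q) := by rw [hsum, one_smul]
        _ = _ := by module
    simpa only [hD, Set.mem_preimage, key] using this
  have han : AnalyticOnNhd ℂ (g ∘ φ) D :=
    (hg.comp hφd.differentiableOn fun t ht => ht).analyticOnNhd hDo
  have h0D : (0 : ℂ) ∈ D := by simpa [hD, hφ] using hq
  have h1D : (1 : ℂ) ∈ D := by simpa [hD, hφ] using hx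
  have hev : (g ∘ φ) =ᶠ[𝓝 0] 0 := by
    have : Tendsto φ (𝓝 0) (𝓝 q) := by simpa [hφ] using hφd.continuous.tendsto 0
    exact this.eventually h0
  have := han.eqOn_zero_of_preconnected_of_eventuallyEq_zero hDc.isPreconnected h0D hev h1D
  simpa [hφ] using this

end Uniqueness

/-! ### Polarization of the boundary condition -/

section Polarization

variable {ι κ : Type*} [Fintype ι] [Fintype κ]

/-- The vectors `x ± i y` are orthogonal exactly when `x + t y` has square norm
`(1 + t²) H(y, y)` for all real `t`; this is the direction used for polarization. -/
theorem herm_self_eq_of_orthogonal (ε : ι → ℝ) (x y : ι → ℂ)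
    (h : herm ε (x + Complex.I • y) (x - Complex.I • y) = 0) :
    herm ε x x = herm ε y y ∧ (herm ε x y).re = 0 := by
  rw [herm_sub_right, herm_add_left, herm_add_left, herm_smul_right, herm_smul_left,
    herm_smul_left, herm_smul_right, Complex.conj_I, ← herm_conj ε x y] at h
  have h1 := congrArg Complex.re h
  have h2 := congrArg Complex.im h
  simp [herm_self] at h1 h2
  constructor
  · rw [herm_self, herm_self]
    norm_cast
    linarith
  · linarith

set_option maxHeartbeats 1000000 in
/-- If a holomorphic map sends null vectors of `herm ε` near `z₀` to null vectors of `herm ε'`,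
then it preserves orthogonality near `z₀`. For orthogonal `z`, `w` the points `z` and `w` are the
values at `±i` of a holomorphic curve whose real points are null vectors. -/
theorem eventually_orthogonal {ε : ι → ℝ} {ε' : κ → ℝ} {F : (ι → ℂ) → κ → ℂ} {O : Set (ι → ℂ)}
    (hO : IsOpen O) {z₀ e : ι → ℂ} (hz₀ : z₀ ∈ O) (hF : DifferentiableOn ℂ F O)
    (he : herm ε e e = 0) (h0e : herm ε z₀ e = 1)
    (hnull : ∀ z ∈ O, herm ε z z = 0 → herm ε' (F z) (F z) = 0) :
    ∀ᶠ p : (ι → ℂ) × (ι → ℂ) in 𝓝 (z₀, z₀),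
      herm ε p.1 p.2 = 0 → herm ε' (F p.1) (F p.2) = 0 := by
  set X : (ι → ℂ) × (ι → ℂ) → ι → ℂ := fun p => (1 / 2 : ℂ) • (p.1 + p.2) with hX
  set Y : (ι → ℂ) × (ι → ℂ) → ι → ℂ := fun p => (-Complex.I / 2) • (p.1 - p.2) with hY
  set D : (ι → ℂ) × (ι → ℂ) → ℂ → ℂ := fun p t =>
    ((2 * (herm ε (X p) e).re : ℝ) : ℂ) + t * ((2 * (herm ε (Y p) e).re : ℝ) : ℂ) with hD
  set μ : (ι → ℂ) × (ι → ℂ) → ℂ → ℂ := fun p t =>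
    -((hermSq ε (Y p) : ℝ) : ℂ) * (1 + t ^ 2) / D p t with hμ
  set Γ : (ι → ℂ) × (ι → ℂ) → ℂ → ι → ℂ := fun p t => X p + t • Y p + μ p t • e with hΓ
  have hXc : Continuous X := by fun_prop
  have hYc : Continuous Y := by fun_prop
  have hX0 : X (z₀, z₀) = z₀ := by
    simp only [hX, ← two_smul ℂ z₀, smul_smul]; norm_num
  have hY0 : Y (z₀, z₀) = 0 := by simp [hY]
  have hD0 : ∀ t, D (z₀, z₀) t = 2 := by
    intro t
    simp [hD, hX0, hY0, h0e]
  have hDc : Continuous fun q : ((ι → ℂ) × (ι → ℂ)) × ℂ => D q.1 q.2 := by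
    have h1 : Continuous fun q : ((ι → ℂ) × (ι → ℂ)) × ℂ => herm ε (X q.1) e :=
      Continuous.herm ε (hXc.comp continuous_fst) continuous_const
    have h2 : Continuous fun q : ((ι → ℂ) × (ι → ℂ)) × ℂ => herm ε (Y q.1) e :=
      Continuous.herm ε (hYc.comp continuous_fst) continuous_const
    have h3 := Complex.continuous_re.comp h1
    have h4 := Complex.continuous_re.comp h2
    simp only [Function.comp_def] at h3 h4
    fun_prop
  have hΓ0 : ∀ t, Γ (z₀, z₀) t = z₀ := by
    intro t
    simp [hΓ, hμ, hX0, hY0, hermSq]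
  have hev : ∀ᶠ p : (ι → ℂ) × (ι → ℂ) in 𝓝 (z₀, z₀), ∀ t ∈ Metric.closedBall (0 : ℂ) 2,
      D p t ≠ 0 ∧ Γ p t ∈ O := by
    refine (isCompact_closedBall (0 : ℂ) 2).eventually_forall_of_forall_eventually fun t _ => ?_
    have hDt : D (z₀, z₀) t ≠ 0 := by rw [hD0]; norm_num
    have hDev : ∀ᶠ q : ((ι → ℂ) × (ι → ℂ)) × ℂ in 𝓝 ((z₀, z₀), t), D q.1 q.2 ≠ 0 := by
      have h1 : Tendsto (fun q : ((ι → ℂ) × (ι → ℂ)) × ℂ => D q.1 q.2) (𝓝 ((z₀, z₀), t))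
          (𝓝 (D (z₀, z₀) t)) := hDc.tendsto ((z₀, z₀), t)
      exact h1.eventually (isOpen_ne.mem_nhds hDt)
    refine hDev.and ?_
    have hμc : ContinuousAt (fun q : ((ι → ℂ) × (ι → ℂ)) × ℂ => μ q.1 q.2) ((z₀, z₀), t) := by
      refine ContinuousAt.div ?_ hDc.continuousAt hDt
      have h1 : Continuous fun q : ((ι → ℂ) × (ι → ℂ)) × ℂ => hermSq ε (Y q.1) :=
        (continuous_hermSq ε).comp (hYc.comp continuous_fst)
      fun_prop
    have hΓc : ContinuousAt (fun q : ((ι → ℂ) × (ι → ℂ)) × ℂ => Γ q.1 q.2) ((z₀, z₀), t) := by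
      refine ContinuousAt.add (Continuous.continuousAt ?_) (hμc.smul continuousAt_const)
      exact (hXc.comp continuous_fst).add (continuous_snd.smul (hYc.comp continuous_fst))
    refine hΓc.eventually (hO.mem_nhds ?_)
    simpa only [hΓ0] using hz₀
  filter_upwards [hev] with p hp hpw
  have hb : ∀ t ∈ Metric.ball (0 : ℂ) 2, D p t ≠ 0 ∧ Γ p t ∈ O := fun t ht =>
    hp t (Metric.ball_subset_closedBall ht)
  have hΓd : DifferentiableOn ℂ (Γ p) (Metric.ball 0 2) := by
    have hDd : Differentiable ℂ (D p) := by fun_prop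
    have hμd : DifferentiableOn ℂ (μ p) (Metric.ball 0 2) := by
      refine DifferentiableOn.div ?_ hDd.differentiableOn fun t ht => (hb t ht).1
      fun_prop
    fun_prop
  have hFΓ : DifferentiableOn ℂ (fun t => F (Γ p t)) (Metric.ball 0 2) :=
    hF.comp hΓd fun t ht => (hb t ht).2
  have hconj : ∀ t ∈ Metric.ball (0 : ℂ) 2, conj t ∈ Metric.ball (0 : ℂ) 2 := by
    intro t ht
    simpa using ht
  have hg : DifferentiableOn ℂ (fun t => herm ε' (F (Γ p t)) (F (Γ p (conj t))))
      (Metric.ball 0 2) := by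
    intro t ht
    refine DifferentiableAt.differentiableWithinAt ?_
    have hi : ∀ s ∈ Metric.ball (0 : ℂ) 2, ∀ i, DifferentiableAt ℂ (fun t => F (Γ p t) i) s :=
      fun s hs i => (differentiableAt_pi.1
        ((hFΓ s hs).differentiableAt (Metric.isOpen_ball.mem_nhds hs))) i
    unfold herm
    refine DifferentiableAt.fun_sum fun i _ => DifferentiableAt.const_mul ?_ _
    refine (hi t ht i).mul ?_
    have := (hi _ (hconj t ht) i).conj_conj
    simpa [Function.comp_def] using this
  -- for orthogonal `x + i y`, `x - i y` the square `H(x + t y)` is `H(y) (1 + t²)` at real `t`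
  have hxy : herm ε (X p) (X p) = herm ε (Y p) (Y p) ∧ (herm ε (X p) (Y p)).re = 0 := by
    have e1 : p.1 = X p + Complex.I • Y p := by
      simp only [hX, hY, smul_smul]
      rw [show Complex.I * (-Complex.I / 2) = 1 / 2 by
        rw [mul_div_assoc', mul_neg, Complex.I_mul_I]; norm_num]
      module
    have e2 : p.2 = X p - Complex.I • Y p := by
      simp only [hX, hY, smul_smul]
      rw [show Complex.I * (-Complex.I / 2) = 1 / 2 by
        rw [mul_div_assoc', mul_neg, Complex.I_mul_I]; norm_num]
      module
    have h := hpw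
    rw [e1, e2] at h
    exact herm_self_eq_of_orthogonal ε (X p) (Y p) h
  have hres := eq_zero_at_I_of_real hg fun t ht => ?_
  · have hI : μ p Complex.I = 0 := by simp [hμ]
    have hI' : μ p (conj Complex.I) = 0 := by simp [hμ]
    have e1 : Γ p Complex.I = p.1 := by
      simp only [hΓ, hI, hX, hY, smul_smul]
      rw [show Complex.I * (-Complex.I / 2) = 1 / 2 by
        rw [mul_div_assoc', mul_neg, Complex.I_mul_I]; norm_num]
      module
    have e2 : Γ p (conj Complex.I) = p.2 := by
      simp only [hΓ, hI', hX, hY, smul_smul]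
      rw [show conj Complex.I * (-Complex.I / 2) = -(1 / 2) by
        rw [Complex.conj_I, mul_div_assoc', neg_mul_neg, Complex.I_mul_I]; norm_num]
      module
    rwa [e1, e2] at hres
  · have htb : (t : ℂ) ∈ Metric.ball (0 : ℂ) 2 := by simpa using ht
    rw [Complex.conj_ofReal]
    refine hnull _ (hb t htb).2 ?_
    have hDt := (hb t htb).1
    have hμr : conj (μ p t) = μ p t := by
      simp only [hμ, hD, map_div₀, map_mul, map_neg, map_add, map_pow, Complex.conj_ofReal,
        map_one]
    have hμD : μ p t * D p t = -((hermSq ε (Y p) : ℝ) : ℂ) * (1 + t ^ 2) :=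
      div_mul_cancel₀ _ hDt
    have hre : ∀ x : ι → ℂ, herm ε x e + herm ε e x = ((2 * (herm ε x e).re : ℝ) : ℂ) := by
      intro x
      rw [← herm_conj ε x e, Complex.add_conj]
    have hXY : herm ε (X p) (Y p) + herm ε (Y p) (X p) = 0 := by
      rw [← herm_conj ε (X p) (Y p), Complex.add_conj, hxy.2]; simp
    have hYY := herm_self ε (Y p)
    simp only [hΓ, herm_add_left, herm_add_right, herm_smul_left, herm_smul_right, he, hμr,
      Complex.conj_ofReal, hxy.1]
    have hDe : D p t = herm ε (X p) e + herm ε e (X p) + t * (herm ε (Y p) e + herm ε e (Y p)) := by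
      rw [hre, hre]
    rw [hDe] at hμD
    rw [← hYY] at hμD
    linear_combination hμD + (t : ℂ) * hXY

end Polarization

/-! ### Null spaces and the index of a Hermitian form -/

section Index

variable {ι κ : Type*} [Fintype ι] [Fintype κ]

/-- In a nondegenerate diagonal form, a space that is the orthogonal sum of a null space and a
positive definite space has dimension at most the number of positive signs. -/
theorem card_add_card_le_of_null_of_pos {ε : κ → ℝ} (hε : ∀ i, ε i ≠ 0)
    {α β : Type*} [Fintype α] [Fintype β] {u : α → κ → ℂ} {v : β → κ → ℂ}
    (hu : LinearIndependent ℂ u) (huu : ∀ a b, herm ε (u a) (u b) = 0)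
    (huv : ∀ a b, herm ε (u a) (v b) = 0) (hvv : ∀ a b, a ≠ b → herm ε (v a) (v b) = 0)
    (hv : ∀ b, 0 < hermSq ε (v b)) :
    Fintype.card α + Fintype.card β ≤ Fintype.card {i // 0 < ε i} := by
  classical
  set R : (κ → ℂ) →ₗ[ℂ] ({i // 0 < ε i} → ℂ) := LinearMap.funLeft ℂ ℂ Subtype.val with hR
  have hli : LinearIndependent ℂ (fun s : α ⊕ β => R (Sum.elim u v s)) := by
    rw [Fintype.linearIndependent_iff]
    intro g hg
    set x : κ → ℂ := ∑ a, g (Sum.inl a) • u a + ∑ b, g (Sum.inr b) • v b with hx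
    have hRx : R x = 0 := by
      rw [← hg, Fintype.sum_sum_type]
      simp [hx, map_add, map_sum]
    have hxv : ∀ b, herm ε x (v b) = g (Sum.inr b) * hermSq ε (v b) := by
      intro b
      rw [hx, herm_add_left, herm_sum_left, herm_sum_left]
      simp only [herm_smul_left, huv, mul_zero, Finset.sum_const_zero, zero_add]
      rw [Finset.sum_eq_single b (fun c _ hc => by rw [hvv c b hc, mul_zero]) (by simp),
        herm_self]
    have hxu : ∀ a, herm ε x (u a) = 0 := by
      intro a
      rw [hx, herm_add_left, herm_sum_left, herm_sum_left]
      simp [herm_smul_left, huu, herm_eq_zero_symm ε (huv a _)]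
    have hxx : hermSq ε x = ∑ b, ‖g (Sum.inr b)‖ ^ 2 * hermSq ε (v b) := by
      have h1 : herm ε x x = ∑ b, ((‖g (Sum.inr b)‖ ^ 2 * hermSq ε (v b) : ℝ) : ℂ) := by
        conv_lhs => rw [hx]
        rw [herm_add_left, herm_sum_left, herm_sum_left]
        simp only [herm_smul_left]
        rw [Finset.sum_eq_zero (fun a _ => by rw [herm_eq_zero_symm ε (hxu a), mul_zero]),
          zero_add]
        refine Finset.sum_congr rfl fun b _ => ?_
        rw [← herm_conj, hxv, map_mul, Complex.conj_ofReal, ← mul_assoc, Complex.mul_conj,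
          Complex.normSq_eq_norm_sq]
        push_cast
        rfl
      rw [hermSq_eq_re, h1, Complex.re_sum]
      simp only [Complex.ofReal_re]
    have hnonneg : 0 ≤ hermSq ε x := by
      rw [hxx]
      exact Finset.sum_nonneg fun b _ => mul_nonneg (by positivity) (hv b).le
    have hterm : ∀ i, ε i * ‖x i‖ ^ 2 ≤ 0 := by
      intro i
      by_cases hi : 0 < ε i
      · have : x i = 0 := congrFun hRx ⟨i, hi⟩
        simp [this]
      · exact mul_nonpos_of_nonpos_of_nonneg (not_lt.1 hi) (by positivity)
    have hx0 : x = 0 := by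
      have h0 : ∑ i, ε i * ‖x i‖ ^ 2 = 0 :=
        le_antisymm (Finset.sum_nonpos fun i _ => hterm i) hnonneg
      funext i
      have := (Finset.sum_eq_zero_iff_of_nonpos fun i _ => hterm i).1 h0 i (Finset.mem_univ i)
      simpa [hε i] using this
    have hgr : ∀ b, g (Sum.inr b) = 0 := by
      intro b
      have := hxv b
      rw [hx0, herm_zero_left] at this
      have hne : ((hermSq ε (v b) : ℝ) : ℂ) ≠ 0 := by exact_mod_cast (hv b).ne'
      exact (mul_eq_zero.1 this.symm).resolve_right hne
    have hgl : ∀ a, g (Sum.inl a) = 0 := by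
      refine Fintype.linearIndependent_iff.1 hu _ ?_
      rw [← hx0, hx]
      simp [hgr]
    rintro (a | b)
    · exact hgl a
    · exact hgr b
  have := hli.fintype_card_le_finrank
  simpa using this

/-- Any two vectors have a common orthogonal complement containing as many orthonormal positive
vectors as the index of the form allows. -/
theorem exists_orthonormal_pos (ε : ι → ℝ) (z v : ι → ℂ) :
    ∃ d : Fin (Fintype.card {i // ε i = 1} - 2) → ι → ℂ,
      (∀ i j, herm ε (d i) (d j) = if i = j then 1 else 0) ∧
      ∀ i, herm ε (d i) z = 0 ∧ herm ε (d i) v = 0 := by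
  classical
  let E := EuclideanSpace ℂ {i // ε i = 1}
  let R : (ι → ℂ) → E := fun x => WithLp.toLp 2 fun i => x i
  let X : E → ι → ℂ := fun a i => if h : ε i = 1 then a ⟨i, h⟩ else 0
  have hX : ∀ (a : E) (w : ι → ℂ), herm ε (X a) w = inner ℂ (R w) a := by
    intro a w
    have hzero : ∀ i, ε i ≠ 1 → (ε i : ℂ) * (X a i * conj (w i)) = 0 := by
      intro i hi
      simp [X, hi]
    rw [herm, ← Finset.sum_subset (Finset.subset_univ (Finset.univ.filter fun i => ε i = 1))
      (fun i _ hi => hzero i (by simpa using hi)), Finset.sum_subtype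
      (p := fun i => ε i = 1) _ (by simp), PiLp.inner_apply]
    refine Finset.sum_congr rfl fun i _ => ?_
    simp [X, R, i.2]
  have hRX : ∀ a : E, R (X a) = a := by
    intro a
    ext i
    simp [R, X, i.2]
  let S : Submodule ℂ E := Submodule.span ℂ {R z, R v}
  have hS : Module.finrank ℂ S ≤ 2 := by
    have h1 := finrank_span_finset_le_card (R := ℂ) ({R z, R v} : Finset E)
    have h2 : (({R z, R v} : Finset E) : Set E) = {R z, R v} := by simp
    rw [Set.finrank, h2] at h1
    exact h1.trans Finset.card_le_two
  have hdim : Fintype.card {i // ε i = 1} - 2 ≤ Module.finrank ℂ Sᗮ := by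
    have h1 := S.finrank_add_finrank_orthogonal
    have h2 : Module.finrank ℂ E = Fintype.card {i // ε i = 1} := finrank_euclideanSpace
    omega
  let b := stdOrthonormalBasis ℂ Sᗮ
  refine ⟨fun i => X (b (Fin.castLE hdim i)), fun i j => ?_, fun i => ⟨?_, ?_⟩⟩
  · rw [hX, hRX]
    have := orthonormal_iff_ite.1 b.orthonormal (Fin.castLE hdim j) (Fin.castLE hdim i)
    rw [← Submodule.coe_inner, this]
    simp [eq_comm]
  · rw [hX]
    exact (b (Fin.castLE hdim i)).2 _ (Submodule.subset_span (by simp))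
  · rw [hX]
    exact (b (Fin.castLE hdim i)).2 _ (Submodule.subset_span (by simp))

/-- A map preserving orthogonality and positivity sends collinear points of a null line to
dependent vectors, provided the target has no larger index than the source: in the orthogonal
complement of the line there is room for too many positive vectors. -/
theorem not_linearIndependent_of_null {ε : ι → ℝ} {ε' : κ → ℝ} (hε' : ∀ i, ε' i ≠ 0)
    (h2 : 2 ≤ Fintype.card {i // ε i = 1})
    (hcard : Fintype.card {i // 0 < ε' i} ≤ Fintype.card {i // ε i = 1})
    {F : (ι → ℂ) → κ → ℂ} {O : Set (ι → ℂ)} (hO : IsOpen O)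
    (horth : ∀ z ∈ O, ∀ w ∈ O, herm ε z w = 0 → herm ε' (F z) (F w) = 0)
    (hpos : ∀ z ∈ O, 0 < hermSq ε z → 0 < hermSq ε' (F z))
    {z v : ι → ℂ} (hzz : herm ε z z = 0) (hzv : herm ε z v = 0) (hvv : herm ε v v = 0)
    {α β : Fin 3 → ℂ} (hx : ∀ k, α k • z + β k • v ∈ O) :
    ¬ LinearIndependent ℂ fun k => F (α k • z + β k • v) := by
  intro hli
  obtain ⟨d, hd, hdzv⟩ := exists_orthonormal_pos ε z v
  have hvz := herm_eq_zero_symm ε hzv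
  have hdx : ∀ i k, herm ε (d i) (α k • z + β k • v) = 0 := by
    intro i k
    rw [herm_add_right, herm_smul_right, herm_smul_right, (hdzv i).1, (hdzv i).2]
    simp
  have hxx : ∀ k l, herm ε (α k • z + β k • v) (α l • z + β l • v) = 0 := by
    intro k l
    simp only [herm_add_right, herm_smul_right, herm_add_left, herm_smul_left, hzz, hzv, hvv, hvz]
    simp
  have hev : ∀ᶠ t : ℝ in 𝓝 0, ∀ i, (α 0 • z + β 0 • v) + (t : ℂ) • d i ∈ O := by
    refine eventually_all.2 fun i => ?_
    have hc : Continuous fun t : ℝ => (α 0 • z + β 0 • v) + (t : ℂ) • d i :=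
      continuous_const.add (Complex.continuous_ofReal.smul continuous_const)
    exact hc.continuousAt.eventually (hO.mem_nhds (by simpa using hx 0))
  obtain ⟨t, ht0, ht⟩ : ∃ t : ℝ, 0 < t ∧ ∀ i, (α 0 • z + β 0 • v) + (t : ℂ) • d i ∈ O := by
    obtain ⟨t, h1, h2⟩ := ((hev.filter_mono nhdsWithin_le_nhds).and
      (self_mem_nhdsWithin (s := Set.Ioi (0 : ℝ)))).exists
    exact ⟨t, h2, h1⟩
  have hpp : ∀ i j, herm ε ((α 0 • z + β 0 • v) + (t : ℂ) • d i)
      ((α 0 • z + β 0 • v) + (t : ℂ) • d j) = if i = j then ((t ^ 2 : ℝ) : ℂ) else 0 := by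
    intro i j
    rw [herm_add_left, herm_add_right ε (α 0 • z + β 0 • v) ((t : ℂ) • d j),
      herm_add_right ε (α 0 • z + β 0 • v) ((t : ℂ) • d j), hxx, herm_smul_right,
      herm_eq_zero_symm ε (hdx j 0), herm_smul_left, herm_smul_left, hdx, herm_smul_right, hd]
    split_ifs
    · simp [pow_two]
    · simp
  have key := card_add_card_le_of_null_of_pos hε' (u := fun k => F (α k • z + β k • v))
    (v := fun i => F ((α 0 • z + β 0 • v) + (t : ℂ) • d i)) hli
    (fun k l => horth _ (hx k) _ (hx l) (hxx k l))
    (fun k i => horth _ (hx k) _ (ht i) ?_)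
    (fun i j hij => horth _ (ht i) _ (ht j) (by rw [hpp, if_neg hij]))
    (fun i => hpos _ (ht i) ?_)
  · simp only [Fintype.card_fin] at key
    omega
  · rw [herm_add_right, hxx, herm_smul_right, herm_eq_zero_symm ε (hdx i k)]
    simp
  · rw [hermSq_eq_re, hpp, if_pos rfl, Complex.ofReal_re]
    positivity

end Index

/-! ### From null lines to all lines -/

section NullLines

variable {ι κ : Type*} [Fintype ι] [Fintype κ]

/-- Two orthogonal null vectors `z`, `v` together with a dual pair `e`, `f` of null vectors. -/
structure IsNullFrame (ε : ι → ℝ) (z v e f : ι → ℂ) : Prop where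
  zz : herm ε z z = 0
  zv : herm ε z v = 0
  vv : herm ε v v = 0
  ee : herm ε e e = 0
  ef : herm ε e f = 0
  ff : herm ε f f = 0
  ze : herm ε z e = 1
  zf : herm ε z f = 0
  ve : herm ε v e = 0
  vf : herm ε v f = 1

/-- A quadratic-cubic function of `t` with value `k` at `t = i` and real part `-q t² / 2` at real
`t`, for real `q`. -/
noncomputable def diagCoeff (q k t : ℂ) : ℂ :=
  -(t ^ 2 * q * (1 + Complex.I * t)) / 2 + Complex.I * ((k.im : ℂ) - t * (k.re : ℂ))

theorem diagCoeff_I (q k : ℂ) : diagCoeff q k Complex.I = k := by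
  simp only [diagCoeff]
  rw [Complex.I_mul_I]
  apply Complex.ext <;> simp

theorem diagCoeff_add_conj {q : ℂ} (hq : conj q = q) (k : ℂ) (t : ℝ) :
    diagCoeff q k t + conj (diagCoeff q k t) = -(t ^ 2 * q) := by
  simp only [diagCoeff, map_add, map_div₀, map_neg, map_mul, map_pow, Complex.conj_ofReal, map_one,
    Complex.conj_I, map_sub, map_ofNat, hq]
  ring

theorem Continuous.diagCoeff {X : Type*} [TopologicalSpace X] {q k t : X → ℂ} (hq : Continuous q)
    (hk : Continuous k) (ht : Continuous t) :
    Continuous fun x => diagCoeff (q x) (k x) (t x) := by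
  unfold _root_.diagCoeff
  fun_prop

theorem differentiable_diagCoeff (q k : ℂ) : Differentiable ℂ (diagCoeff q k) := by
  unfold diagCoeff
  fun_prop

/-- Every pair `(z, v)` that is normalized with respect to `e`, `f` is the value at `i` of a
holomorphic curve of pairs that span null planes at real times. Null planes near the span of `z₀`
and `v₀` are graphs over it; the curves are explicit in the resulting coordinates. -/
theorem exists_null_curve {ε : ι → ℝ} {z₀ v₀ e f : ι → ℂ} (h : IsNullFrame ε z₀ v₀ e f) :
    ∃ Z W : ((ι → ℂ) × (ι → ℂ)) × ℂ → ι → ℂ, Continuous Z ∧ Continuous W ∧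
      (∀ p, Differentiable ℂ fun t => Z (p, t)) ∧ (∀ p, Differentiable ℂ fun t => W (p, t)) ∧
      (∀ t, Z ((z₀, v₀), t) = z₀) ∧ (∀ t, W ((z₀, v₀), t) = v₀) ∧
      (∀ p, Z (p, Complex.I) = p.1 ∧ W (p, Complex.I) = p.2) ∧
      ∀ z v, herm ε z e = 1 → herm ε z f = 0 → herm ε v e = 0 → herm ε v f = 1 → ∀ t : ℝ,
        herm ε (Z ((z, v), t)) (Z ((z, v), t)) = 0 ∧
        herm ε (Z ((z, v), t)) (W ((z, v), t)) = 0 ∧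
        herm ε (W ((z, v), t)) (W ((z, v), t)) = 0 := by
  have hez : herm ε e z₀ = 1 := by rw [← herm_conj, h.ze, map_one]
  have hfv : herm ε f v₀ = 1 := by rw [← herm_conj, h.vf, map_one]
  have hfz := herm_eq_zero_symm ε h.zf
  have hev := herm_eq_zero_symm ε h.ve
  have hvz := herm_eq_zero_symm ε h.zv
  have hfe := herm_eq_zero_symm ε h.ef
  -- coordinates of `z - z₀` and `v - v₀` along `e` and `f`, and the remaining components
  let a : (ι → ℂ) × (ι → ℂ) → ℂ := fun p => herm ε p.1 z₀
  let b : (ι → ℂ) × (ι → ℂ) → ℂ := fun p => herm ε p.1 v₀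
  let c : (ι → ℂ) × (ι → ℂ) → ℂ := fun p => herm ε p.2 z₀
  let d : (ι → ℂ) × (ι → ℂ) → ℂ := fun p => herm ε p.2 v₀
  let y : (ι → ℂ) × (ι → ℂ) → ι → ℂ := fun p => p.1 - z₀ - a p • e - b p • f
  let u : (ι → ℂ) × (ι → ℂ) → ι → ℂ := fun p => p.2 - v₀ - c p • e - d p • f
  let s : (ι → ℂ) × (ι → ℂ) → ℂ := fun p => herm ε (y p) (u p)
  let β₀ : (ι → ℂ) × (ι → ℂ) → ℂ := fun p => (b p + (s p - conj (c p))) / 2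
  let β₁ : (ι → ℂ) × (ι → ℂ) → ℂ := fun p => -Complex.I * (b p - (s p - conj (c p))) / 2
  let Z : ((ι → ℂ) × (ι → ℂ)) × ℂ → ι → ℂ := fun q =>
    z₀ - (Complex.I * q.2) • y q.1 + diagCoeff (herm ε (y q.1) (y q.1)) (a q.1) q.2 • e
      + (β₀ q.1 + β₁ q.1 * q.2) • f
  let W : ((ι → ℂ) × (ι → ℂ)) × ℂ → ι → ℂ := fun q =>
    v₀ - (Complex.I * q.2) • u q.1
      + (-(conj (β₀ q.1) + conj (β₁ q.1) * q.2) - q.2 ^ 2 * conj (s q.1)) • e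
      + diagCoeff (herm ε (u q.1) (u q.1)) (d q.1) q.2 • f
  have hconj : Continuous (starRingEnd ℂ) := Complex.continuous_conj
  have hac : Continuous a := Continuous.herm ε continuous_fst continuous_const
  have hbc : Continuous b := Continuous.herm ε continuous_fst continuous_const
  have hcc : Continuous c := Continuous.herm ε continuous_snd continuous_const
  have hdc : Continuous d := Continuous.herm ε continuous_snd continuous_const
  have hyc : Continuous y := by fun_prop
  have huc : Continuous u := by fun_prop
  have hsc : Continuous s := Continuous.herm ε hyc huc
  have hyy : Continuous fun p => herm ε (y p) (y p) := Continuous.herm ε hyc hyc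
  have huu : Continuous fun p => herm ε (u p) (u p) := Continuous.herm ε huc huc
  have hβ₀ : Continuous β₀ := by fun_prop
  have hβ₁ : Continuous β₁ := by fun_prop
  have ha0 : a (z₀, v₀) = 0 := h.zz
  have hb0 : b (z₀, v₀) = 0 := h.zv
  have hc0 : c (z₀, v₀) = 0 := hvz
  have hd0 : d (z₀, v₀) = 0 := h.vv
  have hy0 : y (z₀, v₀) = 0 := by simp only [y, ha0, hb0]; simp
  have hu0 : u (z₀, v₀) = 0 := by simp only [u, hc0, hd0]; simp
  have hs0 : s (z₀, v₀) = 0 := by simp only [s, hy0]; simp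
  have hI2 : Complex.I ^ 2 = -1 := Complex.I_sq
  refine ⟨Z, W, ?_, ?_, ?_, ?_, ?_, ?_, ?_, ?_⟩
  · have h1 := (hyy.comp continuous_fst).diagCoeff (hac.comp continuous_fst)
      (continuous_snd (X := (ι → ℂ) × (ι → ℂ)) (Y := ℂ))
    simp only [Function.comp_def] at h1
    simp only [Z]
    fun_prop
  · have h1 := (huu.comp continuous_fst).diagCoeff (hdc.comp continuous_fst)
      (continuous_snd (X := (ι → ℂ) × (ι → ℂ)) (Y := ℂ))
    simp only [Function.comp_def] at h1
    simp only [W]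
    fun_prop
  · intro p
    have h1 := differentiable_diagCoeff (herm ε (y p) (y p)) (a p)
    simp only [Z]
    fun_prop
  · intro p
    have h1 := differentiable_diagCoeff (herm ε (u p) (u p)) (d p)
    simp only [W]
    fun_prop
  · intro t
    simp only [Z, diagCoeff, β₀, β₁, hy0, ha0, hb0, hc0, hs0]
    simp
  · intro t
    simp only [W, diagCoeff, β₀, β₁, hu0, hb0, hc0, hd0, hs0]
    simp
  · intro p
    constructor
    · simp only [Z, diagCoeff_I]
      rw [show β₀ p + β₁ p * Complex.I = b p by
        simp only [β₀, β₁]; linear_combination (-(b p - (s p - conj (c p))) / 2) * hI2]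
      rw [Complex.I_mul_I]
      simp only [y]
      module
    · simp only [W, diagCoeff_I]
      rw [show -(conj (β₀ p) + conj (β₁ p) * Complex.I) - Complex.I ^ 2 * conj (s p) = c p by
        simp only [β₀, β₁, map_div₀, map_mul, map_add, map_sub, map_neg, Complex.conj_I,
          Complex.conj_conj, map_ofNat]
        linear_combination (-(conj (b p) - (conj (s p) - c p)) / 2 - conj (s p)) * hI2]
      rw [Complex.I_mul_I]
      simp only [u]
      module
  · intro z v hze hzf hve hvf t
    have hye : herm ε (y (z, v)) e = 0 := by
      simp only [y, herm_sub_left, herm_smul_left, hze, h.ze, h.ee, hfe]; ring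
    have hyf : herm ε (y (z, v)) f = 0 := by
      simp only [y, herm_sub_left, herm_smul_left, hzf, h.zf, h.ef, h.ff]; ring
    have hyz : herm ε (y (z, v)) z₀ = 0 := by
      simp only [y, a, herm_sub_left, herm_smul_left, h.zz, hez, hfz]; ring
    have hyv : herm ε (y (z, v)) v₀ = 0 := by
      simp only [y, b, herm_sub_left, herm_smul_left, h.zv, hev, hfv]; ring
    have hue : herm ε (u (z, v)) e = 0 := by
      simp only [u, herm_sub_left, herm_smul_left, hve, h.ve, h.ee, hfe]; ring
    have huf : herm ε (u (z, v)) f = 0 := by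
      simp only [u, herm_sub_left, herm_smul_left, hvf, h.vf, h.ef, h.ff]; ring
    have huz : herm ε (u (z, v)) z₀ = 0 := by
      simp only [u, c, herm_sub_left, herm_smul_left, hvz, hez, hfz]; ring
    have huv : herm ε (u (z, v)) v₀ = 0 := by
      simp only [u, d, herm_sub_left, herm_smul_left, h.vv, hev, hfv]; ring
    have hey := herm_eq_zero_symm ε hye
    have hfy := herm_eq_zero_symm ε hyf
    have hzy := herm_eq_zero_symm ε hyz
    have hvy := herm_eq_zero_symm ε hyv
    have heu := herm_eq_zero_symm ε hue
    have hfu := herm_eq_zero_symm ε huf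
    have hzu := herm_eq_zero_symm ε huz
    have hvu := herm_eq_zero_symm ε huv
    have hs : herm ε (y (z, v)) (u (z, v)) = s (z, v) := rfl
    have h1 := diagCoeff_add_conj (herm_conj ε (y (z, v)) (y (z, v))) (a (z, v)) t
    have h2 := diagCoeff_add_conj (herm_conj ε (u (z, v)) (u (z, v))) (d (z, v)) t
    refine ⟨?_, ?_, ?_⟩
    · simp only [Z, herm_add_left, herm_add_right, herm_sub_left, herm_sub_right, herm_smul_left,
        herm_smul_right, h.zz, hzy, h.ze, h.zf, hyz, hye, hyf, hez, hey, h.ee, h.ef, hfz, hfy,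
        hfe, h.ff, map_mul, Complex.conj_I, Complex.conj_ofReal]
      linear_combination h1 - (t : ℂ) ^ 2 * herm ε (y (z, v)) (y (z, v)) * hI2
    · simp only [Z, W, herm_add_left, herm_add_right, herm_sub_left, herm_sub_right,
        herm_smul_left, herm_smul_right, h.zv, hzu, h.ze, h.zf, hyv, hye, hyf, hs, hev, heu, h.ee,
        h.ef, hfv, hfu, hfe, h.ff, map_mul, map_sub, map_neg, map_add, map_pow, Complex.conj_I,
        Complex.conj_ofReal, Complex.conj_conj]
      linear_combination -(t : ℂ) ^ 2 * s (z, v) * hI2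
    · simp only [W, herm_add_left, herm_add_right, herm_sub_left, herm_sub_right, herm_smul_left,
        herm_smul_right, h.vv, hvu, h.ve, h.vf, huv, hue, huf, hev, heu, h.ee, h.ef, hfv, hfu,
        hfe, h.ff, map_mul, Complex.conj_I, Complex.conj_ofReal]
      linear_combination h2 - (t : ℂ) ^ 2 * herm ε (u (z, v)) (u (z, v)) * hI2

end NullLines

section Collinear

variable {ι κ : Type*} [Fintype ι]

/-- The `3 × 3` minor of the rows `a`, `b`, `c` in the columns `i`, `j`, `k`. -/
def minor3 (a b c : κ → ℂ) (i j k : κ) : ℂ :=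
  a i * (b j * c k - b k * c j) - a j * (b i * c k - b k * c i) + a k * (b i * c j - b j * c i)

theorem minor3_eq_zero {u : Fin 3 → κ → ℂ} (h : ¬ LinearIndependent ℂ u) (i j k : κ) :
    minor3 (u 0) (u 1) (u 2) i j k = 0 := by
  obtain ⟨g, hg, l, hl⟩ := Fintype.not_linearIndependent_iff.1 h
  have hc : ∀ m, g 0 * u 0 m + g 1 * u 1 m + g 2 * u 2 m = 0 := by
    intro m
    simpa [Fin.sum_univ_three] using congrFun hg m
  have h0 := hc i
  have h1 := hc j
  have h2 := hc k
  refine (mul_eq_zero.1 (?_ : g l * minor3 (u 0) (u 1) (u 2) i j k = 0)).resolve_left hl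
  unfold minor3
  fin_cases l
  · simp only [Fin.zero_eta]
    linear_combination (u 1 j * u 2 k - u 1 k * u 2 j) * h0 -
      (u 1 i * u 2 k - u 1 k * u 2 i) * h1 + (u 1 i * u 2 j - u 1 j * u 2 i) * h2
  · simp only [Fin.mk_one]
    linear_combination -(u 0 j * u 2 k - u 0 k * u 2 j) * h0 +
      (u 0 i * u 2 k - u 0 k * u 2 i) * h1 - (u 0 i * u 2 j - u 0 j * u 2 i) * h2
  · simp only [Fin.reduceFinMk]
    linear_combination (u 0 j * u 1 k - u 0 k * u 1 j) * h0 -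
      (u 0 i * u 1 k - u 0 k * u 1 i) * h1 + (u 0 i * u 1 j - u 0 j * u 1 i) * h2

theorem DifferentiableOn.minor3 {E : Type*} [NormedAddCommGroup E] [NormedSpace ℂ E] {s : Set E}
    {a b c : E → κ → ℂ} (ha : DifferentiableOn ℂ a s) (hb : DifferentiableOn ℂ b s)
    (hc : DifferentiableOn ℂ c s) (i j k : κ) :
    DifferentiableOn ℂ (fun x => minor3 (a x) (b x) (c x) i j k) s := by
  have ha' := differentiableOn_pi.1 ha
  have hb' := differentiableOn_pi.1 hb
  have hc' := differentiableOn_pi.1 hc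
  have h1 := ha' i
  have h2 := ha' j
  have h3 := ha' k
  have h4 := hb' i
  have h5 := hb' j
  have h6 := hb' k
  have h7 := hc' i
  have h8 := hc' j
  have h9 := hc' k
  unfold _root_.minor3
  fun_prop

variable [Fintype κ]

/-- Collinear points on lines close to a null line have dependent images, for lines in
normalized form. -/
theorem eventually_minor3_of_normalized {ε : ι → ℝ} {F : (ι → ℂ) → κ → ℂ} {O : Set (ι → ℂ)}
    (hO : IsOpen O) (hF : DifferentiableOn ℂ F O) {z₀ v₀ e f : ι → ℂ}
    (h : IsNullFrame ε z₀ v₀ e f) (hz₀ : z₀ ∈ O)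
    (hnull : ∀ z v, herm ε z z = 0 → herm ε z v = 0 → herm ε v v = 0 → ∀ α β : Fin 3 → ℂ,
      (∀ k, α k • z + β k • v ∈ O) → ∀ i j k, minor3 (F (α 0 • z + β 0 • v))
        (F (α 1 • z + β 1 • v)) (F (α 2 • z + β 2 • v)) i j k = 0) :
    ∀ᶠ q : ((ι → ℂ) × (ι → ℂ)) × ((Fin 3 → ℂ) × (Fin 3 → ℂ)) in
      𝓝 ((z₀, v₀), ((fun _ => 1), (fun _ => 0))),
      herm ε q.1.1 e = 1 → herm ε q.1.1 f = 0 → herm ε q.1.2 e = 0 → herm ε q.1.2 f = 1 →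
      ∀ i j k, minor3 (F (q.2.1 0 • q.1.1 + q.2.2 0 • q.1.2))
        (F (q.2.1 1 • q.1.1 + q.2.2 1 • q.1.2)) (F (q.2.1 2 • q.1.1 + q.2.2 2 • q.1.2)) i j k
          = 0 := by
  obtain ⟨Z, W, hZc, hWc, hZd, hWd, hZ0, hW0, hI, hR⟩ := exists_null_curve h
  have hev : ∀ᶠ q : ((ι → ℂ) × (ι → ℂ)) × ((Fin 3 → ℂ) × (Fin 3 → ℂ)) in
      𝓝 ((z₀, v₀), ((fun _ => 1), (fun _ => 0))), ∀ t ∈ Metric.closedBall (0 : ℂ) 2,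
      ∀ k, q.2.1 k • Z (q.1, t) + q.2.2 k • W (q.1, t) ∈ O := by
    refine (isCompact_closedBall (0 : ℂ) 2).eventually_forall_of_forall_eventually fun t _ => ?_
    refine eventually_all.2 fun k => ?_
    have hc : Continuous fun q : (((ι → ℂ) × (ι → ℂ)) × ((Fin 3 → ℂ) × (Fin 3 → ℂ))) × ℂ =>
        q.1.2.1 k • Z (q.1.1, q.2) + q.1.2.2 k • W (q.1.1, q.2) := by fun_prop
    refine hc.continuousAt.eventually (hO.mem_nhds ?_)
    simpa [hZ0, hW0] using hz₀
  filter_upwards [hev] with q hq hze hzf hve hvf i j k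
  have hb : ∀ t ∈ Metric.ball (0 : ℂ) 2, ∀ k, q.2.1 k • Z (q.1, t) + q.2.2 k • W (q.1, t) ∈ O :=
    fun t ht => hq t (Metric.ball_subset_closedBall ht)
  have hd : ∀ k, DifferentiableOn ℂ (fun t => F (q.2.1 k • Z (q.1, t) + q.2.2 k • W (q.1, t)))
      (Metric.ball 0 2) := by
    intro k
    have h1 := hZd q.1
    have h2 := hWd q.1
    have h3 : DifferentiableOn ℂ (fun t => q.2.1 k • Z (q.1, t) + q.2.2 k • W (q.1, t))
      (Metric.ball 0 2) :=
      ((h1.const_smul (q.2.1 k)).add (h2.const_smul (q.2.2 k))).differentiableOn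
    exact hF.comp h3 fun t ht => hb t ht k
  have := eq_zero_at_I_of_real ((hd 0).minor3 (hd 1) (hd 2) i j k) fun t ht => ?_
  · simpa only [(hI q.1).1, (hI q.1).2] using this
  · obtain ⟨h1, h2, h3⟩ := hR q.1.1 q.1.2 hze hzf hve hvf t
    exact hnull _ _ h1 h2 h3 _ _ (hb t (by simpa using ht)) i j k

/-- A holomorphic map that sends null lines into lines near `z₀` sends all lines into lines in a
neighbourhood of `z₀`. -/
theorem exists_ball_minor3 {ε : ι → ℝ} {F : (ι → ℂ) → κ → ℂ} {O : Set (ι → ℂ)}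
    (hO : IsOpen O) (hF : DifferentiableOn ℂ F O) {z₀ v₀ e f : ι → ℂ}
    (h : IsNullFrame ε z₀ v₀ e f) (hz₀ : z₀ ∈ O)
    (hnull : ∀ z v, herm ε z z = 0 → herm ε z v = 0 → herm ε v v = 0 → ∀ α β : Fin 3 → ℂ,
      (∀ k, α k • z + β k • v ∈ O) → ∀ i j k, minor3 (F (α 0 • z + β 0 • v))
        (F (α 1 • z + β 1 • v)) (F (α 2 • z + β 2 • v)) i j k = 0) :
    ∃ ρ > 0, Metric.ball z₀ (2 * ρ) ⊆ O ∧ ∀ x ∈ Metric.ball z₀ ρ, ∀ v ∈ Metric.ball (0 : ι → ℂ) ρ,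
      ∀ s₁ s₂ : ℂ, ‖s₁‖ ≤ 1 → ‖s₂‖ ≤ 1 → ∀ i j k,
        minor3 (F x) (F (x + s₁ • v)) (F (x + s₂ • v)) i j k = 0 := by
  have hA := eventually_minor3_of_normalized hO hF h hz₀ hnull
  -- lines `x + s v` with `v` close to `v₀`, by normalizing a basis of the plane they span
  have hB : ∀ᶠ q : ((ι → ℂ) × (ι → ℂ)) × (Fin 3 → ℂ) in 𝓝 ((z₀, v₀), 0),
      ∀ i j k, minor3 (F (q.1.1 + q.2 0 • q.1.2)) (F (q.1.1 + q.2 1 • q.1.2))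
        (F (q.1.1 + q.2 2 • q.1.2)) i j k = 0 := by
    let A : ((ι → ℂ) × (ι → ℂ)) → ℂ := fun p => herm ε p.1 e
    let B : ((ι → ℂ) × (ι → ℂ)) → ℂ := fun p => herm ε p.1 f
    let C : ((ι → ℂ) × (ι → ℂ)) → ℂ := fun p => herm ε p.2 e
    let D : ((ι → ℂ) × (ι → ℂ)) → ℂ := fun p => herm ε p.2 f
    let Δ : ((ι → ℂ) × (ι → ℂ)) → ℂ := fun p => A p * D p - B p * C p
    let X : ((ι → ℂ) × (ι → ℂ)) → ι → ℂ := fun p => (Δ p)⁻¹ • (D p • p.1 - B p • p.2)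
    let Y : ((ι → ℂ) × (ι → ℂ)) → ι → ℂ := fun p => (Δ p)⁻¹ • (A p • p.2 - C p • p.1)
    have hAc : Continuous A := Continuous.herm ε continuous_fst continuous_const
    have hBc : Continuous B := Continuous.herm ε continuous_fst continuous_const
    have hCc : Continuous C := Continuous.herm ε continuous_snd continuous_const
    have hDc : Continuous D := Continuous.herm ε continuous_snd continuous_const
    have hΔc : Continuous Δ := by fun_prop
    have hA0 : A (z₀, v₀) = 1 := h.ze
    have hB0 : B (z₀, v₀) = 0 := h.zf
    have hC0 : C (z₀, v₀) = 0 := h.ve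
    have hD0 : D (z₀, v₀) = 1 := h.vf
    have hΔ0 : Δ (z₀, v₀) = 1 := by simp only [Δ, hA0, hB0, hC0, hD0]; ring
    have hX0 : X (z₀, v₀) = z₀ := by simp only [X, hΔ0, hD0, hB0]; simp
    have hY0 : Y (z₀, v₀) = v₀ := by simp only [Y, hΔ0, hA0, hC0]; simp
    have hinv : ContinuousAt (fun p => (Δ p)⁻¹) (z₀, v₀) :=
      hΔc.continuousAt.inv₀ (by rw [hΔ0]; exact one_ne_zero)
    have hXc : ContinuousAt X (z₀, v₀) := hinv.smul (Continuous.continuousAt (by fun_prop))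
    have hYc : ContinuousAt Y (z₀, v₀) := hinv.smul (Continuous.continuousAt (by fun_prop))
    let Θ : ((ι → ℂ) × (ι → ℂ)) × (Fin 3 → ℂ) →
        ((ι → ℂ) × (ι → ℂ)) × ((Fin 3 → ℂ) × (Fin 3 → ℂ)) := fun q =>
      ((X q.1, Y q.1), (fun k => A q.1 + q.2 k * C q.1, fun k => B q.1 + q.2 k * D q.1))
    have hΘ0 : Θ ((z₀, v₀), 0) = ((z₀, v₀), ((fun _ => 1), (fun _ => 0))) := by
      simp only [Θ, hX0, hY0, hA0, hB0, hC0, hD0]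
      simp
    have hΘc : Tendsto Θ (𝓝 ((z₀, v₀), 0)) (𝓝 ((z₀, v₀), ((fun _ => 1), (fun _ => 0)))) := by
      rw [← hΘ0]
      have h1 : ContinuousAt (fun q : ((ι → ℂ) × (ι → ℂ)) × (Fin 3 → ℂ) => X q.1)
          ((z₀, v₀), 0) := ContinuousAt.comp (f := Prod.fst) (g := X) hXc continuousAt_fst
      have h2 : ContinuousAt (fun q : ((ι → ℂ) × (ι → ℂ)) × (Fin 3 → ℂ) => Y q.1)
          ((z₀, v₀), 0) := ContinuousAt.comp (f := Prod.fst) (g := Y) hYc continuousAt_fst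
      have h3 : Continuous fun q : ((ι → ℂ) × (ι → ℂ)) × (Fin 3 → ℂ) =>
        ((fun k => A q.1 + q.2 k * C q.1, fun k => B q.1 + q.2 k * D q.1) :
          (Fin 3 → ℂ) × (Fin 3 → ℂ)) := by fun_prop
      exact (h1.prodMk h2).prodMk h3.continuousAt
    have hΔne : ∀ᶠ q : ((ι → ℂ) × (ι → ℂ)) × (Fin 3 → ℂ) in 𝓝 ((z₀, v₀), 0), Δ q.1 ≠ 0 := by
      have h1 : Tendsto (fun q : ((ι → ℂ) × (ι → ℂ)) × (Fin 3 → ℂ) => Δ q.1) (𝓝 ((z₀, v₀), 0))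
          (𝓝 (Δ (z₀, v₀))) := (hΔc.comp continuous_fst).tendsto ((z₀, v₀), 0)
      refine h1.eventually (isOpen_ne.mem_nhds ?_)
      rw [hΔ0]
      exact one_ne_zero
    filter_upwards [hΘc.eventually hA, hΔne] with q hq hΔq i j k
    have hΔq' : (Δ q.1)⁻¹ * Δ q.1 = 1 := inv_mul_cancel₀ hΔq
    have key : ∀ s : ℂ, (A q.1 + s * C q.1) • X q.1 + (B q.1 + s * D q.1) • Y q.1
        = q.1.1 + s • q.1.2 := by
      intro s
      have h1 : (A q.1 + s * C q.1) • X q.1 + (B q.1 + s * D q.1) • Y q.1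
          = ((Δ q.1)⁻¹ * Δ q.1) • (q.1.1 + s • q.1.2) := by
        simp only [X, Y, Δ]
        module
      rw [h1, hΔq', one_smul]
    have hX : ∀ w, herm ε (X q.1) w
        = (Δ q.1)⁻¹ * (D q.1 * herm ε q.1.1 w - B q.1 * herm ε q.1.2 w) := by
      intro w
      simp only [X, herm_smul_left, herm_sub_left]
    have hY : ∀ w, herm ε (Y q.1) w
        = (Δ q.1)⁻¹ * (A q.1 * herm ε q.1.2 w - C q.1 * herm ε q.1.1 w) := by
      intro w
      simp only [Y, herm_smul_left, herm_sub_left]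
    have := hq ?_ ?_ ?_ ?_ i j k
    · simpa only [Θ, key] using this
    · refine (hX e).trans ?_
      rw [← hΔq']
      simp only [Δ, A, B, C, D]
      ring
    · refine (hX f).trans ?_
      simp only [B, D]
      ring
    · refine (hY e).trans ?_
      simp only [A, C]
      ring
    · refine (hY f).trans ?_
      rw [← hΔq']
      simp only [Δ, A, B, C, D]
      ring
  obtain ⟨r, hr, hrO⟩ := Metric.isOpen_iff.1 hO z₀ hz₀
  obtain ⟨δ, hδ, hδB⟩ := Metric.eventually_nhds_iff.1 hB
  refine ⟨r / 2, by positivity, by rwa [mul_div_cancel₀ _ (two_ne_zero' ℝ)], ?_⟩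
  intro x hx v hv s₁ s₂ hs₁ hs₂ i j k
  set κ₀ : ℝ := min (δ / 2) (r / 2 / (‖v₀‖ + 1)) with hκ₀
  have hκpos : 0 < κ₀ := by positivity
  have hκδ : κ₀ < δ := lt_of_le_of_lt (min_le_left _ _) (by linarith)
  have hκv : ‖(κ₀ : ℂ) • v₀‖ < r / 2 := by
    rw [norm_smul, Complex.norm_real, Real.norm_of_nonneg hκpos.le]
    calc κ₀ * ‖v₀‖ < κ₀ * (‖v₀‖ + 1) := by
          apply mul_lt_mul_of_pos_left _ hκpos
          linarith
      _ ≤ r / 2 / (‖v₀‖ + 1) * (‖v₀‖ + 1) :=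
          mul_le_mul_of_nonneg_right (min_le_right _ _) (by positivity)
      _ = r / 2 := div_mul_cancel₀ _ (by positivity)
  set Bset : Set ((ι → ℂ) × (ι → ℂ)) := Metric.ball z₀ (r / 2) ×ˢ Metric.ball 0 (r / 2) with hBset
  have hBo : IsOpen Bset := Metric.isOpen_ball.prod Metric.isOpen_ball
  have hBcv : Convex ℝ Bset := (convex_ball _ _).prod (convex_ball _ _)
  have hmem : ∀ s : ℂ, ‖s‖ ≤ 1 → ∀ p ∈ Bset, p.1 + s • p.2 ∈ O := by
    intro s hs p hp
    apply hrO
    have h1 : ‖p.1 - z₀‖ < r / 2 := by simpa [dist_eq_norm] using hp.1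
    have h2 : ‖p.2‖ < r / 2 := by simpa using hp.2
    rw [Metric.mem_ball, dist_eq_norm]
    calc ‖p.1 + s • p.2 - z₀‖ = ‖(p.1 - z₀) + s • p.2‖ := by congr 1; abel
      _ ≤ ‖p.1 - z₀‖ + ‖s‖ * ‖p.2‖ := by rw [← norm_smul]; exact norm_add_le _ _
      _ ≤ ‖p.1 - z₀‖ + 1 * ‖p.2‖ := by gcongr
      _ < r := by linarith
  have hd : ∀ s : ℂ, ‖s‖ ≤ 1 → DifferentiableOn ℂ
      (fun p : (ι → ℂ) × (ι → ℂ) => F (p.1 + s • p.2)) Bset := by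
    intro s hs
    have h3 : DifferentiableOn ℂ (fun p : (ι → ℂ) × (ι → ℂ) => p.1 + s • p.2) Bset := by fun_prop
    exact hF.comp h3 fun p hp => hmem s hs p hp
  have hmain := eqOn_zero_of_convex hBo hBcv (((hd 0 (by simp)).minor3 (hd s₁ hs₁) (hd s₂ hs₂))
    i j k) (q := (z₀, (κ₀ : ℂ) • v₀)) ⟨by simpa using hr, by simpa using hκv⟩ ?_ (x := (x, v))
    ⟨hx, hv⟩
  · simpa using hmain
  · have hκne : (κ₀ : ℂ) ≠ 0 := by exact_mod_cast hκpos.ne'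
    have hc : Tendsto (fun p : (ι → ℂ) × (ι → ℂ) => (p.1, (κ₀ : ℂ)⁻¹ • p.2))
        (𝓝 (z₀, (κ₀ : ℂ) • v₀)) (𝓝 (z₀, v₀)) := by
      have : Continuous fun p : (ι → ℂ) × (ι → ℂ) => (p.1, (κ₀ : ℂ)⁻¹ • p.2) := by fun_prop
      have h1 := this.tendsto (z₀, (κ₀ : ℂ) • v₀)
      have h2 : (κ₀ : ℂ)⁻¹ • (κ₀ : ℂ) • v₀ = v₀ := by
        rw [smul_smul, inv_mul_cancel₀ hκne, one_smul]
      simpa only [h2] using h1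
    filter_upwards [hc.eventually (Metric.ball_mem_nhds _ hδ)] with p hp
    have h1 := @hδB ((p.1, (κ₀ : ℂ)⁻¹ • p.2), ![0, κ₀ * s₁, κ₀ * s₂]) ?_ i j k
    · have h2 : ∀ s : ℂ, ((κ₀ : ℂ) * s) • (κ₀ : ℂ)⁻¹ • p.2 = s • p.2 := by
        intro s
        rw [smul_smul, mul_comm (κ₀ : ℂ) s, mul_assoc, mul_inv_cancel₀ hκne, mul_one]
      simpa [h2] using h1
    · rw [Prod.dist_eq]
      refine max_lt hp ?_
      rw [dist_zero_right, pi_norm_lt_iff hδ]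
      have h3 : ∀ s : ℂ, ‖s‖ ≤ 1 → ‖(κ₀ : ℂ) * s‖ < δ := by
        intro s hs
        rw [norm_mul, Complex.norm_real, Real.norm_of_nonneg hκpos.le]
        nlinarith
      intro k
      fin_cases k
      · simpa using hδ
      · exact h3 s₁ hs₁
      · exact h3 s₂ hs₂

end Collinear

/-! ### Local collineations are linear -/

section Collineation

variable {ι κ : Type*} [Fintype ι] [Fintype κ]

/-- A local holomorphic collineation, in affine coordinates of the target, whose image does not
lie in a line, agrees near some point with an affine map up to a scalar factor. Restricting to
the lines through a point `x₀` with `L = dF(x₀) ≠ 0` gives `F x = F x₀ + L (x - x₀) / μ x`, and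
the remaining lines force the function `μ` to be affine. -/
theorem exists_affine_of_collinear {F : (ι → ℂ) → κ → ℂ} {O : Set (ι → ℂ)} (hO : IsOpen O)
    (hOc : Convex ℝ O) (hF : DifferentiableOn ℂ F O) (i₀ : κ) (hi₀ : ∀ x ∈ O, F x i₀ = 1)
    (hcol : ∀ x ∈ O, ∀ y ∈ O, ∀ s : ℂ, ‖s‖ ≤ 1 → x + s • (y - x) ∈ O → ∀ i j k,
      minor3 (F x) (F y) (F (x + s • (y - x))) i j k = 0)
    {p : Fin 3 → ι → ℂ} (hp : ∀ k, p k ∈ O) (hind : LinearIndependent ℂ fun k => F (p k)) :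
    ∃ (A : (ι → ℂ) →ₗ[ℂ] (κ → ℂ)) (b : κ → ℂ), ∃ q ∈ O, ∃ r > 0, Metric.ball q r ⊆ O ∧
      ∀ x ∈ Metric.ball q r, ∃ μ : ℂ, μ ≠ 0 ∧ μ • F x = A x + b := by
  have hFat : ∀ x ∈ O, DifferentiableAt ℂ F x := fun x hx =>
    (hF x hx).differentiableAt (hO.mem_nhds hx)
  obtain ⟨x₀, hx₀, hL0⟩ : ∃ x₀ ∈ O, fderiv ℂ F x₀ ≠ 0 := by
    by_contra hcon
    push Not at hcon
    have hconst : F (p 0) = F (p 1) := hO.is_const_of_fderiv_eq_zero hOc.isPreconnected hF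
      (fun x hx => hcon x hx) (hp 0) (hp 1)
    exact absurd (hind.injective hconst) (by decide)
  set L := fderiv ℂ F x₀ with hL
  have hLd : HasFDerivAt F L x₀ := (hFat x₀ hx₀).hasFDerivAt
  have hline : ∀ h : ι → ℂ, HasDerivAt (fun t : ℂ => F (x₀ + t • h)) (L h) 0 := by
    intro h
    have h1 : HasDerivAt (fun t : ℂ => x₀ + t • h) h 0 := by
      simpa using ((hasDerivAt_id (0 : ℂ)).smul_const h).const_add x₀
    have h2 : HasFDerivAt F L (x₀ + (0 : ℂ) • h) := by simpa using hLd
    exact h2.comp_hasDerivAt (0 : ℂ) h1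
  have hcont : ∀ h : ι → ℂ, ∀ x : ι → ℂ, x ∈ O → ∀ᶠ t : ℂ in 𝓝 0, x + t • h ∈ O := by
    intro h x hx
    have h1 : Continuous fun t : ℂ => x + t • h := by fun_prop
    exact h1.continuousAt.eventually (hO.mem_nhds (by simpa using hx))
  have hLi₀ : ∀ h, L h i₀ = 0 := by
    intro h
    have h1 := hasDerivAt_pi.1 (hline h) i₀
    have h2 : HasDerivAt (fun t : ℂ => F (x₀ + t • h) i₀) 0 0 := by
      refine (hasDerivAt_const (0 : ℂ) (1 : ℂ)).congr_of_eventuallyEq ?_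
      filter_upwards [hcont h x₀ hx₀] with t ht using hi₀ _ ht
    exact h1.unique h2
  set D : (ι → ℂ) → κ → ℂ := fun x => F x - F x₀ with hD
  have hDi : ∀ i, DifferentiableOn ℂ (fun x => D x i) O := fun i =>
    (differentiableOn_pi.1 hF i).sub_const _
  -- lines through `x₀` are mapped to lines, so `D x` is parallel to `L (x - x₀)`
  have hstar : ∀ x ∈ O, ∀ i j, D x i * L (x - x₀) j = D x j * L (x - x₀) i := by
    intro x hx i j
    have hd : ∀ i, HasDerivAt (fun t : ℂ => D (x₀ + t • (x - x₀)) i) (L (x - x₀) i) 0 := fun i =>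
      (hasDerivAt_pi.1 (hline (x - x₀)) i).sub_const _
    have h1 := ((hd j).const_mul (D x i)).sub ((hd i).const_mul (D x j))
    have h2 : HasDerivAt (fun t : ℂ => D x i * D (x₀ + t • (x - x₀)) j -
        D x j * D (x₀ + t • (x - x₀)) i) 0 0 := by
      refine (hasDerivAt_const (0 : ℂ) (0 : ℂ)).congr_of_eventuallyEq ?_
      have hs : ∀ᶠ t : ℂ in 𝓝 0, ‖t‖ ≤ 1 := by
        filter_upwards [Metric.ball_mem_nhds (0 : ℂ) one_pos] with t ht
        exact (by simpa using ht : ‖t‖ < 1).le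
      filter_upwards [hcont (x - x₀) x₀ hx₀, hs] with t ht hts
      have h3 := hcol x₀ hx₀ x hx t hts ht i₀ i j
      simp only [minor3, hi₀ _ hx₀, hi₀ _ hx, hi₀ _ ht] at h3
      simp only [hD, Pi.sub_apply]
      linear_combination h3
    have h3 := h1.unique h2
    linear_combination h3
  obtain ⟨v₁, v₂, i, j, hv⟩ : ∃ v₁ v₂ i j, L v₁ i * L v₂ j - L v₁ j * L v₂ i ≠ 0 := by
    by_contra hcon
    push Not at hcon
    obtain ⟨v, hv⟩ : ∃ v, L v ≠ 0 := by
      by_contra h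
      push Not at h
      exact hL0 (ContinuousLinearMap.ext h)
    obtain ⟨i, hi⟩ := Function.ne_iff.1 hv
    have hi : L v i ≠ 0 := hi
    have hpar : ∀ x ∈ O, ∀ j, D x i * L v j - D x j * L v i = 0 := by
      intro x hx j
      obtain ⟨t, htO, ht0⟩ : ∃ t : ℂ, x₀ + t • v ∈ O ∧ t ≠ 0 :=
        (((hcont v x₀ hx₀).filter_mono nhdsWithin_le_nhds).and
          (self_mem_nhdsWithin (s := ({0}ᶜ : Set ℂ)))).exists
      have hdiff : DifferentiableOn ℂ (fun x => D x i * L v j - D x j * L v i) O :=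
        ((hDi i).mul_const _).sub ((hDi j).mul_const _)
      refine eqOn_zero_of_convex hO hOc hdiff htO ?_ hx
      have hne : ∀ᶠ y in 𝓝 (x₀ + t • v), L (y - x₀) i ≠ 0 := by
        have hc : Continuous fun y => L (y - x₀) i := by fun_prop
        refine hc.continuousAt.eventually_ne ?_
        simp [ht0, hi]
      filter_upwards [hne, hO.mem_nhds htO] with y hy hyO
      refine (mul_eq_zero.1 (?_ : L (y - x₀) i * _ = 0)).resolve_left hy
      linear_combination L v i * hstar y hyO i j + D y i * hcon (y - x₀) v i j
    have hFx : ∀ x ∈ O, F x = F x₀ + (D x i / L v i) • L v := by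
      intro x hx
      funext k
      have h1 := hpar x hx k
      have h2 : D x k = D x i / L v i * L v k := by
        field_simp
        linear_combination -h1
      simp only [Pi.add_apply, Pi.smul_apply, smul_eq_mul, ← h2]
      simp [hD]
    set a : Fin 3 → ℂ := fun k => D (p k) i / L v i with ha
    have hFp : ∀ k, F (p k) = F x₀ + a k • L v := fun k => hFx _ (hp k)
    have h0 := Fintype.linearIndependent_iff.1 hind ![a 1 - a 2, a 2 - a 0, a 0 - a 1] (by
      rw [Fin.sum_univ_three]
      change (a 1 - a 2) • F (p 0) + (a 2 - a 0) • F (p 1) + (a 0 - a 1) • F (p 2) = 0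
      rw [hFp, hFp, hFp]
      module) 0
    have h1 : a 1 = a 2 := by simpa [sub_eq_zero] using h0
    have h2 : F (p 1) = F (p 2) := by rw [hFp, hFp, h1]
    exact absurd (hind.injective h2) (by decide)
  obtain ⟨k, hk⟩ : ∃ k, L v₁ k ≠ 0 := by
    by_contra h
    push Not at h
    exact hv (by simp [h])
  -- a base point `q` near `x₀` on the line in direction `v₁`
  obtain ⟨t₀, ⟨htO, ht0⟩, htD⟩ : ∃ t : ℂ, (x₀ + t • v₁ ∈ O ∧ t ≠ 0) ∧ D (x₀ + t • v₁) k ≠ 0 := by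
    have h1 : HasDerivAt (fun t : ℂ => D (x₀ + t • v₁) k) (L v₁ k) 0 :=
      (hasDerivAt_pi.1 (hline v₁) k).sub_const _
    have h2 := h1.eventually_ne (c := 0) hk
    exact ((((hcont v₁ x₀ hx₀).filter_mono nhdsWithin_le_nhds).and
          (self_mem_nhdsWithin (s := ({0}ᶜ : Set ℂ)))).and h2).exists
  set q := x₀ + t₀ • v₁ with hq
  have hDk : ContinuousAt (fun x => D x k) q := ((hDi k).continuousOn.continuousAt (hO.mem_nhds htO))
  have hLk : Continuous fun x => L (x - x₀) k := by fun_prop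
  have hLq : L (q - x₀) = t₀ • L v₁ := by simp [hq]
  obtain ⟨r, hr, hball⟩ : ∃ r > 0, ∀ x ∈ Metric.ball q r, x ∈ O ∧ D x k ≠ 0 ∧ L (x - x₀) k ≠ 0 := by
    have h1 : ∀ᶠ x in 𝓝 q, x ∈ O ∧ D x k ≠ 0 ∧ L (x - x₀) k ≠ 0 := by
      have h2 : ∀ᶠ x in 𝓝 q, x ∈ O := hO.mem_nhds htO
      refine h2.and ((hDk.eventually_ne htD).and
        (hLk.continuousAt.eventually_ne ?_))
      rw [hLq]
      simp [ht0, hk]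
    obtain ⟨r, hr, h2⟩ := Metric.eventually_nhds_iff.1 h1
    exact ⟨r, hr, fun x hx => h2 hx⟩
  have hqb : q ∈ Metric.ball q r := Metric.mem_ball_self hr
  set lam : (ι → ℂ) → ℂ := fun x => L (x - x₀) k / D x k with hlam
  have hlamne : ∀ x ∈ Metric.ball q r, lam x ≠ 0 := fun x hx =>
    div_ne_zero (hball x hx).2.2 (hball x hx).2.1
  have hlamD : ∀ x ∈ Metric.ball q r, ∀ l, lam x * F x l = lam x * F x₀ l + L (x - x₀) l := by
    intro x hx l
    have h1 := hstar x (hball x hx).1 k l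
    have h2 := (hball x hx).2.1
    have h3 : lam x * D x l = L (x - x₀) l := by
      simp only [hlam]
      field_simp
      linear_combination -h1
    have h4 : D x l = F x l - F x₀ l := rfl
    rw [← h3, h4]
    ring
  have hlamd : DifferentiableOn ℂ lam (Metric.ball q r) := by
    have h1 : Differentiable ℂ fun x => L (x - x₀) :=
      L.differentiable.comp (differentiable_id.sub_const x₀)
    have h2 : DifferentiableOn ℂ (fun x => L (x - x₀) k) (Metric.ball q r) :=
      (differentiable_pi.1 h1 k).differentiableOn
    have h3 : DifferentiableOn ℂ (fun x => (D x k)⁻¹) (Metric.ball q r) := fun x hx =>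
      ((hDi k).mono (fun x hx => (hball x hx).1) x hx).fun_inv (hball x hx).2.1
    simp only [hlam, div_eq_mul_inv]
    exact h2.mul h3
  set dl := fderiv ℂ lam q with hdl
  have hdld : HasFDerivAt lam dl q :=
    ((hlamd q hqb).differentiableAt (Metric.isOpen_ball.mem_nhds hqb)).hasFDerivAt
  have hnorm : ∀ h : ι → ℂ, ∀ s : ℂ, ‖s‖ ≤ 1 → q + h ∈ Metric.ball q r →
      q + s • h ∈ Metric.ball q r := by
    intro h s hs hh
    rw [Metric.mem_ball, dist_eq_norm, add_sub_cancel_left] at hh ⊢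
    rw [norm_smul]
    nlinarith [norm_nonneg h]
  -- on lines through `q` in general position the function `lam` is affine
  have haff : ∀ h : ι → ℂ, q + h ∈ Metric.ball q r → L v₁ i * L h j - L v₁ j * L h i ≠ 0 →
      lam (q + h) = lam q + dl h := by
    intro h hh hgen
    have hs : ∀ s : ℂ, ‖s‖ ≤ 1 → lam (q + s • h) = lam q + s * (lam (q + h) - lam q) := by
      intro s hs
      have hz := hnorm h s hs hh
      have e : q + s • ((q + h) - q) = q + s • h := by rw [add_sub_cancel_left]
      have h1 := hcol q htO (q + h) (hball _ hh).1 s hs (by rw [e]; exact (hball _ hz).1) i₀ i j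
      rw [e] at h1
      simp only [minor3, hi₀ _ htO, hi₀ _ (hball _ hh).1, hi₀ _ (hball _ hz).1] at h1
      have a1 := hlamD q hqb
      have a2 := hlamD _ hh
      have a3 := hlamD _ hz
      have b2 : ∀ l, L (q + h - x₀) l = t₀ * L v₁ l + L h l := by
        intro l
        rw [show q + h - x₀ = (q - x₀) + h by abel, map_add, hLq]
        simp
      have b3 : ∀ l, L (q + s • h - x₀) l = t₀ * L v₁ l + s * L h l := by
        intro l
        rw [show q + s • h - x₀ = (q - x₀) + s • h by abel, map_add, hLq, map_smul]
        simp
      have b1 : ∀ l, L (q - x₀) l = t₀ * L v₁ l := by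
        intro l
        rw [hLq]
        simp
      simp only [b1] at a1
      simp only [b2] at a2
      simp only [b3] at a3
      have h2 : lam q * lam (q + h) * lam (q + s • h) * (F (q + h) i * F (q + s • h) j
          - F (q + h) j * F (q + s • h) i - F q i * (F (q + s • h) j - F (q + h) j)
          + F q j * (F (q + s • h) i - F (q + h) i)) = 0 := by
        linear_combination lam q * lam (q + h) * lam (q + s • h) * h1
      have h3 : (lam (q + s • h) - lam q - s * (lam (q + h) - lam q)) *
          (t₀ * (L v₁ i * L h j - L v₁ j * L h i)) = 0 := by
        have h4 : lam q * ((lam (q + h) * F (q + h) i) * (lam (q + s • h) * F (q + s • h) j)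
            - (lam (q + h) * F (q + h) j) * (lam (q + s • h) * F (q + s • h) i))
            - (lam q * F q i) * (lam (q + h) * (lam (q + s • h) * F (q + s • h) j)
              - lam (q + s • h) * (lam (q + h) * F (q + h) j))
            + (lam q * F q j) * (lam (q + h) * (lam (q + s • h) * F (q + s • h) i)
              - lam (q + s • h) * (lam (q + h) * F (q + h) i)) = 0 := by
          linear_combination h2
        rw [a1, a1, a2, a2, a3, a3] at h4
        linear_combination h4
      have h5 := (mul_eq_zero.1 h3).resolve_right (mul_ne_zero ht0 hgen)
      linear_combination h5
    have h1 : HasDerivAt (fun s : ℂ => lam (q + s • h)) (dl h) 0 := by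
      have h1 : HasDerivAt (fun t : ℂ => q + t • h) h 0 := by
        simpa using ((hasDerivAt_id (0 : ℂ)).smul_const h).const_add q
      have h2 : HasFDerivAt lam dl (q + (0 : ℂ) • h) := by simpa using hdld
      exact h2.comp_hasDerivAt (0 : ℂ) h1
    have h2 : HasDerivAt (fun s : ℂ => lam (q + s • h)) (lam (q + h) - lam q) 0 := by
      have h3 : HasDerivAt (fun s : ℂ => lam q + s * (lam (q + h) - lam q))
          (lam (q + h) - lam q) 0 := by
        simpa using ((hasDerivAt_id (0 : ℂ)).mul_const (lam (q + h) - lam q)).const_add (lam q)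
      refine h3.congr_of_eventuallyEq ?_
      filter_upwards [Metric.ball_mem_nhds (0 : ℂ) one_pos] with s hs1
      exact hs s (by simpa using hs1 : ‖s‖ < 1).le
    rw [h1.unique h2]
    ring
  have hall : ∀ x ∈ Metric.ball q r, lam x = lam q + dl (x - q) := by
    obtain ⟨t, htb, ht0'⟩ : ∃ t : ℂ, q + t • v₂ ∈ Metric.ball q r ∧ t ≠ 0 := by
      have h1 : Continuous fun t : ℂ => q + t • v₂ := by fun_prop
      have h2 : ∀ᶠ t : ℂ in 𝓝 0, q + t • v₂ ∈ Metric.ball q r :=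
        h1.continuousAt.eventually (Metric.isOpen_ball.mem_nhds (by simpa using hr))
      exact ((h2.filter_mono nhdsWithin_le_nhds).and
          (self_mem_nhdsWithin (s := ({0}ᶜ : Set ℂ)))).exists
    intro x hx
    have hdiff : DifferentiableOn ℂ (fun x => lam x - (lam q + dl (x - q))) (Metric.ball q r) := by
      refine hlamd.sub (Differentiable.differentiableOn ?_)
      exact (dl.differentiable.comp (differentiable_id.sub_const q)).const_add _
    have h1 := eqOn_zero_of_convex Metric.isOpen_ball (convex_ball q r) hdiff htb ?_ hx
    · exact sub_eq_zero.1 h1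
    · have hne : ∀ᶠ y in 𝓝 (q + t • v₂), L v₁ i * L (y - q) j - L v₁ j * L (y - q) i ≠ 0 := by
        have hc : Continuous fun y => L v₁ i * L (y - q) j - L v₁ j * L (y - q) i := by fun_prop
        refine hc.continuousAt.eventually_ne ?_
        have : L v₁ i * (t * L v₂ j) - L v₁ j * (t * L v₂ i) ≠ 0 := by
          rw [show L v₁ i * (t * L v₂ j) - L v₁ j * (t * L v₂ i)
            = t * (L v₁ i * L v₂ j - L v₁ j * L v₂ i) by ring]
          exact mul_ne_zero ht0' hv
        simpa using this
      filter_upwards [hne, Metric.isOpen_ball.mem_nhds htb] with y hy hyb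
      have h2 := haff (y - q) (by simpa using hyb) hy
      rw [add_sub_cancel] at h2
      rw [h2, sub_self]
  refine ⟨dl.toLinearMap.smulRight (F x₀) + L.toLinearMap, (lam q - dl q) • F x₀ - L x₀, q, htO, r,
    hr, fun x hx => (hball x hx).1, fun x hx => ⟨lam x, hlamne x hx, ?_⟩⟩
  funext l
  have h1 := hlamD x hx l
  simp only [Pi.smul_apply, smul_eq_mul, h1, Pi.add_apply, Pi.sub_apply, LinearMap.add_apply,
    LinearMap.smulRight_apply, ContinuousLinearMap.coe_coe, map_sub]
  rw [hall x hx, map_sub]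
  ring

/-- A local holomorphic collineation that is constant along the lines through the origin agrees
near some point with a linear map up to a scalar factor. -/
theorem exists_linear_of_collinear {F : (ι → ℂ) → κ → ℂ} {O : Set (ι → ℂ)} (hO : IsOpen O)
    (hOc : Convex ℝ O) (hF : DifferentiableOn ℂ F O) (i₀ : κ) (hi₀ : ∀ x ∈ O, F x i₀ = 1)
    (hcol : ∀ x ∈ O, ∀ y ∈ O, ∀ s : ℂ, ‖s‖ ≤ 1 → x + s • (y - x) ∈ O → ∀ i j k,
      minor3 (F x) (F y) (F (x + s • (y - x))) i j k = 0)
    {p : Fin 3 → ι → ℂ} (hp : ∀ k, p k ∈ O) (hind : LinearIndependent ℂ fun k => F (p k))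
    (hhom : ∀ x ∈ O, ∀ c : ℂ, c • x ∈ O → F (c • x) = F x) :
    ∃ A : (ι → ℂ) →ₗ[ℂ] (κ → ℂ), ∃ q ∈ O, ∀ᶠ x in 𝓝 q, ∃ μ : ℂ, μ ≠ 0 ∧ μ • F x = A x := by
  obtain ⟨A, b, q, hq, r, hr, hrO, h⟩ :=
    exists_affine_of_collinear hO hOc hF i₀ hi₀ hcol hp hind
  refine ⟨A, q, hq, ?_⟩
  have hb : b = 0 := by
    by_contra hb0
    have hconst : ∀ x ∈ Metric.ball q r, ∀ l, b i₀ * F x l = b l := by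
      intro x hx l
      obtain ⟨c, hcx, hc1⟩ : ∃ c : ℂ, c • x ∈ Metric.ball q r ∧ c ≠ 1 := by
        have h1 : Continuous fun c : ℂ => c • x := by fun_prop
        have h2 : ∀ᶠ c : ℂ in 𝓝 1, c • x ∈ Metric.ball q r :=
          h1.continuousAt.eventually (Metric.isOpen_ball.mem_nhds (by simpa using hx))
        exact ((h2.filter_mono nhdsWithin_le_nhds).and
          (self_mem_nhdsWithin (s := ({1}ᶜ : Set ℂ)))).exists
      obtain ⟨μ, -, h1⟩ := h x hx
      obtain ⟨ν, -, h2⟩ := h _ hcx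
      rw [hhom x (hrO hx) c (hrO hcx), map_smul] at h2
      have h3 : ∀ l, (ν - c * μ) * F x l = (1 - c) * b l := by
        intro l
        have h4 := congrFun h1 l
        have h5 := congrFun h2 l
        simp only [Pi.smul_apply, Pi.add_apply, smul_eq_mul] at h4 h5
        linear_combination h5 - c * h4
      have h4 := h3 i₀
      rw [hi₀ x (hrO hx)] at h4
      refine mul_left_cancel₀ (sub_ne_zero.2 hc1.symm) ?_
      rw [← h3 l]
      linear_combination -F x l * h4
    have hbi : b i₀ ≠ 0 := by
      intro h0
      apply hb0
      funext l
      have := hconst q (Metric.mem_ball_self hr) l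
      rw [h0, zero_mul] at this
      exact this.symm
    have hall : ∀ x ∈ O, ∀ l, b i₀ * F x l - b l = 0 := by
      intro x hx l
      refine eqOn_zero_of_convex hO hOc
        (((differentiableOn_pi.1 hF l).const_mul _).sub_const _) hq ?_ hx
      filter_upwards [Metric.ball_mem_nhds q hr] with y hy
      rw [hconst y hy l, sub_self]
    have heq : F (p 0) = F (p 1) := by
      funext l
      refine mul_left_cancel₀ hbi ?_
      linear_combination hall _ (hp 0) l - hall _ (hp 1) l
    exact absurd (hind.injective heq) (by decide)
  filter_upwards [Metric.ball_mem_nhds q hr] with x hx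
  simpa [hb] using h x hx

end Collineation

/-! ### Null frames -/

section Frames

variable {ι : Type*} [Fintype ι]

/-- The part of a vector supported on the coordinates of sign `σ`. -/
noncomputable def signPart (ε : ι → ℝ) (σ : ℝ) (z : ι → ℂ) : ι → ℂ :=
  open Classical in fun k => if ε k = σ then z k else 0

theorem herm_signPart_signPart (ε : ι → ℝ) (σ : ℝ) (z w : ι → ℂ) :
    herm ε (signPart ε σ z) (signPart ε σ w) = herm ε (signPart ε σ z) w := by
  refine Finset.sum_congr rfl fun k _ => ?_
  by_cases h : ε k = σ <;> simp [signPart, h]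

theorem herm_signPart_of_ne (ε : ι → ℝ) {σ τ : ℝ} (hστ : σ ≠ τ) (z w : ι → ℂ) :
    herm ε (signPart ε σ z) (signPart ε τ w) = 0 := by
  refine Finset.sum_eq_zero fun k _ => ?_
  by_cases h : ε k = σ
  · simp [signPart, h, hστ]
  · simp [signPart, h]

theorem herm_eq_signPart_add {ε : ι → ℝ} (hε : ∀ i, ε i = 1 ∨ ε i = -1 ∨ ε i = 0)
    (z w : ι → ℂ) : herm ε z w = herm ε (signPart ε 1 z) w + herm ε (signPart ε (-1) z) w := by
  simp only [herm, ← Finset.sum_add_distrib]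
  refine Finset.sum_congr rfl fun k _ => ?_
  have h1 : (1 : ℝ) ≠ -1 := by norm_num
  rcases hε k with h | h | h <;> simp [signPart, h, h1, h1.symm]

theorem hermSq_signPart (ε : ι → ℝ) (σ : ℝ) (z : ι → ℂ) :
    hermSq ε (signPart ε σ z) = σ * ∑ k, ‖signPart ε σ z k‖ ^ 2 := by
  rw [hermSq, Finset.mul_sum]
  refine Finset.sum_congr rfl fun k _ => ?_
  by_cases h : ε k = σ <;> simp [signPart, h]

/-- A unit vector of sign `σ` orthogonal to `z`, in the span of two coordinate vectors. -/
theorem exists_unit_orthogonal [DecidableEq ι] {ε : ι → ℝ} {σ : ℝ} {z : ι → ℂ} {i j : ι}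
    (hij : i ≠ j) (hi : ε i = σ) (hj : ε j = σ) (hz : z i ≠ 0) :
    ∃ u : ι → ℂ, signPart ε σ u = u ∧ herm ε u z = 0 ∧ herm ε u u = σ := by
  set N : ℝ := ‖z i‖ ^ 2 + ‖z j‖ ^ 2 with hN
  have hNpos : 0 < N := by positivity
  set w : ι → ℂ := Pi.single i (conj (z j)) - Pi.single j (conj (z i)) with hw
  have hwi : w i = conj (z j) := by simp [hw, hij]
  have hwj : w j = -conj (z i) := by simp [hw, hij.symm]
  have hwk : ∀ k, k ≠ i → k ≠ j → w k = 0 := by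
    intro k hki hkj
    simp [hw, hki, hkj]
  have hsum : ∀ y, herm ε w y = σ * (conj (z j) * conj (y i) - conj (z i) * conj (y j)) := by
    intro y
    rw [herm, Finset.sum_eq_add_of_mem i j (Finset.mem_univ _) (Finset.mem_univ _) hij
      (fun k _ hk => by rw [hwk k hk.1 hk.2]; simp), hwi, hwj, hi, hj]
    ring
  refine ⟨((Real.sqrt N)⁻¹ : ℂ) • w, ?_, ?_, ?_⟩
  · funext k
    by_cases h : ε k = σ
    · simp [signPart, h]
    · have h1 : k ≠ i := fun h' => h (h' ▸ hi)
      have h2 : k ≠ j := fun h' => h (h' ▸ hj)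
      simp [signPart, h, hwk k h1 h2]
  · rw [herm_smul_left, hsum]
    ring
  · rw [herm_smul_left, herm_smul_right, hsum, hwi, hwj]
    have h1 : ((Real.sqrt N : ℝ) : ℂ) ^ 2 = ((N : ℝ) : ℂ) := by
      rw [← Complex.ofReal_pow, Real.sq_sqrt hNpos.le]
    have h2 : ((Real.sqrt N : ℝ) : ℂ) ≠ 0 := by
      exact_mod_cast (Real.sqrt_pos.2 hNpos).ne'
    have h3 : ((N : ℝ) : ℂ) = z i * conj (z i) + z j * conj (z j) := by
      rw [Complex.mul_conj, Complex.mul_conj, Complex.normSq_eq_norm_sq, Complex.normSq_eq_norm_sq,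
        hN]
      push_cast
      ring
    simp only [map_inv₀, Complex.conj_ofReal, map_neg, Complex.conj_conj]
    field_simp
    rw [h1, h3]
    ring

/-- Every null vector outside the radical belongs to a null frame, and there is a positive unit
vector orthogonal to it and to its dual vector. -/
theorem exists_isNullFrame [DecidableEq ι] {ε : ι → ℝ}
    (hε : ∀ i, ε i = 1 ∨ ε i = -1 ∨ ε i = 0)
    (hpos : ∀ i, ε i = 1 → ∃ j, i ≠ j ∧ ε j = 1) (hneg : ∀ i, ε i = -1 → ∃ j, i ≠ j ∧ ε j = -1)
    {z : ι → ℂ} (hz : herm ε z z = 0) (hz0 : ∃ k, ε k ≠ 0 ∧ z k ≠ 0) :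
    ∃ v e f u : ι → ℂ, IsNullFrame ε z v e f ∧ herm ε u z = 0 ∧ herm ε u e = 0 ∧
      herm ε u u = 1 := by
  have h11 : (1 : ℝ) ≠ -1 := by norm_num
  set a := signPart ε 1 z with ha
  set b := signPart ε (-1) z with hb
  set c : ℝ := hermSq ε a with hc
  have hza : herm ε z a = c := by
    rw [← herm_conj, ha, ← herm_signPart_signPart, herm_self, Complex.conj_ofReal]
  have hzb' : herm ε z b = hermSq ε b := by
    rw [← herm_conj, hb, ← herm_signPart_signPart, herm_self, Complex.conj_ofReal]
  have hcb : hermSq ε b = -c := by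
    have h1 := herm_eq_signPart_add hε z z
    rw [hz, ← ha, ← hb, ← herm_conj ε z a, ← herm_conj ε z b, hza, hzb'] at h1
    simp only [Complex.conj_ofReal] at h1
    have h2 : (0 : ℝ) = c + hermSq ε b := by exact_mod_cast h1
    linarith
  have hc1 : c = ∑ k, ‖a k‖ ^ 2 := by rw [hc, ha, hermSq_signPart, one_mul]
  have hc2 : c = ∑ k, ‖b k‖ ^ 2 := by
    have h1 : hermSq ε b = -1 * ∑ k, ‖b k‖ ^ 2 := by rw [hb, hermSq_signPart]
    linarith
  have hcpos : 0 < c := by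
    obtain ⟨k, hk, hzk⟩ := hz0
    rcases hε k with h | h | h
    · rw [hc1]
      refine Finset.sum_pos' (fun _ _ => by positivity) ⟨k, Finset.mem_univ k, ?_⟩
      have : a k = z k := by simp [ha, signPart, h]
      rw [this]; positivity
    · rw [hc2]
      refine Finset.sum_pos' (fun _ _ => by positivity) ⟨k, Finset.mem_univ k, ?_⟩
      have : b k = z k := by simp [hb, signPart, h]
      rw [this]; positivity
    · exact absurd h hk
  have hex : ∀ σ : ℝ, 0 < ∑ k, ‖signPart ε σ z k‖ ^ 2 → ∃ k, ε k = σ ∧ z k ≠ 0 := by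
    intro σ hσ
    obtain ⟨k, -, hk⟩ := Finset.exists_ne_zero_of_sum_ne_zero hσ.ne'
    by_cases h : ε k = σ
    · exact ⟨k, h, by rintro h'; simp [signPart, h, h'] at hk⟩
    · simp [signPart, h] at hk
  obtain ⟨i, hi, hzi⟩ := hex 1 (by rw [← ha, ← hc1]; exact hcpos)
  obtain ⟨j, hj, hzj⟩ := hex (-1) (by rw [← hb, ← hc2]; exact hcpos)
  obtain ⟨i', hii', hi'⟩ := hpos i hi
  obtain ⟨j', hjj', hj'⟩ := hneg j hj
  obtain ⟨u, hu, huz, huu⟩ := exists_unit_orthogonal hii' hi hi' hzi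
  obtain ⟨w, hw, hwz, hww⟩ := exists_unit_orthogonal hjj' hj hj' hzj
  have huw : herm ε u w = 0 := by rw [← hu, ← hw]; exact herm_signPart_of_ne ε h11 u w
  have hwu := herm_eq_zero_symm ε huw
  have hua : herm ε u a = 0 := by
    rw [← hu, ha, herm_signPart_signPart, hu, huz]
  have hub : herm ε u b = 0 := by
    rw [← hu, hb, herm_signPart_of_ne ε h11]
  have hwa : herm ε w a = 0 := by
    rw [← hw, ha, herm_signPart_of_ne ε h11.symm]
  have hwb : herm ε w b = 0 := by
    rw [← hw, hb, herm_signPart_signPart, hw, hwz]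
  have haa : herm ε a a = c := herm_self ε a
  have hbb : herm ε b b = -c := by rw [herm_self, hcb]; push_cast; rfl
  have hab : herm ε a b = 0 := herm_signPart_of_ne ε h11 z z
  have hzb : herm ε z b = -c := by rw [hzb', hcb]; push_cast; rfl
  have hba := herm_eq_zero_symm ε hab
  have hzu := herm_eq_zero_symm ε huz
  have hzw := herm_eq_zero_symm ε hwz
  have hau := herm_eq_zero_symm ε hua
  have hbu := herm_eq_zero_symm ε hub
  have haw := herm_eq_zero_symm ε hwa
  have hbw := herm_eq_zero_symm ε hwb
  have hcne : (c : ℂ) ≠ 0 := by exact_mod_cast hcpos.ne'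
  refine ⟨u + w, (1 / (2 * c) : ℂ) • (a - b), (1 / 2 : ℂ) • (u - w), u,
    ⟨hz, ?_, ?_, ?_, ?_, ?_, ?_, ?_, ?_, ?_⟩, huz, ?_, by simpa using huu⟩
  all_goals
    simp only [herm_add_left, herm_add_right, herm_sub_left, herm_sub_right, herm_smul_left,
      herm_smul_right, hzu, hzw, huu, hww, huw, hwu, haa, hbb, hab, hba, hza, hzb, hau, hbu, haw,
      hbw, hua, hub, hwa, hwb, map_div₀, map_mul, map_one, map_ofNat, Complex.conj_ofReal]
    push_cast
    field_simp
    try ring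

end Frames

/-! ### The local theorem -/

section Local

variable {ι κ : Type*} [Fintype ι] [Fintype κ]

/-- The image of a map preserving orthogonality and sides is not contained in a line: it contains
a null point and two orthogonal positive points. -/
theorem exists_independent_images {ε : ι → ℝ} {ε' : κ → ℝ} {F : (ι → ℂ) → κ → ℂ}
    {O : Set (ι → ℂ)} (hO : IsOpen O) (hF0 : ∀ x ∈ O, F x ≠ 0)
    (horth : ∀ z ∈ O, ∀ w ∈ O, herm ε z w = 0 → herm ε' (F z) (F w) = 0)
    (hpos : ∀ z ∈ O, 0 < hermSq ε z → 0 < hermSq ε' (F z))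
    {z e u : ι → ℂ} (hz : z ∈ O) (hzz : herm ε z z = 0) (hze : herm ε z e = 1)
    (hee : herm ε e e = 0) (huz : herm ε u z = 0) (hue : herm ε u e = 0) (huu : herm ε u u = 1) :
    ∃ p : Fin 3 → ι → ℂ, (∀ k, p k ∈ O) ∧ LinearIndependent ℂ fun k => F (p k) := by
  have hzu := herm_eq_zero_symm ε huz
  have heu := herm_eq_zero_symm ε hue
  have hez : herm ε e z = 1 := by rw [← herm_conj, hze, map_one]
  obtain ⟨t, ⟨h1, h2⟩, ht⟩ : ∃ t : ℝ, (z + (t : ℂ) • u ∈ O ∧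
      z + (t : ℂ) ^ 3 • e - (t : ℂ) ^ 2 • u ∈ O) ∧ 0 < t := by
    have hc1 : Continuous fun t : ℝ => z + (t : ℂ) • u := by
      have := Complex.continuous_ofReal
      fun_prop
    have hc2 : Continuous fun t : ℝ => z + (t : ℂ) ^ 3 • e - (t : ℂ) ^ 2 • u := by
      have := Complex.continuous_ofReal
      fun_prop
    have h1 : ∀ᶠ t : ℝ in 𝓝 0, z + (t : ℂ) • u ∈ O :=
      hc1.continuousAt.eventually (hO.mem_nhds (by simpa using hz))
    have h2 : ∀ᶠ t : ℝ in 𝓝 0, z + (t : ℂ) ^ 3 • e - (t : ℂ) ^ 2 • u ∈ O :=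
      hc2.continuousAt.eventually (hO.mem_nhds (by simpa using hz))
    exact (((h1.and h2).filter_mono nhdsWithin_le_nhds).and
      (self_mem_nhdsWithin (s := Set.Ioi (0 : ℝ)))).exists
  set q₁ := z + (t : ℂ) • u with hq₁
  set q₂ := z + (t : ℂ) ^ 3 • e - (t : ℂ) ^ 2 • u with hq₂
  have e1 : herm ε z q₁ = 0 := by
    simp only [hq₁, herm_add_right, herm_smul_right, hzz, hzu]; ring
  have e2 : hermSq ε q₁ = t ^ 2 := by
    rw [hermSq_eq_re, hq₁]
    simp only [herm_add_right, herm_add_left, herm_smul_left, herm_smul_right, hzz, hzu, huz, huu,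
      Complex.conj_ofReal]
    norm_cast
    simp [pow_two]
  have e3 : herm ε q₂ q₁ = 0 := by
    simp only [hq₁, hq₂, herm_add_right, herm_add_left, herm_sub_left, herm_smul_left,
      herm_smul_right, hzz, hzu, huz, huu, hez, heu, Complex.conj_ofReal]
    ring
  have e4 : hermSq ε q₂ = 2 * t ^ 3 + t ^ 4 := by
    rw [hermSq_eq_re, hq₂]
    simp only [herm_add_right, herm_add_left, herm_sub_left, herm_sub_right, herm_smul_left,
      herm_smul_right, hzz, hzu, huz, huu, hez, heu, hze, hue, hee, Complex.conj_ofReal, map_pow]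
    norm_cast
    ring
  have p1 : 0 < hermSq ε' (F q₁) := hpos _ h1 (by rw [e2]; positivity)
  have p2 : 0 < hermSq ε' (F q₂) := hpos _ h2 (by rw [e4]; positivity)
  have k0 : herm ε' (F z) (F z) = 0 := horth _ hz _ hz hzz
  have k1 : herm ε' (F z) (F q₁) = 0 := horth _ hz _ h1 e1
  have k2 : herm ε' (F q₂) (F q₁) = 0 := horth _ h2 _ h1 e3
  refine ⟨![z, q₁, q₂], fun k => by fin_cases k <;> assumption, ?_⟩
  rw [Fintype.linearIndependent_iff]
  intro g hg
  have hg' : g 0 • F z + g 1 • F q₁ + g 2 • F q₂ = 0 := by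
    simpa [Fin.sum_univ_three] using hg
  have g1 : g 1 = 0 := by
    have := congrArg (fun x => herm ε' x (F q₁)) hg'
    simp only [herm_add_left, herm_smul_left, k1, k2, herm_self, herm_zero_left] at this
    have hne : ((hermSq ε' (F q₁) : ℝ) : ℂ) ≠ 0 := by exact_mod_cast p1.ne'
    simpa [hne] using this
  rw [g1, zero_smul, add_zero] at hg'
  have g2 : g 2 = 0 := by
    have h3 : g 2 • F q₂ = (-g 0) • F z := by
      rw [neg_smul]; exact eq_neg_of_add_eq_zero_right hg'
    have h4 := congrArg (hermSq ε') h3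
    rw [hermSq_smul, hermSq_smul, (hermSq_eq_zero_iff ε' (F z)).2 k0, mul_zero] at h4
    simpa [p2.ne'] using h4
  rw [g2, zero_smul, add_zero] at hg'
  have g0 : g 0 = 0 := (smul_eq_zero.1 hg').resolve_right (hF0 _ hz)
  intro k
  fin_cases k
  · exact g0
  · exact g1
  · exact g2

/-- Near a null point outside the radical, a holomorphic map that respects the null cones and the
positive sides of the two forms is projectively linear and preserves orthogonality. -/
theorem exists_linear_near [DecidableEq ι] {ε : ι → ℝ} {ε' : κ → ℝ}
    (hε : ∀ i, ε i = 1 ∨ ε i = -1 ∨ ε i = 0)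
    (hεp : ∀ i, ε i = 1 → ∃ j, i ≠ j ∧ ε j = 1) (hεn : ∀ i, ε i = -1 → ∃ j, i ≠ j ∧ ε j = -1)
    (h2 : 2 ≤ Fintype.card {i // ε i = 1}) (hε' : ∀ i, ε' i ≠ 0)
    (hcard : Fintype.card {i // 0 < ε' i} ≤ Fintype.card {i // ε i = 1})
    {F : (ι → ℂ) → κ → ℂ} {O : Set (ι → ℂ)} (hO : IsOpen O) (hF : DifferentiableOn ℂ F O)
    (i₀ : κ) (hi₀ : ∀ x ∈ O, F x i₀ = 1) (hhom : ∀ x ∈ O, ∀ c : ℂ, c • x ∈ O → F (c • x) = F x)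
    (hnull : ∀ z ∈ O, herm ε z z = 0 → herm ε' (F z) (F z) = 0)
    (hpos : ∀ z ∈ O, 0 < hermSq ε z → 0 < hermSq ε' (F z))
    {z₀ : ι → ℂ} (hz₀ : z₀ ∈ O) (hz : herm ε z₀ z₀ = 0) (hzr : ∃ k, ε k ≠ 0 ∧ z₀ k ≠ 0) :
    ∃ (e : ι → ℂ) (A : (ι → ℂ) →ₗ[ℂ] (κ → ℂ)), ∃ ρ > 0, herm ε z₀ e = 1 ∧ herm ε e e = 0 ∧
      Metric.ball z₀ ρ ⊆ O ∧ A ≠ 0 ∧ (∀ x ∈ Metric.ball z₀ ρ, A x = A x i₀ • F x) ∧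
      ∀ z ∈ Metric.ball z₀ ρ, ∀ w ∈ Metric.ball z₀ ρ, herm ε z w = 0 →
        herm ε' (F z) (F w) = 0 := by
  obtain ⟨v, e, f, u, hfr, huz, hue, huu⟩ := exists_isNullFrame hε hεp hεn hz hzr
  have hev := eventually_orthogonal hO hz₀ hF hfr.ee hfr.ze hnull
  obtain ⟨δ, hδ, hδO⟩ : ∃ δ > 0, Metric.ball z₀ δ ⊆ O ∧ ∀ z ∈ Metric.ball z₀ δ,
      ∀ w ∈ Metric.ball z₀ δ, herm ε z w = 0 → herm ε' (F z) (F w) = 0 := by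
    obtain ⟨δ₁, hδ₁, h1⟩ := Metric.eventually_nhds_iff.1 hev
    obtain ⟨δ₂, hδ₂, h3⟩ := Metric.isOpen_iff.1 hO z₀ hz₀
    refine ⟨min δ₁ δ₂, lt_min hδ₁ hδ₂, (Metric.ball_subset_ball (min_le_right _ _)).trans h3,
      fun z hz w hw => @h1 (z, w) ?_⟩
    rw [Prod.dist_eq]
    exact max_lt (lt_of_lt_of_le hz (min_le_left _ _)) (lt_of_lt_of_le hw (min_le_left _ _))
  have hzB : z₀ ∈ Metric.ball z₀ δ := Metric.mem_ball_self hδ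
  obtain ⟨ρ, hρ, hρB, hmin⟩ := exists_ball_minor3 Metric.isOpen_ball (hF.mono hδO.1) hfr hzB
    fun z v hzz hzv hvv α β hαβ i j k =>
      minor3_eq_zero (not_linearIndependent_of_null hε' h2 hcard Metric.isOpen_ball hδO.2
        (fun x hx => hpos x (hδO.1 hx)) hzz hzv hvv hαβ) i j k
  have hB2 : Metric.ball z₀ (ρ / 2) ⊆ Metric.ball z₀ δ :=
    (Metric.ball_subset_ball (by linarith)).trans hρB
  have hB3 : Metric.ball z₀ (ρ / 2) ⊆ O := hB2.trans hδO.1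
  have horth : ∀ z ∈ Metric.ball z₀ (ρ / 2), ∀ w ∈ Metric.ball z₀ (ρ / 2), herm ε z w = 0 →
      herm ε' (F z) (F w) = 0 := fun z hz w hw => hδO.2 z (hB2 hz) w (hB2 hw)
  obtain ⟨p, hp, hind⟩ := exists_independent_images Metric.isOpen_ball
    (fun x hx h0 => one_ne_zero (α := ℂ) (by rw [← hi₀ x (hB3 hx), h0]; rfl)) horth
    (fun x hx => hpos x (hB3 hx)) (Metric.mem_ball_self (by positivity)) hz hfr.ze hfr.ee huz hue
    huu
  have hcol : ∀ x ∈ Metric.ball z₀ (ρ / 2), ∀ y ∈ Metric.ball z₀ (ρ / 2), ∀ s : ℂ, ‖s‖ ≤ 1 →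
      x + s • (y - x) ∈ Metric.ball z₀ (ρ / 2) → ∀ i j k,
      minor3 (F x) (F y) (F (x + s • (y - x))) i j k = 0 := by
    intro x hx y hy s hs _ i j k
    have hxy : y - x ∈ Metric.ball (0 : ι → ℂ) ρ := by
      rw [mem_ball_zero_iff, ← dist_eq_norm]
      calc dist y x ≤ dist y z₀ + dist x z₀ := dist_triangle_right _ _ _
        _ < ρ := by
          rw [Metric.mem_ball] at hx hy
          linarith
    have := hmin x (Metric.ball_subset_ball (by linarith) hx) (y - x) hxy 1 s (by simp) hs i j k
    simpa using this
  obtain ⟨A, q, hq, hA⟩ := exists_linear_of_collinear Metric.isOpen_ball (convex_ball z₀ (ρ / 2))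
    (hF.mono hB3) i₀ (fun x hx => hi₀ x (hB3 hx)) hcol hp hind
    (fun x hx c hc => hhom x (hB3 hx) c (hB3 hc))
  refine ⟨e, A, ρ / 2, by positivity, hfr.ze, hfr.ee, hB3, ?_, ?_, horth⟩
  · rintro rfl
    obtain ⟨μ, hμ, h⟩ := hA.self_of_nhds
    have h1 := congrFun h i₀
    simp [hi₀ q (hB3 hq)] at h1
    exact hμ h1
  · intro x hx
    funext l
    have hAd : ∀ l, Differentiable ℂ fun x => A x l := fun l =>
      differentiable_pi.1 A.toContinuousLinearMap.differentiable l
    have hd : DifferentiableOn ℂ (fun x => A x l - A x i₀ * F x l) (Metric.ball z₀ (ρ / 2)) :=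
      (hAd l).differentiableOn.sub ((hAd i₀).differentiableOn.mul
        (differentiableOn_pi.1 (hF.mono hB3) l))
    refine sub_eq_zero.1 (eqOn_zero_of_convex Metric.isOpen_ball (convex_ball _ _) hd hq ?_ hx)
    filter_upwards [hA, Metric.isOpen_ball.mem_nhds hq] with y hy hyB
    obtain ⟨μ, hμ, h⟩ := hy
    have h1 := congrFun h i₀
    have h2 := congrFun h l
    simp only [Pi.smul_apply, smul_eq_mul, hi₀ y (hB3 hyB), mul_one] at h1 h2
    rw [← h1, ← h2, sub_self]

/-- A linear map that preserves orthogonality near a null point outside the radical multiplies the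
Hermitian form by a constant. -/
theorem exists_conformal {ε : ι → ℝ} {ε' : κ → ℝ} {A : (ι → ℂ) →ₗ[ℂ] (κ → ℂ)} {z₀ e : ι → ℂ}
    (hz : herm ε z₀ z₀ = 0) (hze : herm ε z₀ e = 1) (hee : herm ε e e = 0) {ρ : ℝ} (hρ : 0 < ρ)
    (horth : ∀ z ∈ Metric.ball z₀ ρ, ∀ w ∈ Metric.ball z₀ ρ, herm ε z w = 0 →
      herm ε' (A z) (A w) = 0) :
    ∃ c : ℝ, ∀ x w, herm ε' (A x) (A w) = c * herm ε x w := by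
  have hez : herm ε e z₀ = 1 := by rw [← herm_conj, hze, map_one]
  -- for `w` near `z₀` the functionals `H'(A ·, A w)` and `H(·, w)` are proportional
  have hloc : ∀ᶠ w in 𝓝 z₀, herm ε e w ≠ 0 ∧
      ∀ x, herm ε' (A x) (A w) = herm ε' (A e) (A w) / herm ε e w * herm ε x w := by
    have hc1 : Continuous fun w => herm ε e w := Continuous.herm ε continuous_const continuous_id
    have hc2 : Continuous fun w => herm ε z₀ w := Continuous.herm ε continuous_const continuous_id
    have hne : ∀ᶠ w in 𝓝 z₀, herm ε e w ≠ 0 := hc1.continuousAt.eventually_ne (by simp [hez])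
    have hy : ContinuousAt (fun w => z₀ - (herm ε z₀ w / herm ε e w) • e) z₀ :=
      continuousAt_const.sub ((hc2.continuousAt.div hc1.continuousAt (by simp [hez])).smul
        continuousAt_const)
    have hyB : ∀ᶠ w in 𝓝 z₀, z₀ - (herm ε z₀ w / herm ε e w) • e ∈ Metric.ball z₀ ρ :=
      hy.eventually (Metric.isOpen_ball.mem_nhds (by simpa [hz] using hρ))
    filter_upwards [hne, hyB, Metric.ball_mem_nhds z₀ hρ] with w hw hyw hwB
    refine ⟨hw, ?_⟩
    set y := z₀ - (herm ε z₀ w / herm ε e w) • e with hydef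
    have hyw0 : herm ε y w = 0 := by
      rw [hydef, herm_sub_left, herm_smul_left, div_mul_cancel₀ _ hw, sub_self]
    have hperp : ∀ h, herm ε h w = 0 → herm ε' (A h) (A w) = 0 := by
      intro h hh
      obtain ⟨t, htB, ht0⟩ : ∃ t : ℂ, y + t • h ∈ Metric.ball z₀ ρ ∧ t ≠ 0 := by
        have h1 : Continuous fun t : ℂ => y + t • h := by fun_prop
        have h2 : ∀ᶠ t : ℂ in 𝓝 0, y + t • h ∈ Metric.ball z₀ ρ :=
          h1.continuousAt.eventually (Metric.isOpen_ball.mem_nhds (by simpa using hyw))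
        exact ((h2.filter_mono nhdsWithin_le_nhds).and
            (self_mem_nhdsWithin (s := ({0}ᶜ : Set ℂ)))).exists
      have h1 := horth _ htB w hwB (by rw [herm_add_left, herm_smul_left, hyw0, hh]; ring)
      rw [map_add, map_smul, herm_add_left, herm_smul_left, horth _ hyw w hwB hyw0, zero_add] at h1
      exact (mul_eq_zero.1 h1).resolve_left ht0
    intro x
    have h1 := hperp (x - (herm ε x w / herm ε e w) • e) (by
      rw [herm_sub_left, herm_smul_left, div_mul_cancel₀ _ hw, sub_self])
    rw [map_sub, map_smul, herm_sub_left, herm_smul_left, sub_eq_zero] at h1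
    rw [h1]
    ring
  -- a non-null point `z₁` near `z₀`
  obtain ⟨t, ht, ht0⟩ : ∃ t : ℝ, (∀ᶠ w in 𝓝 (z₀ + (t : ℂ) • e), herm ε e w ≠ 0 ∧
      ∀ x, herm ε' (A x) (A w) = herm ε' (A e) (A w) / herm ε e w * herm ε x w) ∧ 0 < t := by
    have h1 : Continuous fun t : ℝ => z₀ + (t : ℂ) • e := by
      have := Complex.continuous_ofReal
      fun_prop
    have h2 : Tendsto (fun t : ℝ => z₀ + (t : ℂ) • e) (𝓝 0) (𝓝 z₀) := by
      simpa using h1.tendsto 0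
    exact (((h2.eventually hloc.eventually_nhds).filter_mono nhdsWithin_le_nhds).and
            (self_mem_nhdsWithin (s := Set.Ioi (0 : ℝ)))).exists
  set z₁ := z₀ + (t : ℂ) • e with hz₁
  have hz₁z₁ : herm ε z₁ z₁ = ((2 * t : ℝ) : ℂ) := by
    simp only [hz₁, herm_add_left, herm_add_right, herm_smul_left, herm_smul_right, hz, hze, hez,
      hee, Complex.conj_ofReal]
    push_cast
    ring
  have hne1 : ((2 * t : ℝ) : ℂ) ≠ 0 := by
    have : (2 * t : ℝ) ≠ 0 := by positivity
    exact_mod_cast this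
  set c : ℝ := hermSq ε' (A z₁) / (2 * t) with hc
  have hcz : ∀ x, herm ε' (A x) (A z₁) = c * herm ε x z₁ := by
    intro x
    have h1 := ht.self_of_nhds.2
    have h3 := h1 z₁
    rw [herm_self, hz₁z₁] at h3
    have h2 : herm ε' (A e) (A z₁) / herm ε e z₁ = c := by
      rw [hc, Complex.ofReal_div, h3, mul_div_cancel_right₀ _ hne1]
    rw [h1 x, h2]
  have hnear : ∀ᶠ w in 𝓝 z₁, ∀ x, herm ε' (A x) (A w) = c * herm ε x w := by
    have hc1 : Continuous fun w => herm ε z₁ w := Continuous.herm ε continuous_const continuous_id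
    filter_upwards [ht, hc1.continuousAt.eventually_ne (by rw [hz₁z₁]; exact hne1)] with w hw hw1 x
    have h1 := hw.2 z₁
    have h2 : herm ε' (A z₁) (A w) = c * herm ε z₁ w := by
      rw [← herm_conj, hcz, map_mul, Complex.conj_ofReal, herm_conj]
    rw [h2] at h1
    rw [hw.2 x, ← mul_right_cancel₀ hw1 h1]
  refine ⟨c, fun x w => ?_⟩
  obtain ⟨s, hs, hs0⟩ : ∃ s : ℂ, (∀ x, herm ε' (A x) (A (z₁ + s • w)) = c * herm ε x (z₁ + s • w)) ∧
      s ≠ 0 := by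
    have h1 : Continuous fun s : ℂ => z₁ + s • w := by fun_prop
    have h2 : Tendsto (fun s : ℂ => z₁ + s • w) (𝓝 0) (𝓝 z₁) := by simpa using h1.tendsto 0
    exact (((h2.eventually hnear)).filter_mono nhdsWithin_le_nhds |>.and
            (self_mem_nhdsWithin (s := ({0}ᶜ : Set ℂ)))).exists
  have h1 := hs x
  rw [map_add, map_smul, herm_add_right, herm_add_right, herm_smul_right, herm_smul_right, hcz] at h1
  have h2 : conj s ≠ 0 := by simpa using hs0
  refine mul_left_cancel₀ h2 ?_
  linear_combination h1

/-- A holomorphic map that respects the null cones and the positive sides of the two forms is given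
near a null point by a linear isometry. -/
theorem exists_isometry_near [DecidableEq ι] {ε : ι → ℝ} {ε' : κ → ℝ}
    (hε : ∀ i, ε i = 1 ∨ ε i = -1 ∨ ε i = 0)
    (hεp : ∀ i, ε i = 1 → ∃ j, i ≠ j ∧ ε j = 1) (hεn : ∀ i, ε i = -1 → ∃ j, i ≠ j ∧ ε j = -1)
    (h2 : 2 ≤ Fintype.card {i // ε i = 1}) (hε' : ∀ i, ε' i ≠ 0)
    (hcard : Fintype.card {i // 0 < ε' i} ≤ Fintype.card {i // ε i = 1})
    {F : (ι → ℂ) → κ → ℂ} {O : Set (ι → ℂ)} (hO : IsOpen O) (hF : DifferentiableOn ℂ F O)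
    (i₀ : κ) (hi₀ : ∀ x ∈ O, F x i₀ = 1) (hhom : ∀ x ∈ O, ∀ c : ℂ, c • x ∈ O → F (c • x) = F x)
    (hnull : ∀ z ∈ O, herm ε z z = 0 → herm ε' (F z) (F z) = 0)
    (hpos : ∀ z ∈ O, 0 < hermSq ε z → 0 < hermSq ε' (F z))
    {z₀ : ι → ℂ} (hz₀ : z₀ ∈ O) (hz : herm ε z₀ z₀ = 0) (hzr : ∃ k, ε k ≠ 0 ∧ z₀ k ≠ 0) :
    ∃ A : (ι → ℂ) →ₗ[ℂ] (κ → ℂ), (∀ x w, herm ε' (A x) (A w) = herm ε x w) ∧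
      ∀ᶠ x in 𝓝 z₀, A x = A x i₀ • F x := by
  obtain ⟨e, A, ρ, hρ, hze, hee, hρO, hA0, hAF, horth⟩ :=
    exists_linear_near hε hεp hεn h2 hε' hcard hO hF i₀ hi₀ hhom hnull hpos hz₀ hz hzr
  obtain ⟨c, hc⟩ := exists_conformal (A := A) (ε' := ε') hz hze hee hρ (fun z hzB w hwB hzw => by
    rw [hAF z hzB, hAF w hwB, herm_smul_left, herm_smul_right, horth z hzB w hwB hzw]; ring)
  have hez : herm ε e z₀ = 1 := by rw [← herm_conj, hze, map_one]
  -- a positive point in the ball that is not in the kernel of `A`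
  obtain ⟨x, hxB, hxpos, hAx⟩ : ∃ x ∈ Metric.ball z₀ ρ, 0 < hermSq ε x ∧ A x ≠ 0 := by
    have hopen : IsOpen (Metric.ball z₀ ρ ∩ {x | 0 < hermSq ε x}) :=
      Metric.isOpen_ball.inter (isOpen_lt continuous_const (continuous_hermSq ε))
    obtain ⟨t, htB, ht0⟩ : ∃ t : ℝ, z₀ + (t : ℂ) • e ∈ Metric.ball z₀ ρ ∧ 0 < t := by
      have h1 : Continuous fun t : ℝ => z₀ + (t : ℂ) • e := by
        have := Complex.continuous_ofReal
        fun_prop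
      have h2 : ∀ᶠ t : ℝ in 𝓝 0, z₀ + (t : ℂ) • e ∈ Metric.ball z₀ ρ :=
        h1.continuousAt.eventually (Metric.isOpen_ball.mem_nhds (by simpa using hρ))
      exact ((h2.filter_mono nhdsWithin_le_nhds).and
            (self_mem_nhdsWithin (s := Set.Ioi (0 : ℝ)))).exists
    have hpos1 : 0 < hermSq ε (z₀ + (t : ℂ) • e) := by
      rw [hermSq_eq_re]
      simp only [herm_add_left, herm_add_right, herm_smul_left, herm_smul_right, hz, hze, hez,
        hee, Complex.conj_ofReal]
      norm_num
      linarith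
    obtain ⟨y, hy⟩ : ∃ y, A y ≠ 0 := by
      by_contra h
      push Not at h
      exact hA0 (LinearMap.ext h)
    by_cases hA1 : A (z₀ + (t : ℂ) • e) = 0
    · obtain ⟨s, hs, hs0⟩ : ∃ s : ℂ, (z₀ + (t : ℂ) • e) + s • y ∈
          Metric.ball z₀ ρ ∩ {x | 0 < hermSq ε x} ∧ s ≠ 0 := by
        have h1 : Continuous fun s : ℂ => (z₀ + (t : ℂ) • e) + s • y := by fun_prop
        have h2 : ∀ᶠ s : ℂ in 𝓝 0, (z₀ + (t : ℂ) • e) + s • y ∈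
            Metric.ball z₀ ρ ∩ {x | 0 < hermSq ε x} :=
          h1.continuousAt.eventually (hopen.mem_nhds (by
            simp only [zero_smul, add_zero]; exact ⟨htB, hpos1⟩))
        exact ((h2.filter_mono nhdsWithin_le_nhds).and
              (self_mem_nhdsWithin (s := ({0}ᶜ : Set ℂ)))).exists
      refine ⟨_, hs.1, hs.2, ?_⟩
      rw [map_add, hA1, zero_add, map_smul]
      exact smul_ne_zero hs0 hy
    · exact ⟨_, htB, hpos1, hA1⟩
  have hcpos : 0 < c := by
    have h1 : hermSq ε' (A x) = c * hermSq ε x := by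
      have := hc x x
      rw [herm_self, herm_self] at this
      exact_mod_cast this
    rw [hAF x hxB, hermSq_smul] at h1
    have h3 : A x i₀ ≠ 0 := by
      intro h0
      apply hAx
      rw [hAF x hxB, h0, zero_smul]
    have h4 : 0 < ‖A x i₀‖ ^ 2 * hermSq ε' (F x) :=
      mul_pos (by positivity) (hpos x (hρO hxB) hxpos)
    rw [h1] at h4
    exact (pos_iff_pos_of_mul_pos h4).2 hxpos
  have hsq : ((Real.sqrt c : ℝ) : ℂ) * ((Real.sqrt c : ℝ) : ℂ) = (c : ℂ) := by
    rw [← Complex.ofReal_mul, Real.mul_self_sqrt hcpos.le]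
  have hsne : ((Real.sqrt c : ℝ) : ℂ) ≠ 0 := by
    exact_mod_cast (Real.sqrt_pos.2 hcpos).ne'
  refine ⟨((Real.sqrt c : ℝ) : ℂ)⁻¹ • A, fun x w => ?_, ?_⟩
  · rw [LinearMap.smul_apply, LinearMap.smul_apply, herm_smul_left, herm_smul_right, hc, map_inv₀,
      Complex.conj_ofReal, ← hsq]
    field_simp
  · filter_upwards [Metric.ball_mem_nhds z₀ hρ] with x hx
    rw [LinearMap.smul_apply, Pi.smul_apply, smul_assoc, ← hAF x hx]

end Local

/-! ### Extension of isometries -/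

section Witt

/-- The signs of the form defining the generalized ball: `1` for `i ≤ r`, `-1` for
`r < i ≤ r + s` and `0` afterwards. -/
noncomputable def ballSign (n r s : ℕ) (i : Fin (n + 1)) : ℝ :=
  if i.val ≤ r then 1 else if i.val ≤ r + s then -1 else 0

variable {n m r s : ℕ}

theorem ballSign_cases (i : Fin (n + 1)) :
    ballSign n r s i = 1 ∨ ballSign n r s i = -1 ∨ ballSign n r s i = 0 := by
  unfold ballSign
  split_ifs <;> simp

theorem ballSign_eq_one_iff (i : Fin (n + 1)) : ballSign n r s i = 1 ↔ i.val ≤ r := by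
  unfold ballSign
  split_ifs with h1 h2 <;> norm_num [h1]

theorem ballSign_pos_iff (i : Fin (n + 1)) : 0 < ballSign n r s i ↔ i.val ≤ r := by
  unfold ballSign
  split_ifs with h1 h2 <;> norm_num [h1]

theorem ballSign_eq_zero_iff (i : Fin (n + 1)) : ballSign n r s i = 0 ↔ r + s < i.val := by
  unfold ballSign
  split_ifs with h1 h2 <;> norm_num
  · omega
  · omega
  · omega

theorem ballSign_eq_neg_one_iff (i : Fin (n + 1)) :
    ballSign n r s i = -1 ↔ r < i.val ∧ i.val ≤ r + s := by
  unfold ballSign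
  split_ifs with h1 h2 <;> norm_num <;> omega

theorem card_val_le (h : r ≤ n) : Fintype.card {i : Fin (n + 1) // i.val ≤ r} = r + 1 := by
  rw [← Fintype.card_fin (r + 1)]
  exact Fintype.card_congr
    { toFun := fun i => ⟨i.1.1, Nat.lt_succ_of_le i.2⟩
      invFun := fun j => ⟨⟨j.1, by omega⟩, by have := j.2; simp only; omega⟩
      left_inv := fun _ => rfl
      right_inv := fun _ => rfl }

theorem card_ballSign_pos (h : r ≤ n) : Fintype.card {i // 0 < ballSign n r s i} = r + 1 := by
  rw [← card_val_le h]
  exact Fintype.card_congr (Equiv.subtypeEquivRight fun i => ballSign_pos_iff i)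

theorem card_ballSign_eq_one (h : r ≤ n) :
    Fintype.card {i // ballSign n r s i = 1} = r + 1 := by
  rw [← card_val_le h]
  exact Fintype.card_congr (Equiv.subtypeEquivRight fun i => ballSign_eq_one_iff i)

theorem herm_single_single {ι : Type*} [Fintype ι] [DecidableEq ι] (ε : ι → ℝ) (i j : ι) :
    herm ε (Pi.single i 1) (Pi.single j 1) = if i = j then (ε i : ℂ) else 0 := by
  rw [herm, Finset.sum_eq_single i (fun k _ hk => by simp [hk]) (by simp)]
  by_cases h : i = j
  · subst h; simp
  · simp [h]

/-- A vector orthogonal to a maximal family of orthonormal positive vectors is negative. -/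
theorem hermSq_neg_of_orthogonal {ε' : Fin (m + 1) → ℝ} (hε' : ∀ i, ε' i ≠ 0)
    {β : Type*} [Fintype β] (hβ : Fintype.card {i // 0 < ε' i} ≤ Fintype.card β)
    {b : β → Fin (m + 1) → ℂ} (hbb : ∀ i j, i ≠ j → herm ε' (b i) (b j) = 0)
    (hb : ∀ i, 0 < hermSq ε' (b i)) {y : Fin (m + 1) → ℂ} (hy : y ≠ 0)
    (hyb : ∀ i, herm ε' y (b i) = 0) : hermSq ε' y < 0 := by
  by_contra hcon
  rcases (not_lt.1 hcon).eq_or_lt with h | h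
  · have := card_add_card_le_of_null_of_pos hε' (u := fun _ : Unit => y) (v := b)
      (linearIndependent_unique_iff.2 hy)
      (fun _ _ => (hermSq_eq_zero_iff ε' y).1 h.symm) (fun _ i => hyb i) hbb hb
    rw [Fintype.card_unit] at this
    omega
  · have := card_add_card_le_of_null_of_pos hε' (u := fun e : Empty => e.elim)
      (v := fun o : Option β => o.elim y b) linearIndependent_empty_type (fun a => a.elim)
      (fun a => a.elim) ?_ ?_
    · rw [Fintype.card_option, Fintype.card_empty] at this
      omega
    · rintro (_ | i) (_ | j) hij
      · exact absurd rfl hij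
      · exact hyb j
      · exact herm_eq_zero_symm ε' (hyb i)
      · exact hbb i j fun h => hij (by rw [h])
    · rintro (_ | i)
      · exact h
      · exact hb i

/-- An orthonormal family containing all positive vectors of an orthonormal basis extends to an
orthonormal basis. -/
theorem exists_orthonormal_extension (hr : r ≤ m) {k : ℕ} (hrk : r < k) (hk : k ≤ m + 1)
    (b : Fin (m + 1) → Fin (m + 1) → ℂ)
    (hb : ∀ i j : Fin (m + 1), i.val < k → j.val < k → herm (ballSign m r (m - r)) (b i) (b j)
      = if i = j then (ballSign m r (m - r) i : ℂ) else 0) :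
    ∃ b' : Fin (m + 1) → Fin (m + 1) → ℂ, (∀ i : Fin (m + 1), i.val < k → b' i = b i) ∧
      ∀ i j, herm (ballSign m r (m - r)) (b' i) (b' j)
        = if i = j then (ballSign m r (m - r) i : ℂ) else 0 := by
  set ε' := ballSign m r (m - r) with hε'
  have hne : ∀ i, ε' i ≠ 0 := by
    intro i h
    have := (ballSign_eq_zero_iff i).1 h
    have := i.2
    omega
  induction hd : m + 1 - k generalizing k b with
  | zero =>
    have hkm : k = m + 1 := by omega
    exact ⟨b, fun _ _ => rfl, fun i j => hb i j (by omega) (by omega)⟩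
  | succ d ih =>
    have hkm : k < m + 1 := by omega
    -- a vector orthogonal to the first `k` vectors
    obtain ⟨y, hy0, hy⟩ : ∃ y : Fin (m + 1) → ℂ, y ≠ 0 ∧
        ∀ i : Fin (m + 1), i.val < k → herm ε' y (b i) = 0 := by
      let T : (Fin (m + 1) → ℂ) →ₗ[ℂ] (Fin k → ℂ) :=
        LinearMap.pi fun i => hermLeft ε' (b (Fin.castLE hk i))
      have hT : LinearMap.ker T ≠ ⊥ := LinearMap.ker_ne_bot_of_finrank_lt (by simpa using hkm)
      obtain ⟨y, hyT, hy0⟩ := (Submodule.ne_bot_iff _).1 hT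
      refine ⟨y, hy0, fun i hi => ?_⟩
      exact congrFun (LinearMap.mem_ker.1 hyT) ⟨i.1, hi⟩
    have hneg : hermSq ε' y < 0 := by
      refine hermSq_neg_of_orthogonal hne (β := {i // 0 < ε' i}) le_rfl (b := fun i => b i)
        (fun i j hij => ?_) (fun i => ?_) hy0 (fun i => ?_)
      · have hi := (ballSign_pos_iff i.1).1 i.2
        have hj := (ballSign_pos_iff j.1).1 j.2
        rw [hb _ _ (by omega) (by omega), if_neg fun h => hij (Subtype.ext h)]
      · have hi := (ballSign_pos_iff i.1).1 i.2
        rw [hermSq_eq_re, hb _ _ (by omega) (by omega), if_pos rfl, Complex.ofReal_re]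
        exact i.2
      · have hi := (ballSign_pos_iff i.1).1 i.2
        exact hy i (by omega)
    set c : ℝ := Real.sqrt (-hermSq ε' y) with hc
    have hcpos : 0 < c := Real.sqrt_pos.2 (by linarith)
    have hcc : c * c = -hermSq ε' y := Real.mul_self_sqrt (by linarith)
    set y' : Fin (m + 1) → ℂ := ((c : ℂ)⁻¹) • y with hy'
    have hyy : herm ε' y' y' = -1 := by
      have h1 : (c : ℂ) ≠ 0 := by exact_mod_cast hcpos.ne'
      have h2 : ((hermSq ε' y : ℝ) : ℂ) = -((c : ℂ) * c) := by
        rw [← Complex.ofReal_mul, hcc]; push_cast; ring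
      rw [hy', herm_smul_left, herm_smul_right, herm_self, h2, map_inv₀, Complex.conj_ofReal]
      field_simp
    have hyb : ∀ i : Fin (m + 1), i.val < k → herm ε' y' (b i) = 0 := by
      intro i hi
      rw [hy', herm_smul_left, hy i hi, mul_zero]
    set b₁ := Function.update b ⟨k, hkm⟩ y' with hb₁
    have hb₁k : b₁ ⟨k, hkm⟩ = y' := Function.update_self _ _ _
    have hb₁i : ∀ i : Fin (m + 1), i.val < k → b₁ i = b i := by
      intro i hi
      refine Function.update_of_ne ?_ _ _
      rintro rfl
      exact lt_irrefl _ hi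
    have hkneg : ε' ⟨k, hkm⟩ = -1 := (ballSign_eq_neg_one_iff _).2 ⟨hrk, by simp only; omega⟩
    obtain ⟨b', h1, h2⟩ := ih (k := k + 1) (by omega) (by omega) b₁ (by
      intro i j hi hj
      rcases Nat.lt_succ_iff_lt_or_eq.1 hi with hi | hi <;>
        rcases Nat.lt_succ_iff_lt_or_eq.1 hj with hj | hj
      · rw [hb₁i i hi, hb₁i j hj, hb i j hi hj]
      · obtain rfl : j = ⟨k, hkm⟩ := Fin.ext hj
        rw [hb₁i i hi, hb₁k, herm_eq_zero_symm ε' (hyb i hi), if_neg]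
        rintro rfl
        exact lt_irrefl _ hi
      · obtain rfl : i = ⟨k, hkm⟩ := Fin.ext hi
        rw [hb₁i j hj, hb₁k, hyb j hj, if_neg]
        rintro rfl
        exact lt_irrefl _ hj
      · obtain rfl : i = ⟨k, hkm⟩ := Fin.ext hi
        obtain rfl : j = ⟨k, hkm⟩ := Fin.ext hj
        rw [hb₁k, hyy, if_pos rfl, hkneg]
        simp) (by omega)
    exact ⟨b', fun i hi => by rw [h1 i (by omega), hb₁i i hi], h2⟩

/-- A linear isometry from the degenerate form of signature `(r + 1, s)` to a nondegenerate form of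
index `r' + 1 ≤ r + 1` is, up to an isometry of the target, the truncation of coordinates. -/
theorem exists_isometry_truncate {r' : ℕ} (hrs : r + s ≤ n) (hm : r' ≤ m) (hr'r : r' ≤ r)
    (A : (Fin (n + 1) → ℂ) →ₗ[ℂ] (Fin (m + 1) → ℂ))
    (hA : ∀ x w, herm (ballSign m r' (m - r')) (A x) (A w) = herm (ballSign n r s) x w) :
    r = r' ∧ r + s ≤ m ∧ ∃ B : (Fin (m + 1) → ℂ) ≃ₗ[ℂ] (Fin (m + 1) → ℂ),
      (∀ x, hermSq (ballSign m r' (m - r')) (B x) = hermSq (ballSign m r' (m - r')) x) ∧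
      ∀ z, A z = B (truncate m (r + s) z) := by
  set ε := ballSign n r s with hε
  set ε' := ballSign m r' (m - r') with hε'
  have hne : ∀ i, ε' i ≠ 0 := by
    intro i h
    have := (ballSign_eq_zero_iff i).1 h
    have := i.2
    omega
  set a : Fin (n + 1) → Fin (m + 1) → ℂ := fun k => A (Pi.single k 1) with ha
  have haa : ∀ i j, herm ε' (a i) (a j) = if i = j then (ε i : ℂ) else 0 := fun i j => by
    rw [ha, hA, herm_single_single]
  have hcard : Fintype.card {i // 0 < ε' i} = r' + 1 := card_ballSign_pos hm
  have hcard2 : Fintype.card {i // 0 < ε i} = r + 1 := card_ballSign_pos (by omega)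
  have hapos : ∀ i : {i // 0 < ε i}, 0 < hermSq ε' (a i) := by
    intro i
    rw [hermSq_eq_re, haa, if_pos rfl, Complex.ofReal_re]
    exact i.2
  have haorth : ∀ i j : {i // 0 < ε i}, i ≠ j → herm ε' (a i) (a j) = 0 := fun i j hij => by
    rw [haa, if_neg fun h => hij (Subtype.ext h)]
  have hrr : r = r' := by
    have := card_add_card_le_of_null_of_pos hne (u := fun e : Empty => e.elim)
      (v := fun i : {i // 0 < ε i} => a i) linearIndependent_empty_type (fun a => a.elim)
      (fun a => a.elim) haorth hapos
    rw [hcard, hcard2, Fintype.card_empty] at this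
    omega
  subst hrr
  have hrad : ∀ k : Fin (n + 1), r + s < k.val → a k = 0 := by
    intro k hk
    by_contra h0
    have h1 := hermSq_neg_of_orthogonal hne (b := fun i : {i // 0 < ε i} => a i)
      (by rw [hcard, hcard2]) haorth hapos h0 (fun i => by
        rw [haa, if_neg]
        rintro rfl
        have := (ballSign_pos_iff i.1).1 i.2
        omega)
    have hk0 : ε k = 0 := (ballSign_eq_zero_iff k).2 hk
    rw [hermSq_eq_re, haa, if_pos rfl, hk0] at h1
    simp at h1
  have hsm : r + s ≤ m := by
    have hli : LinearIndependent ℂ fun k : Fin (r + s + 1) => a (Fin.castLE (by omega) k) := by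
      rw [Fintype.linearIndependent_iff]
      intro g hg k
      have h1 := congrArg (fun x => herm ε' x (a (Fin.castLE (by omega) k))) hg
      simp only [herm_sum_left, herm_smul_left, haa, herm_zero_left] at h1
      rw [Finset.sum_eq_single k (fun j _ hj => by
        rw [if_neg fun h => hj (Fin.castLE_injective _ h), mul_zero]) (by simp), if_pos rfl] at h1
      refine (mul_eq_zero.1 h1).resolve_right ?_
      intro h
      have := (ballSign_eq_zero_iff _).1 (Complex.ofReal_eq_zero.1 h)
      rw [Fin.val_castLE] at this
      have := k.2
      omega
    have := hli.fintype_card_le_finrank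
    simp at this
    omega
  refine ⟨rfl, hsm, ?_⟩
  obtain ⟨b, hba, hbb⟩ := exists_orthonormal_extension (m := m) hm (k := r + s + 1) (by omega)
    (by omega) (fun i => if h : i.val < n + 1 then a ⟨i.val, h⟩ else 0) (by
      intro i j hi hj
      rw [dif_pos (by omega), dif_pos (by omega), haa]
      by_cases hij : i = j
      · subst hij
        rw [if_pos rfl, if_pos rfl]
        have : ε ⟨i.val, by omega⟩ = ballSign m r (m - r) i := by
          simp only [hε, ballSign]
          split_ifs <;> first | rfl | omega
        rw [this]
      · rw [if_neg hij, if_neg]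
        intro h
        exact hij (Fin.ext (by simpa using h)))
  let B : (Fin (m + 1) → ℂ) →ₗ[ℂ] (Fin (m + 1) → ℂ) := Fintype.linearCombination ℂ b
  have hB : ∀ x, B x = ∑ i, x i • b i := fun x => Fintype.linearCombination_apply ℂ b x
  have hBx : ∀ x j, herm ε' (B x) (b j) = x j * (ε' j : ℂ) := by
    intro x j
    rw [hB, herm_sum_left, Finset.sum_eq_single j (fun i _ hi => by
      rw [herm_smul_left, hbb, if_neg hi, mul_zero]) (by simp), herm_smul_left, hbb, if_pos rfl]
  have hBB : ∀ x w, herm ε' (B x) (B w) = herm ε' x w := by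
    intro x w
    conv_lhs => rw [hB w, herm_sum_right]
    simp only [herm_smul_right, hBx]
    exact Finset.sum_congr rfl fun i _ => by ring
  have hBinj : Function.Injective B := by
    refine (injective_iff_map_eq_zero B).2 fun x hx => ?_
    funext j
    have := hBx x j
    rw [hx, herm_zero_left] at this
    exact (mul_eq_zero.1 this.symm).resolve_right (Complex.ofReal_ne_zero.2 (hne j))
  refine ⟨LinearEquiv.ofInjectiveEndo B hBinj, fun x => ?_, fun z => ?_⟩
  · rw [LinearEquiv.coe_ofInjectiveEndo, hermSq_eq_re, hBB, ← hermSq_eq_re]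
  · rw [LinearEquiv.coe_ofInjectiveEndo, hB]
    have h1 : A z = ∑ k, z k • a k := by
      conv_lhs => rw [pi_eq_sum_univ' z, map_sum]
      refine Finset.sum_congr rfl fun k _ => ?_
      rw [map_smul, ha]
    have h2 : ∀ k : Fin (n + 1), ¬ k.val ≤ r + s → z k • a k = 0 := fun k hk => by
      rw [hrad k (by omega), smul_zero]
    have h3 : ∀ j : Fin (m + 1), ¬ j.val ≤ r + s → truncate m (r + s) z j • b j = 0 := fun j hj => by
      simp [truncate, hj]
    rw [h1, ← Finset.sum_filter_of_ne (p := fun k : Fin (n + 1) => k.val ≤ r + s)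
      (fun k _ hk => by by_contra h; exact hk (h2 k h)),
      ← Finset.sum_filter_of_ne (p := fun k : Fin (m + 1) => k.val ≤ r + s)
      (fun k _ hk => by by_contra h; exact hk (h3 k h))]
    refine Finset.sum_bij' (fun k hk => ⟨k.val, by simp at hk; omega⟩)
      (fun k hk => ⟨k.val, by simp at hk; omega⟩) ?_ ?_ ?_ ?_ ?_
    · intro k hk; simpa using hk
    · intro k hk; simpa using hk
    · intro k _; rfl
    · intro k _; rfl
    · intro k hk
      have hk' : k.val ≤ r + s := by simpa using hk
      have hkn : k.val < n + 1 := k.2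
      rw [hba _ (by simp only; omega)]
      simp only [truncate, dif_pos hkn, dif_pos (And.intro hk' hkn)]

end Witt

/-! ### Homogeneous coordinates, balls and their boundaries -/

section Projective

variable {n m r s : ℕ}

theorem hermSq_ballSign (z : Fin (n + 1) → ℂ) : hermSq (ballSign n r s) z =
    ∑ i : Fin (n + 1) with i.val ≤ r, ‖z i‖ ^ 2
      - ∑ j : Fin (n + 1) with r < j.val ∧ j.val ≤ r + s, ‖z j‖ ^ 2 := by
  rw [hermSq, Finset.sum_filter, Finset.sum_filter, ← Finset.sum_sub_distrib]
  refine Finset.sum_congr rfl fun i _ => ?_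
  unfold ballSign
  by_cases h1 : i.val ≤ r
  · simp [h1, not_lt.2 h1]
  · by_cases h2 : i.val ≤ r + s <;> simp [h1, h2, not_le.1 h1]

theorem mk_mem_genBall_iff_hermSq (z : Fin (n + 1) → ℂ) (hz : z ≠ 0) :
    CP.mk z hz ∈ genBall n r s ↔ 0 < hermSq (ballSign n r s) z := by
  rw [mk_mem_genBall_iff, hermSq_ballSign, sub_pos]

/-- The set of homogeneous coordinates of the points of `U`: the cone over `U` in `ℂⁿ⁺¹`, without
its vertex. -/
def coneOver (U : Set (CP n)) : Set (Fin (n + 1) → ℂ) := {z | ∃ hz : z ≠ 0, CP.mk z hz ∈ U}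

theorem isOpen_coneOver {U : Set (CP n)} (hU : IsOpen U) : IsOpen (coneOver U) := by
  have h1 : IsOpen ((fun z : {z : Fin (n + 1) → ℂ // z ≠ 0} => CP.mk z.1 z.2) ⁻¹' U) :=
    hU.preimage CP.isQuotientMap_mk.continuous
  have h2 := (isOpen_ne (x := (0 : Fin (n + 1) → ℂ))).isOpenMap_subtype_val _ h1
  convert! h2 using 1
  ext z
  constructor
  · rintro ⟨hz, h⟩
    exact ⟨⟨z, hz⟩, h, rfl⟩
  · rintro ⟨⟨w, hw⟩, h, rfl⟩
    exact ⟨hw, h⟩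

theorem tendsto_mk {X : Type*} {l : Filter X} {g : X → Fin (n + 1) → ℂ} {z : Fin (n + 1) → ℂ}
    (hz : z ≠ 0) (hg : ∀ x, g x ≠ 0) (h : Tendsto g l (𝓝 z)) :
    Tendsto (fun x => CP.mk (g x) (hg x)) l (𝓝 (CP.mk z hz)) := by
  have h1 : Tendsto (fun x => (⟨g x, hg x⟩ : {z : Fin (n + 1) → ℂ // z ≠ 0})) l (𝓝 ⟨z, hz⟩) :=
    tendsto_subtype_rng.2 h
  exact (CP.isQuotientMap_mk.continuous.tendsto ⟨z, hz⟩).comp h1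

/-- A property of points near `z` in `ℂⁿ⁺¹` that only depends on the line holds near `[z]`. -/
theorem eventually_nhds_mk {z : Fin (n + 1) → ℂ} (hz : z ≠ 0) {Q : CP n → Prop}
    (h : ∀ᶠ x in 𝓝 z, ∀ hx : x ≠ 0, Q (CP.mk x hx)) : ∀ᶠ q in 𝓝 (CP.mk z hz), Q q := by
  obtain ⟨k, hk⟩ := Function.ne_iff.1 hz
  have hk : z k ≠ 0 := hk
  have hsrc : CP.mk z hz ∈ (CP.chart k).source := (CP.rep_mk_ne_zero_iff k z hz).2 hk
  let σ : CP n → Fin (n + 1) → ℂ := fun q =>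
    z k • k.insertNth (α := fun _ => ℂ) (1 : ℂ) (CP.coord k q)
  have hσ0 : σ (CP.mk z hz) = z := by
    funext l
    simp only [σ, CP.coord_mk]
    rcases Fin.eq_self_or_eq_succAbove k l with rfl | ⟨j, rfl⟩
    · simp
    · simp only [Pi.smul_apply, Fin.insertNth_apply_succAbove, smul_eq_mul]
      field_simp
  have hσc : ContinuousAt σ (CP.mk z hz) := by
    have h1 : ContinuousAt (CP.coord k) (CP.mk z hz) := (CP.chart k).continuousAt hsrc
    have h2 : Continuous fun w : Fin n → ℂ => z k • k.insertNth (α := fun _ => ℂ) (1 : ℂ) w :=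
      Continuous.const_smul (continuous_const.finInsertNth k continuous_id) (z k)
    exact ContinuousAt.comp (f := CP.coord k)
      (g := fun w : Fin n → ℂ => z k • k.insertNth (α := fun _ => ℂ) (1 : ℂ) w)
      h2.continuousAt h1
  have h1 : ∀ᶠ q in 𝓝 (CP.mk z hz), ∀ hx : σ q ≠ 0, Q (CP.mk (σ q) hx) := by
    refine Tendsto.eventually (f := σ) ?_ h
    have := hσc.tendsto
    rwa [hσ0] at this
  filter_upwards [h1, (CP.chart k).open_source.mem_nhds hsrc] with q hq hqs
  have hne : σ q ≠ 0 := fun h0 => hk (by simpa [σ] using congrFun h0 k)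
  have h2 : CP.mk (σ q) hne = q := by
    have h3 : CP.ofCoord k (CP.coord k q) = q := (CP.chart k).left_inv hqs
    conv_rhs => rw [← h3]
    exact (Projectivization.mk_eq_mk_iff' ℂ _ _ _ _).2 ⟨z k, rfl⟩
  rw [← h2]
  exact hq hne

theorem isOpen_hermSq_pos (ε : Fin (n + 1) → ℝ) (B : Set (CP n))
    (hB : ∀ z hz, CP.mk z hz ∈ B ↔ 0 < hermSq ε z) : IsOpen B := by
  rw [← CP.isQuotientMap_mk.isOpen_preimage]
  have : (fun z : {z : Fin (n + 1) → ℂ // z ≠ 0} => CP.mk z.1 z.2) ⁻¹' B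
      = {z | 0 < hermSq ε z.1} := by
    ext z
    exact hB z.1 z.2
  rw [this]
  exact isOpen_lt continuous_const ((continuous_hermSq ε).comp continuous_subtype_val)

/-- The boundary of a generalized ball consists of the null points of its Hermitian form, the
points of the radical included. -/
theorem mk_mem_frontier_genBall_iff (z : Fin (n + 1) → ℂ) (hz : z ≠ 0) :
    CP.mk z hz ∈ frontier (genBall n r s) ↔ hermSq (ballSign n r s) z = 0 := by
  set ε := ballSign n r s with hε
  have hopen : IsOpen (genBall n r s) := isOpen_hermSq_pos ε _ mk_mem_genBall_iff_hermSq
  rw [hopen.frontier_eq, Set.mem_sdiff, mk_mem_genBall_iff_hermSq, ← hε, not_lt]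
  constructor
  · rintro ⟨hcl, hle⟩
    refine le_antisymm hle ?_
    by_contra hneg
    have hev : ∀ᶠ q in 𝓝 (CP.mk z hz), q ∉ genBall n r s := by
      refine eventually_nhds_mk hz ?_
      filter_upwards [(continuous_hermSq ε).continuousAt.eventually_lt_const (not_le.1 hneg)]
        with x hx hx0
      rw [mk_mem_genBall_iff_hermSq]
      exact not_lt.2 hx.le
    exact (mem_closure_iff_frequently.1 hcl) hev
  · intro h0
    refine ⟨?_, h0.le⟩
    -- a direction in which the form becomes positive
    obtain ⟨x, hx⟩ : ∃ x : Fin (n + 1) → ℂ, ∀ t : ℝ, 0 < t → 0 < hermSq ε (z + (t : ℂ) • x) := by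
      have hzz := (hermSq_eq_zero_iff ε z).1 h0
      have hexp : ∀ (x : Fin (n + 1) → ℂ) (t : ℝ), hermSq ε (z + (t : ℂ) • x)
          = 2 * t * (herm ε x z).re + t ^ 2 * hermSq ε x := by
        intro x t
        rw [hermSq_eq_re]
        simp only [herm_add_left, herm_add_right, herm_smul_left, herm_smul_right, hzz,
          Complex.conj_ofReal]
        rw [← herm_conj ε x z, herm_self ε x]
        simp
        ring
      by_cases hpart : signPart ε 1 z = 0
      · refine ⟨Pi.single 0 1, fun t ht => ?_⟩
        have h1 : ε 0 = 1 := (ballSign_eq_one_iff 0).2 (Nat.zero_le r)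
        have h2 : z 0 = 0 := by simpa [signPart, h1] using congrFun hpart 0
        have h3 : herm ε (Pi.single 0 1) z = 0 := by
          rw [herm, Finset.sum_eq_single 0 (fun k _ hk => by simp [hk]) (by simp)]
          simp [h2]
        have h4 : hermSq ε (Pi.single 0 1) = 1 := by
          rw [hermSq_eq_re, herm_single_single]
          simp [h1]
        rw [hexp, h3, h4]
        simp
        positivity
      · refine ⟨signPart ε 1 z, fun t ht => ?_⟩
        have h1 : herm ε (signPart ε 1 z) z = (hermSq ε (signPart ε 1 z) : ℝ) := by
          rw [← herm_signPart_signPart, herm_self]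
        have h2 : 0 < hermSq ε (signPart ε 1 z) := by
          rw [hermSq_signPart, one_mul]
          obtain ⟨k, hk⟩ := Function.ne_iff.1 hpart
          have hk : signPart ε 1 z k ≠ 0 := hk
          exact Finset.sum_pos' (fun _ _ => by positivity) ⟨k, Finset.mem_univ k, by positivity⟩
        rw [hexp, h1, Complex.ofReal_re]
        positivity
    have hpos : ∀ k : ℕ, 0 < hermSq ε (z + ((1 / ((k : ℝ) + 1) : ℝ) : ℂ) • x) := fun k =>
      hx _ (by positivity)
    have hne : ∀ k : ℕ, z + ((1 / ((k : ℝ) + 1) : ℝ) : ℂ) • x ≠ 0 := by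
      intro k h
      have := hpos k
      rw [h] at this
      simp [hermSq] at this
    have ht : Tendsto (fun k : ℕ => z + ((1 / ((k : ℝ) + 1) : ℝ) : ℂ) • x) atTop (𝓝 z) := by
      have hc : Continuous fun t : ℝ => z + (t : ℂ) • x := by
        have := Complex.continuous_ofReal
        fun_prop
      have := (hc.tendsto 0).comp (tendsto_one_div_add_atTop_nhds_zero_nat (𝕜 := ℝ))
      simpa only [Function.comp_def, Complex.ofReal_zero, zero_smul, add_zero] using this
    exact mem_closure_of_tendsto (tendsto_mk hz hne ht)
      (Eventually.of_forall fun k => (mk_mem_genBall_iff_hermSq _ _).2 (hpos k))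

/-- The boundary of the ball has points outside the radical in every open set that it meets. -/
theorem exists_null_not_radical (hs : 1 ≤ s) (hrs : r + s ≤ n) {U : Set (CP n)} (hU : IsOpen U)
    (h : (U ∩ frontier (genBall n r s)).Nonempty) :
    ∃ z ∈ coneOver U, herm (ballSign n r s) z z = 0 ∧ ∃ k, ballSign n r s k ≠ 0 ∧ z k ≠ 0 := by
  obtain ⟨p, hpU, hp⟩ := h
  induction p using Projectivization.ind with
  | h z hz =>
    have hz0 := (hermSq_eq_zero_iff _ z).1 ((mk_mem_frontier_genBall_iff z hz).1 hp)
    by_cases hk : ∃ k, ballSign n r s k ≠ 0 ∧ z k ≠ 0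
    · exact ⟨z, ⟨hz, hpU⟩, hz0, hk⟩
    · push Not at hk
      set ε := ballSign n r s with hε
      set i : Fin (n + 1) := 0
      set j : Fin (n + 1) := ⟨r + 1, by omega⟩ with hj
      have hi1 : ε i = 1 := (ballSign_eq_one_iff _).2 (Nat.zero_le r)
      have hj1 : ε j = -1 := (ballSign_eq_neg_one_iff _).2 ⟨by simp [hj], by simp only [hj]; omega⟩
      have hij : i ≠ j := by
        intro h
        have := congrArg Fin.val h
        simp [i, hj] at this
      set x : Fin (n + 1) → ℂ := Pi.single i 1 + Pi.single j 1 with hx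
      have hrad : ∀ w, herm ε w z = 0 := by
        intro w
        refine Finset.sum_eq_zero fun k _ => ?_
        by_cases h0 : ε k = 0
        · simp [h0]
        · simp [hk k h0]
      have hxx : herm ε x x = 0 := by
        simp only [hx, herm_add_left, herm_add_right, herm_single_single, hi1, hj1, if_neg hij,
          if_neg hij.symm]
        simp
      have hc : Continuous fun t : ℂ => z + t • x := by fun_prop
      have hev : ∀ᶠ t : ℂ in 𝓝 0, z + t • x ∈ coneOver U :=
        hc.continuousAt.eventually ((isOpen_coneOver hU).mem_nhds (by
          simp only [zero_smul, add_zero]; exact ⟨hz, hpU⟩))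
      obtain ⟨t, htU, ht0⟩ := ((hev.filter_mono nhdsWithin_le_nhds).and
          (self_mem_nhdsWithin (s := ({0}ᶜ : Set ℂ)))).exists
      refine ⟨z + t • x, htU, ?_, i, by rw [hi1]; exact one_ne_zero, ?_⟩
      · simp only [herm_add_left, herm_add_right, herm_smul_left, herm_smul_right, hrad, hxx,
          herm_eq_zero_symm ε (hrad x)]
        simp
      · have hzi : z i = 0 := hk i (by rw [hi1]; exact one_ne_zero)
        have ht0' : t ≠ 0 := ht0
        simp [hzi, hx, hij, ht0']

end Projective

/-! ### Homogeneous lifts of holomorphic maps -/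

section Lift

variable {n m : ℕ}

theorem affineChart_mem_maximalAtlas (k : Fin (n + 1)) :
    CP.chart k ∈ IsManifold.maximalAtlas 𝓘(ℂ, Fin n → ℂ) 1 (CP n) :=
  haveI : IsManifold 𝓘(ℂ, Fin n → ℂ) 1 (CP n) := IsManifold.of_le (n := ω) le_top
  IsManifold.subset_maximalAtlas ⟨k, rfl⟩

/-- A holomorphic map between projective spaces has, near every vector, a holomorphic homogeneous
lift that only depends on the line of the vector; it is normalized by a coordinate equal to `1`. -/
theorem exists_lift {U : Set (CP n)} (hU : IsOpen U) {f : CP n → CP m}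
    (hf : MDifferentiableOn 𝓘(ℂ, Fin n → ℂ) 𝓘(ℂ, Fin m → ℂ) f U)
    {z₀ : Fin (n + 1) → ℂ} (hz₀ : z₀ ∈ coneOver U) :
    ∃ (O : Set (Fin (n + 1) → ℂ)) (i₀ : Fin (m + 1)) (F : (Fin (n + 1) → ℂ) → Fin (m + 1) → ℂ),
      IsOpen O ∧ O ⊆ coneOver U ∧ z₀ ∈ O ∧ DifferentiableOn ℂ F O ∧
      (∀ x ∈ O, F x i₀ = 1) ∧ (∀ x ∈ O, ∀ c : ℂ, c • x ∈ O → F (c • x) = F x) ∧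
      ∀ x ∈ O, ∀ (hx : x ≠ 0) (hF : F x ≠ 0), f (CP.mk x hx) = CP.mk (F x) hF := by
  obtain ⟨hz0, hzU⟩ := hz₀
  obtain ⟨k, hk⟩ := Function.ne_iff.1 hz0
  have hk : z₀ k ≠ 0 := hk
  obtain ⟨i₀, hi₀⟩ := CP.exists_rep_ne_zero (f (CP.mk z₀ hz0))
  set V : Set (CP n) := U ∩ f ⁻¹' (CP.chart i₀).source with hV
  have hVo : IsOpen V :=
    hf.continuousOn.isOpen_inter_preimage hU (CP.chart i₀).open_source
  set G : (Fin n → ℂ) → Fin m → ℂ := fun w => CP.coord i₀ (f (CP.ofCoord k w)) with hG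
  set g : (Fin (n + 1) → ℂ) → Fin n → ℂ := fun x j => x (k.succAbove j) / x k with hg
  set F : (Fin (n + 1) → ℂ) → Fin (m + 1) → ℂ := fun x =>
    i₀.insertNth (α := fun _ => ℂ) (1 : ℂ) (G (g x)) with hF
  have hmk : ∀ x (hx : x ≠ 0), x k ≠ 0 → CP.ofCoord k (g x) = CP.mk x hx := by
    intro x hx hxk
    have h1 := (CP.chart k).left_inv ((CP.rep_mk_ne_zero_iff k x hx).2 hxk)
    have h2 : CP.coord k (CP.mk x hx) = g x := CP.coord_mk k x hx
    rw [← h2]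
    exact h1
  refine ⟨coneOver V ∩ {x | x k ≠ 0}, i₀, F,
    (isOpen_coneOver hVo).inter (isOpen_ne_fun (continuous_apply k) continuous_const), ?_,
    ⟨⟨hz0, hzU, hi₀⟩, hk⟩, ?_, ?_, ?_, ?_⟩
  · rintro x ⟨⟨hx, hxV⟩, -⟩
    exact ⟨hx, hxV.1⟩
  · rintro x ⟨⟨hx, hxV⟩, hxk⟩
    have hxk : x k ≠ 0 := hxk
    have hsrc : CP.mk x hx ∈ (CP.chart k).source := (CP.rep_mk_ne_zero_iff k x hx).2 hxk
    have h1 := ((hf _ hxV.1).mdifferentiableAt (hU.mem_nhds hxV.1))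
    rw [← mdifferentiableWithinAt_univ, mdifferentiableWithinAt_iff_of_mem_maximalAtlas
      (affineChart_mem_maximalAtlas k) (affineChart_mem_maximalAtlas i₀) hsrc hxV.2] at h1
    have h2 : DifferentiableAt ℂ G (g x) := by
      have h3 := h1.2
      have h4 : (CP.chart k).extend 𝓘(ℂ, Fin n → ℂ) (CP.mk x hx) = g x := CP.coord_mk k x hx
      rw [h4] at h3
      simp only [Set.preimage_univ, Set.univ_inter, modelWithCornersSelf_coe, Set.range_id,
        differentiableWithinAt_univ] at h3
      exact h3
    have h3 : DifferentiableAt ℂ g x := by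
      refine differentiableAt_pi.2 fun j => ?_
      simp only [hg, div_eq_mul_inv]
      have h5 : ∀ l, DifferentiableAt ℂ (fun y : Fin (n + 1) → ℂ => y l) x := fun l =>
        differentiableAt_apply l x
      exact (h5 _).mul ((h5 k).fun_inv hxk)
    have h4 : DifferentiableAt ℂ (fun x => G (g x)) x := DifferentiableAt.comp x h2 h3
    refine DifferentiableAt.differentiableWithinAt ?_
    refine differentiableAt_pi.2 fun l => ?_
    rcases Fin.eq_self_or_eq_succAbove i₀ l with rfl | ⟨j, rfl⟩
    · simp [hF]
    · simp only [hF, Fin.insertNth_apply_succAbove]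
      exact differentiableAt_pi.1 h4 j
  · intro x _
    simp [hF]
  · rintro x ⟨-, hxk⟩ c ⟨-, hck⟩
    have hxk : x k ≠ 0 := hxk
    have hc : c ≠ 0 := by
      rintro rfl
      simp at hck
    have : g (c • x) = g x := by
      funext j
      simp only [hg, Pi.smul_apply, smul_eq_mul]
      exact mul_div_mul_left _ _ hc
    simp only [hF, this]
  · rintro x ⟨⟨hx, hxV⟩, hxk⟩ hx' hFx
    have h1 := (CP.chart i₀).left_inv hxV.2
    have h2 : G (g x) = CP.coord i₀ (f (CP.mk x hx)) := by
      simp only [hG]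
      rw [hmk x hx hxk]
    rw [← h1]
    change CP.ofCoord i₀ (CP.coord i₀ (f (CP.mk x hx))) = _
    simp only [hF, h2]
    rfl

end Lift

/-! ### From a local to a global description of the map -/

section Globalization

variable {n m : ℕ}

/-- The map `f` is at `q` the projectivization of the linear map `A`, in the weak sense that
homogeneous coordinates of `f q` are proportional to the image under `A` of homogeneous coordinates
of `q`. This image is allowed to vanish, so that the condition is closed. -/
def AgreesAt (A : (Fin (n + 1) → ℂ) →ₗ[ℂ] (Fin (m + 1) → ℂ)) (f : CP n → CP m) (q : CP n) : Prop :=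
  ∀ i j, (f q).rep i * A q.rep j = (f q).rep j * A q.rep i

theorem agreesAt_mk_iff (A : (Fin (n + 1) → ℂ) →ₗ[ℂ] (Fin (m + 1) → ℂ)) {f : CP n → CP m}
    {x : Fin (n + 1) → ℂ} (hx : x ≠ 0) {w : Fin (m + 1) → ℂ} (hw : w ≠ 0)
    (h : f (CP.mk x hx) = CP.mk w hw) :
    AgreesAt A f (CP.mk x hx) ↔ ∀ i j, w i * A x j = w j * A x i := by
  obtain ⟨a, ha, hxa⟩ := CP.exists_rep_eq x hx
  obtain ⟨b, hb, hwb⟩ := CP.exists_rep_eq w hw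
  unfold AgreesAt
  rw [h, hxa, hwb]
  simp only [map_smul, Pi.smul_apply, smul_eq_mul]
  refine forall₂_congr fun i j => ⟨fun h => ?_, fun h => ?_⟩
  · refine mul_left_cancel₀ (mul_ne_zero ha hb) ?_
    linear_combination h
  · linear_combination a * b * h

/-- The identity theorem: agreement with a linear map spreads from an open subset over a connected
open set. The vanishing of the image under the linear map does not stop it. -/
theorem agreesAt_of_eventually {U : Set (CP n)} (hU : IsOpen U) (hUc : IsPreconnected U)
    {f : CP n → CP m} (hf : MDifferentiableOn 𝓘(ℂ, Fin n → ℂ) 𝓘(ℂ, Fin m → ℂ) f U)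
    (A : (Fin (n + 1) → ℂ) →ₗ[ℂ] (Fin (m + 1) → ℂ)) {p : CP n} (hp : p ∈ U)
    (h : ∀ᶠ q in 𝓝 p, AgreesAt A f q) : ∀ q ∈ U, AgreesAt A f q := by
  set S : Set (CP n) := {q | ∀ᶠ q' in 𝓝 q, AgreesAt A f q'} with hS
  have hSo : IsOpen S := isOpen_setOfPred_eventually_nhds
  suffices hUS : U ⊆ S from fun q hq => (hUS hq).self_of_nhds
  refine hUc.subset_of_closure_inter_subset hSo ⟨p, hp, h⟩ ?_
  rintro q ⟨hqS, hqU⟩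
  induction q using Projectivization.ind with
  | h z hz =>
    obtain ⟨O, i₀, F, hO, hOU, hzO, hF, hi₀, -, hfF⟩ := exists_lift hU hf ⟨hz, hqU⟩
    obtain ⟨ρ, hρ, hρO⟩ := Metric.isOpen_iff.1 hO z hzO
    have hF0 : ∀ x ∈ O, F x ≠ 0 := fun x hx h0 => by
      have := hi₀ x hx
      rw [h0] at this
      exact zero_ne_one this
    have hx0 : ∀ x ∈ O, x ≠ 0 := fun x hx => (hOU hx).choose
    have hiff : ∀ x (hx : x ∈ O), AgreesAt A f (CP.mk x (hx0 x hx)) ↔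
        ∀ i j, F x i * A x j = F x j * A x i := fun x hx =>
      agreesAt_mk_iff A (hx0 x hx) (hF0 x hx) (hfF x hx _ _)
    -- the ball contains a point over the open set on which the identity is already known
    obtain ⟨x₁, hx₁, hx₁S⟩ : ∃ x ∈ Metric.ball z ρ, ∃ hx : x ≠ 0, CP.mk x hx ∈ S := by
      by_contra hno
      push Not at hno
      have hev : ∀ᶠ q in 𝓝 (CP.mk z hz), q ∉ S := by
        refine eventually_nhds_mk hz ?_
        filter_upwards [Metric.ball_mem_nhds z hρ] with x hx hx0
        exact hno x hx hx0
      exact (mem_closure_iff_frequently.1 hqS) hev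
    obtain ⟨hx₁0, hx₁S⟩ := hx₁S
    have hev : ∀ᶠ x in 𝓝 x₁, ∀ i j, F x i * A x j = F x j * A x i := by
      have h1 : coneOver S ∈ 𝓝 x₁ := (isOpen_coneOver hSo).mem_nhds ⟨hx₁0, hx₁S⟩
      filter_upwards [h1, hO.mem_nhds (hρO hx₁)] with x hxS hxO
      exact (hiff x hxO).1 hxS.choose_spec.self_of_nhds
    have hball : ∀ x ∈ Metric.ball z ρ, ∀ i j, F x i * A x j = F x j * A x i := by
      intro x hx i j
      have hd : DifferentiableOn ℂ (fun x => F x i * A x j - F x j * A x i) (Metric.ball z ρ) := by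
        have h1 : ∀ i, DifferentiableOn ℂ (fun x => F x i) (Metric.ball z ρ) := fun i =>
          differentiableOn_pi.1 (hF.mono hρO) i
        have h2 : ∀ i, Differentiable ℂ (fun x => A x i) := fun i =>
          (((LinearMap.proj i).comp A).toContinuousLinearMap).differentiable
        exact ((h1 i).mul (h2 j).differentiableOn).sub ((h1 j).mul (h2 i).differentiableOn)
      refine sub_eq_zero.1 (eqOn_zero_of_convex Metric.isOpen_ball (convex_ball z ρ) hd hx₁ ?_ hx)
      filter_upwards [hev] with y hy
      exact sub_eq_zero.2 (hy i j)
    refine eventually_nhds_mk hz ?_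
    filter_upwards [Metric.ball_mem_nhds z hρ] with x hx _
    exact (hiff x (hρO hx)).2 (hball x hx)

/-- A linear map that agrees with a holomorphic map on `U` does not vanish over `U` when two
orthogonal non-null vectors have orthogonal non-null images: otherwise the map would have two
different limits along them. -/
theorem map_ne_zero_of_agreesAt {U : Set (CP n)} (hU : IsOpen U) {f : CP n → CP m}
    (hf : MDifferentiableOn 𝓘(ℂ, Fin n → ℂ) 𝓘(ℂ, Fin m → ℂ) f U)
    {A : (Fin (n + 1) → ℂ) →ₗ[ℂ] (Fin (m + 1) → ℂ)} (hA : ∀ q ∈ U, AgreesAt A f q)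
    {ε : Fin (m + 1) → ℝ} {x y : Fin (n + 1) → ℂ} (hxx : herm ε (A x) (A x) ≠ 0)
    (hyy : herm ε (A y) (A y) ≠ 0) (hxy : herm ε (A x) (A y) = 0) {z : Fin (n + 1) → ℂ}
    (hz : z ∈ coneOver U) : A z ≠ 0 := by
  intro hAz
  obtain ⟨O, i₀, F, hO, hOU, hzO, hF, hi₀, -, hfF⟩ := exists_lift hU hf hz
  have key : ∀ v, A v = A v i₀ • F z := by
    intro v
    have hc : Continuous fun t : ℂ => z + t • v := by fun_prop
    have hev : ∀ᶠ t in 𝓝[≠] (0 : ℂ), ∀ j, A v j = F (z + t • v) j * A v i₀ := by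
      have h1 : ∀ᶠ t in 𝓝 (0 : ℂ), z + t • v ∈ O :=
        hc.continuousAt.eventually (hO.mem_nhds (by simpa using hzO))
      filter_upwards [h1.filter_mono nhdsWithin_le_nhds, self_mem_nhdsWithin] with t ht ht0 j
      have ht0 : t ≠ 0 := ht0
      obtain ⟨hne, hmem⟩ := hOU ht
      have hFne : F (z + t • v) ≠ 0 := fun h0 => by
        have := hi₀ _ ht
        rw [h0] at this
        exact zero_ne_one this
      have h2 := (agreesAt_mk_iff A hne hFne (hfF _ ht hne hFne)).1 (hA _ hmem) i₀ j
      rw [hi₀ _ ht, map_add, hAz, zero_add, map_smul, Pi.smul_apply, Pi.smul_apply, smul_eq_mul,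
        smul_eq_mul] at h2
      exact mul_left_cancel₀ ht0 (by linear_combination h2)
    funext j
    have hcF : Tendsto (fun t : ℂ => F (z + t • v) j * A v i₀) (𝓝[≠] 0) (𝓝 (F z j * A v i₀)) := by
      have h1 : ContinuousAt F z := (hF.continuousOn).continuousAt (hO.mem_nhds hzO)
      have h2 : Tendsto (fun t : ℂ => z + t • v) (𝓝[≠] 0) (𝓝 z) := by
        have := (hc.tendsto 0).mono_left (nhdsWithin_le_nhds (s := {0}ᶜ))
        simpa using this
      exact ((tendsto_pi_nhds.1 (h1.tendsto.comp h2)) j).mul_const _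
    have h3 := tendsto_nhds_unique (tendsto_const_nhds.congr' (hev.mono fun t ht => ht j)) hcF
    rw [h3, Pi.smul_apply, smul_eq_mul, mul_comm]
  rw [key x, herm_smul_left, herm_smul_right] at hxx
  rw [key y, herm_smul_left, herm_smul_right] at hyy
  rw [key x, key y, herm_smul_left, herm_smul_right] at hxy
  simp only [ne_eq, mul_eq_zero, not_or] at hxx hyy hxy
  tauto

theorem eq_mk_of_agreesAt {A : (Fin (n + 1) → ℂ) →ₗ[ℂ] (Fin (m + 1) → ℂ)} {f : CP n → CP m}
    {z : Fin (n + 1) → ℂ} (hz : z ≠ 0) (h : AgreesAt A f (CP.mk z hz)) (hA : A z ≠ 0) :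
    f (CP.mk z hz) = CP.mk (A z) hA := by
  have h1 := (agreesAt_mk_iff A hz (f (CP.mk z hz)).rep_nonzero
    (f (CP.mk z hz)).mk_rep.symm).1 h
  set w := (f (CP.mk z hz)).rep with hw
  obtain ⟨j, hj⟩ := Function.ne_iff.1 hA
  have hj : A z j ≠ 0 := hj
  rw [← (f (CP.mk z hz)).mk_rep]
  refine (Projectivization.mk_eq_mk_iff' ℂ _ _ _ _).2 ⟨w j / A z j, ?_⟩
  funext i
  rw [Pi.smul_apply, smul_eq_mul, div_mul_eq_mul_div, div_eq_iff hj]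
  exact (h1 i j).symm

/-- The boundary conditions determine `f` as the projectivization of a linear isometry. -/
theorem exists_isometry_agreesAt {r s r' : ℕ} (hrs : r + s ≤ n) (hm : r' ≤ m)
    (hr' : 1 ≤ r') (hr'r : r' ≤ r) (hs : 2 ≤ s) {U : Set (CP n)} (hU : IsOpen U)
    (hUc : IsPreconnected U) (hUbd : (U ∩ frontier (genBall n r s)).Nonempty) {f : CP n → CP m}
    (hf : MDifferentiableOn 𝓘(ℂ, Fin n → ℂ) 𝓘(ℂ, Fin m → ℂ) f U)
    (hball : Set.MapsTo f (U ∩ genBall n r s) (ordBall m r'))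
    (hbd : Set.MapsTo f (U ∩ frontier (genBall n r s)) (frontier (ordBall m r'))) :
    ∃ A : (Fin (n + 1) → ℂ) →ₗ[ℂ] (Fin (m + 1) → ℂ),
      (∀ x w, herm (ballSign m r' (m - r')) (A x) (A w) = herm (ballSign n r s) x w) ∧
      ∀ q ∈ U, AgreesAt A f q := by
  rw [ordBall_eq_genBall (Nat.add_sub_cancel' hm)] at hball hbd
  obtain ⟨z₀, hz₀, hnull, hz₀r⟩ := exists_null_not_radical (by omega) hrs hU hUbd
  obtain ⟨O, i₀, F, hO, hOU, hzO, hF, hi₀, hhom, hfF⟩ := exists_lift hU hf hz₀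
  have hF0 : ∀ x ∈ O, F x ≠ 0 := fun x hx h0 => by
    have := hi₀ x hx
    rw [h0] at this
    exact zero_ne_one this
  have h0 : ballSign n r s 0 = 1 := (ballSign_eq_one_iff _).2 (Nat.zero_le r)
  have h1 : ballSign n r s ⟨1, by omega⟩ = 1 := (ballSign_eq_one_iff _).2 (by simp only; omega)
  have hm1 : ballSign n r s ⟨r + 1, by omega⟩ = -1 :=
    (ballSign_eq_neg_one_iff _).2 ⟨by simp only; omega, by simp only; omega⟩
  have hm2 : ballSign n r s ⟨r + 2, by omega⟩ = -1 :=
    (ballSign_eq_neg_one_iff _).2 ⟨by simp only; omega, by simp only; omega⟩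
  obtain ⟨A, hA, hAF⟩ := exists_isometry_near (ε := ballSign n r s)
    (ε' := ballSign m r' (m - r')) ballSign_cases
    (fun i _ => by
      by_cases hi : i = 0
      · exact ⟨⟨1, by omega⟩, by rw [hi]; intro h; simpa using congrArg Fin.val h, h1⟩
      · exact ⟨0, hi, h0⟩)
    (fun i _ => by
      by_cases hi : i = ⟨r + 1, by omega⟩
      · exact ⟨⟨r + 2, by omega⟩, by rw [hi]; intro h; simpa using congrArg Fin.val h, hm2⟩
      · exact ⟨⟨r + 1, by omega⟩, hi, hm1⟩)
    (by rw [card_ballSign_eq_one (by omega)]; omega)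
    (fun i h => by
      have := (ballSign_eq_zero_iff i).1 h
      have := i.2
      omega)
    (by rw [card_ballSign_eq_one (by omega), card_ballSign_pos (by omega)]; omega)
    hO hF i₀ hi₀ hhom
    (fun z hz hzn => by
      obtain ⟨hz0, hzU⟩ := hOU hz
      have := hbd ⟨hzU, (mk_mem_frontier_genBall_iff z hz0).2 ((hermSq_eq_zero_iff _ z).2 hzn)⟩
      rw [hfF z hz hz0 (hF0 z hz), mk_mem_frontier_genBall_iff] at this
      exact (hermSq_eq_zero_iff _ _).1 this)
    (fun z hz hzp => by
      obtain ⟨hz0, hzU⟩ := hOU hz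
      have := hball ⟨hzU, (mk_mem_genBall_iff_hermSq z hz0).2 hzp⟩
      rwa [hfF z hz hz0 (hF0 z hz), mk_mem_genBall_iff_hermSq] at this)
    hzO hnull hz₀r
  refine ⟨A, hA, ?_⟩
  obtain ⟨hz0, hzU⟩ := hz₀
  refine agreesAt_of_eventually hU hUc hf A hzU (eventually_nhds_mk hz0 ?_)
  filter_upwards [hAF, hO.mem_nhds hzO] with x hx hxO hx0
  rw [agreesAt_mk_iff A hx0 (hF0 x hxO) (hfF x hxO hx0 _)]
  intro i j
  rw [hx]
  simp only [Pi.smul_apply, smul_eq_mul]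
  ring

end Globalization

/-! ### Degeneracy of the differential and the rigidity theorem -/

section Rigidity

variable {n m : ℕ}

/-- If `f` is constant along a line in the preferred affine chart at `p`, then its differential at
`p` has a kernel. -/
theorem not_injective_mfderiv_of_eventually_const {f : CP n → CP m} {p : CP n}
    (hf : MDifferentiableAt 𝓘(ℂ, Fin n → ℂ) 𝓘(ℂ, Fin m → ℂ) f p) {h : Fin n → ℂ} (h0 : h ≠ 0)
    (hc : ∀ᶠ t : ℂ in 𝓝 0, f ((chartAt (Fin n → ℂ) p).symm (chartAt (Fin n → ℂ) p p + t • h)) = f p) :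
    ¬ Function.Injective (mfderiv 𝓘(ℂ, Fin n → ℂ) 𝓘(ℂ, Fin m → ℂ) f p) := by
  intro hinj
  set D : (Fin n → ℂ) →L[ℂ] (Fin m → ℂ) := mfderiv 𝓘(ℂ, Fin n → ℂ) 𝓘(ℂ, Fin m → ℂ) f p with hD
  set e := chartAt (Fin n → ℂ) p with he
  set g : (Fin n → ℂ) → Fin m → ℂ :=
    writtenInExtChartAt 𝓘(ℂ, Fin n → ℂ) 𝓘(ℂ, Fin m → ℂ) p f with hg
  have h1 : HasFDerivAt g D (e p) := by
    have h := hf.hasMFDerivAt.2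
    simp only [modelWithCornersSelf_coe, Set.range_id] at h
    exact (hasFDerivWithinAt_univ (f := g) (f' := D) (x := e p)).1 h
  have h2 : HasDerivAt (fun t : ℂ => e p + t • h) h 0 := by
    simpa using ((hasDerivAt_id (0 : ℂ)).smul_const h).const_add (e p)
  have h3 : HasDerivAt (fun t : ℂ => g (e p + t • h)) (D h) 0 := by
    have h1' : HasFDerivAt g D (e p + (0 : ℂ) • h) := by simpa using h1
    exact h1'.comp_hasDerivAt (0 : ℂ) h2
  have h4 : (fun t : ℂ => g (e p + t • h)) =ᶠ[𝓝 0] fun _ => chartAt (Fin m → ℂ) (f p) (f p) := by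
    filter_upwards [hc] with t ht
    change chartAt (Fin m → ℂ) (f p) (f (e.symm (e p + t • h))) = _
    rw [ht]
  have h5 : D h = 0 := h3.unique ((hasDerivAt_const (0 : ℂ) _).congr_of_eventuallyEq h4)
  exact h0 (hinj (h5.trans (map_zero D).symm))

/-- Through a point outside the centre of the truncation passes a line in the affine chart that the
truncation contracts to a point. -/
theorem exists_direction_truncate {k : ℕ} (hk : k < n) (c : Fin (n + 1)) {w : Fin n → ℂ}
    (hw : truncate m k (c.insertNth (α := fun _ => ℂ) (1 : ℂ) w) ≠ 0) :
    ∃ h : Fin n → ℂ, h ≠ 0 ∧ ∀ t : ℂ, ∃ a : ℂ,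
      truncate m k (c.insertNth (α := fun _ => ℂ) (1 : ℂ) (w + t • h)) =
        a • truncate m k (c.insertNth (α := fun _ => ℂ) (1 : ℂ) w) := by
  by_cases hc : c.val ≤ k
  · have hlast : Fin.last n ≠ c := fun h => by
      have := congrArg Fin.val h
      simp at this
      omega
    obtain ⟨j, hj⟩ := Fin.exists_succAbove_eq hlast
    refine ⟨Pi.single j 1, by simp, fun t => ⟨1, ?_⟩⟩
    rw [one_smul]
    funext i
    unfold truncate
    split_ifs with hi
    · generalize hl : (⟨i, hi.2⟩ : Fin (n + 1)) = l
      have hlv : l.val ≤ k := by rw [← hl]; exact hi.1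
      rcases Fin.eq_self_or_eq_succAbove c l with rfl | ⟨j', rfl⟩
      · simp
      · have hjj : j' ≠ j := by
          rintro rfl
          rw [hj, Fin.val_last] at hlv
          omega
        simp [hjj]
    · rfl
  · have hkey : ∀ t : ℂ, truncate m k (c.insertNth (α := fun _ => ℂ) (1 : ℂ) (w + t • w)) =
        (1 + t) • truncate m k (c.insertNth (α := fun _ => ℂ) (1 : ℂ) w) := by
      intro t
      funext i
      simp only [truncate, Pi.smul_apply, smul_eq_mul]
      split_ifs with hi
      · generalize hl : (⟨i, hi.2⟩ : Fin (n + 1)) = l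
        have hlv : l.val ≤ k := by rw [← hl]; exact hi.1
        rcases Fin.eq_self_or_eq_succAbove c l with rfl | ⟨j', rfl⟩
        · exact absurd hlv hc
        · simp
          ring
      · simp
    refine ⟨w, ?_, fun t => ⟨1 + t, hkey t⟩⟩
    rintro rfl
    have := hkey (-1)
    simp only [smul_zero, add_zero, add_neg_cancel, zero_smul] at this
    exact hw this

theorem not_injective_mfderiv_of_smul_eq_truncate {U : Set (CP n)} (hU : IsOpen U) {k : ℕ}
    (hk : k < n) {f : CP n → CP m}
    (hf : MDifferentiableOn 𝓘(ℂ, Fin n → ℂ) 𝓘(ℂ, Fin m → ℂ) f U)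
    {Φ : LinearMap.GeneralLinearGroup ℂ (Fin (m + 1) → ℂ)}
    (hΦ : ∀ (z : Fin (n + 1) → ℂ) (hz : z ≠ 0), CP.mk z hz ∈ U →
      ∃ hw : truncate m k z ≠ 0, Φ • f (CP.mk z hz) = CP.mk (truncate m k z) hw)
    {p : CP n} (hp : p ∈ U) :
    ¬ Function.Injective (mfderiv 𝓘(ℂ, Fin n → ℂ) 𝓘(ℂ, Fin m → ℂ) f p) := by
  set e := chartAt (Fin n → ℂ) p with he
  set c : Fin (n + 1) := (CP.exists_rep_ne_zero p).choose with hc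
  have hmem : p ∈ e.source := mem_chart_source _ p
  have hleft : CP.ofCoord c (e p) = p := e.left_inv hmem
  have hne : ∀ w : Fin n → ℂ, c.insertNth (α := fun _ => ℂ) (1 : ℂ) w ≠ 0 := fun w h =>
    one_ne_zero (α := ℂ) (by simpa using congrFun h c)
  obtain ⟨hw, hpw⟩ := hΦ _ (hne (e p)) (by rw [← hleft] at hp; exact hp)
  obtain ⟨h, h0, hh⟩ := exists_direction_truncate hk c hw
  refine not_injective_mfderiv_of_eventually_const
    ((hf p hp).mdifferentiableAt (hU.mem_nhds hp)) h0 ?_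
  have hcont : ContinuousAt (fun t : ℂ => e.symm (e p + t • h)) 0 := by
    have h1 : ContinuousAt e.symm (e p + (0 : ℂ) • h) := by
      simpa using e.continuousAt_symm (e.map_source hmem)
    have h2 : Continuous fun t : ℂ => e p + t • h := by fun_prop
    exact ContinuousAt.comp (f := fun t : ℂ => e p + t • h) h1 h2.continuousAt
  have hev : ∀ᶠ t : ℂ in 𝓝 0, e.symm (e p + t • h) ∈ U := by
    refine hcont.eventually (hU.mem_nhds ?_)
    simpa [e.left_inv hmem] using hp
  filter_upwards [hev] with t ht
  obtain ⟨hwt, hft⟩ := hΦ _ (hne (e p + t • h)) ht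
  obtain ⟨a, ha⟩ := hh t
  have hfp : Φ • f p = CP.mk _ hw := by
    rw [← hpw]
    exact congrArg (fun q => Φ • f q) hleft.symm
  refine smul_left_cancel Φ ?_
  rw [hfp]
  refine Eq.trans hft ?_
  exact (Projectivization.mk_eq_mk_iff' ℂ _ _ _ _).2 ⟨a, ha.symm⟩

theorem ofLinearEquiv_symm_mem_ballAut {r : ℕ} (hr : r ≤ m)
    (B : (Fin (m + 1) → ℂ) ≃ₗ[ℂ] (Fin (m + 1) → ℂ))
    (hB : ∀ x, hermSq (ballSign m r (m - r)) (B x) = hermSq (ballSign m r (m - r)) x) :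
    LinearMap.GeneralLinearGroup.ofLinearEquiv B.symm ∈ ballAut m r := by
  rw [ballAut, MulAction.mem_stabilizer_iff]
  ext p
  rw [Set.mem_smul_set_iff_inv_smul_mem, ordBall_eq_genBall (Nat.add_sub_cancel' hr)]
  induction p using Projectivization.ind with
  | h z hz =>
    rw [← LinearMap.GeneralLinearGroup.ofLinearEquiv_inv, Projectivization.smul_mk]
    have h1 : LinearMap.GeneralLinearGroup.ofLinearEquiv B.symm⁻¹ • z = B z := rfl
    change CP.mk _ _ ∈ _ ↔ CP.mk _ _ ∈ _
    rw [mk_mem_genBall_iff_hermSq, mk_mem_genBall_iff_hermSq, h1, hB]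

end Rigidity

theorem theorem1p1 (n m r s r' : ℕ) (hrs : r + s ≤ n) (hm : r' ≤ m)
    (hr' : 1 ≤ r') (hr'r : r' ≤ r) (hlt : r < s)
    (U : Set (CP n)) (hUopen : IsOpen U) (hUconn : IsConnected U)
    (hUbd : (U ∩ frontier (genBall n r s)).Nonempty)
    (f : CP n → CP m)
    (hf : MDifferentiableOn 𝓘(ℂ, Fin n → ℂ) 𝓘(ℂ, Fin m → ℂ) f U)
    (hball : Set.MapsTo f (U ∩ genBall n r s) (ordBall m r'))
    (hbd : Set.MapsTo f (U ∩ frontier (genBall n r s)) (frontier (ordBall m r'))) :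
    r = r' ∧ r + s ≤ m ∧
    (∃ Φ ∈ ballAut m r', ∀ (z : Fin (n + 1) → ℂ) (hz : z ≠ 0), CP.mk z hz ∈ U →
      ∃ hw : truncate m (r + s) z ≠ 0,
        Φ • f (CP.mk z hz) = CP.mk (truncate m (r + s) z) hw) ∧
    (r + s < n → ∀ p ∈ U, ¬ Function.Injective
      (mfderiv 𝓘(ℂ, Fin n → ℂ) 𝓘(ℂ, Fin m → ℂ) f p)) := by
  obtain ⟨A, hA, hAf⟩ := exists_isometry_agreesAt hrs hm hr' hr'r (by omega) hUopen
    hUconn.isPreconnected hUbd hf hball hbd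
  obtain ⟨hrr, hrsm, B, hB, hAB⟩ := exists_isometry_truncate hrs hm hr'r A hA
  have hA0 : ∀ z ∈ coneOver U, A z ≠ 0 := fun z hz => by
    have h0 : ballSign n r s 0 = 1 := (ballSign_eq_one_iff _).2 (Nat.zero_le r)
    have h1 : ballSign n r s ⟨1, by omega⟩ = 1 := (ballSign_eq_one_iff _).2 (by simp only; omega)
    have h01 : (0 : Fin (n + 1)) ≠ ⟨1, by omega⟩ := fun h => by simpa using congrArg Fin.val h
    refine map_ne_zero_of_agreesAt hUopen hf hAf (ε := ballSign m r' (m - r'))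
      (x := Pi.single 0 1) (y := Pi.single ⟨1, by omega⟩ 1) ?_ ?_ ?_ hz
    · rw [hA, herm_single_single, h0]; simp
    · rw [hA, herm_single_single, h1]; simp
    · rw [hA, herm_single_single, if_neg h01]
  have hΦ : ∀ (z : Fin (n + 1) → ℂ) (hz : z ≠ 0), CP.mk z hz ∈ U →
      ∃ hw : truncate m (r + s) z ≠ 0,
        LinearMap.GeneralLinearGroup.ofLinearEquiv B.symm • f (CP.mk z hz)
          = CP.mk (truncate m (r + s) z) hw := by
    intro z hz hzU
    have hAz := hA0 z ⟨hz, hzU⟩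
    refine ⟨fun h => hAz (by rw [hAB, h, map_zero]), ?_⟩
    rw [eq_mk_of_agreesAt hz (hAf _ hzU) hAz, Projectivization.smul_mk]
    have h1 : LinearMap.GeneralLinearGroup.ofLinearEquiv B.symm • A z = truncate m (r + s) z := by
      simp [hAB]
    congr 1
  exact ⟨hrr, hrsm, ⟨_, ofLinearEquiv_symm_mem_ballAut hm B hB, hΦ⟩, fun hn p hp =>
    not_injective_mfderiv_of_smul_eq_truncate hUopen hn hf hΦ hp⟩
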